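/- **Setting.** A constraint map-germ is a pair of $C^\infty$ map-germs $g=(g_1,\dots,g_q):(\mathbb R^n,0)\to\mathbb R^q$, $h=(h_1,\dots,h_r):(\mathbb R^n,0)\to(\mathbb R^r,0)$ with $g_i(0)\le 0$ for all $i$. Put $I=\{i: g_i(0)=0\}$, $M(g,h)=\{x: g_i(x)\le0,\ h_j(x)=0 \text{ for all } i,j\}$, $$C^+=\{d: \exists\, x_m\in M(g,h),\ x_m\to0,\ t_m>0,\ t_mx_m\to d\},\qquad L^+=\{d: dg_{i,0}(d)\le0\ (i\in I),\ dh_0(d)=0\},$$ and $X^\circ=\{v: v\cdot d\le0\ \forall d\in X\}$. LICQ: the differentials at $0$ of $g_i$ $(i\in I)$ and of all $h_j$ are linearly independent. MFCQ: the $dh_{j,0}$ are linearly independent and some $d$ satisfies $dg_{i,0}(d)<0$ $(i\in I)$ and $dh_0(d)=0$. ACQ: $C^+=L^+$. GCQ: $(C^+)^\circ=(L^+)^\circ$. $(g,h)$ and $(g',h')$ (with the same $n,q,r$) are $\mathcal K[G]$-equivalent if, near $0$, $g(x)=C(x)g'(\varphi(x))+B(x)h'(\varphi(x))$ and $h(x)=A(x)h'(\varphi(x))$,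 where $\varphi$ is a diffeomorphism-germ of $(\mathbb R^n,0)$, $A,B,C$ are smooth matrix-valued germs, $A(x)$ is invertible, and $C(x)$ is a diagonal matrix with positive diagonal times a permutation matrix. A class is a $\mathcal K[G]$-equivalence class; a class satisfies a condition if every germ in it does, and violates it if no germ in it does. All $\epsilon_j,\epsilon'_j,\epsilon_{ij},\delta_j$ are in $\{1,-1\}$, and $\alpha,\alpha_{ij}=\alpha_{ji}\in\mathbb R$. Condition $(\ast)$: $4\delta_1\delta_2-\alpha^2\ne0$. Condition $(\ast\ast)$: $4\delta_i\delta_j-\alpha_{ij}^2\neq0$ for $i\ne j$ in $\{1,2,3\}$ and $4\delta_1\delta_2\delta_3+\alpha_{12}\alpha_{13}\alpha_{23}-\delta_3\alpha_{12}^2-\delta_2\alpha_{13}^2-\delta_1\alpha_{23}^2\ne0$. In every normal form $n$ is large enough that the sum $\sum_j\epsilon_jx_j^2$ is nonempty (in type E2 below, $n\ge3$ suffices). **Theorem (Generic CQ classification).** **(I) LICQ.** A constraint map-germ $(g,h)$ satisfies LICQ if and only if, with $s=|I|$, one has $s+r\le n$ and $(g_I,h)$ is $\mathcal K[G]$-equivalent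 to the regular germ $\big((x_1,\dots,x_s),(x_{s+1},\dots,x_{s+r})\big)$. In particular every class listed in (III)–(V) violates LICQ. **(II) MFCQ.** If the $dh_{j,0}$ are linearly dependent, then MFCQ fails. In particular all classes in (III) and (V) violate MFCQ. A class in (IV) satisfies MFCQ if $l_1>0$ and violates it if $l_1=0$. **(III) One equality, no inequality constraint.** All the following classes violate ACQ. They satisfy GCQ under the stated condition, and violate GCQ otherwise. - E(1,k), $2\le k\le5$: $h=x_1^k+\sum_{j=2}^n\epsilon_jx_j^2$. GCQ: ($k=2$ and some $\epsilon_j=-1$, $2\le j\le n$) or ($k\ge3$ and $\{\epsilon_2,\dots,\epsilon_n\}=\{1,-1\}$). - E2: $h=x_1^3+\epsilon_2x_1x_2^2+x_3^2+\sum_{j=4}^n\epsilon_jx_j^2$. GCQ: some $\epsilon_j=-1$, $4\le j\le n$. **(IV) Inequality constraints only.** $g=\big(x_1,\dots,x_{q-1},\ \sum_{j=1}^{l_1}x_j-\sum_{j=l_1+1}^{l}x_j+\tilde g\big)$ with $l\ge 0$ and $0\le l_1\le\lceil l/2\rceil$, and $\tilde g$, $l$ as below. If $l_1>0$, ACQ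 and GCQ hold. If $l_1=0$, each of ACQ and GCQ holds under the stated condition and fails otherwise. - (1,k), $2\le k\le5$, $l=q-1$: $\tilde g=\epsilon_qx_q^k+\sum_{j\ge q+1}\epsilon_jx_j^2$. ACQ: $\epsilon_q=\dots=\epsilon_n=-1$, or ($k\ge3$ and $\epsilon_{q+1}=\dots=\epsilon_n=-1$). GCQ: ($k=2$ and $(\epsilon_q,\dots,\epsilon_n)\ne(1,\dots,1)$) or $(\epsilon_{q+1},\dots,\epsilon_n)\neq(1,\dots,1)$. - (2), $l=q-1$: $\tilde g=x_q^3+\epsilon_{q+1}x_qx_{q+1}^2+\sum_{j\ge q+2}\epsilon_jx_j^2$. ACQ: $\epsilon_{q+2}=\dots=\epsilon_n=-1$. GCQ: $(\epsilon_{q+2},\dots,\epsilon_n)\ne(1,\dots,1)$. - (3,k), $2\le k\le4$, $l=q-2$: $\tilde g=\epsilon_{q-1}x_{q-1}^k+\sum_{j\ge q}\epsilon_jx_j^2$. ACQ: $\epsilon_{q-1}=\dots=\epsilon_n=-1$, or ($k\ge3$ and $\epsilon_q=\dots=\epsilon_n=-1$). GCQ: $(\epsilon_q,\dots,\epsilon_n)\ne(1,\dots,1)$.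 - (4,k), $k=3,4$, $l=q-2$: $\tilde g=\epsilon_qx_q^k+x_{q-1}x_q+\sum_{j\ge q+1}\epsilon_jx_j^2$. ACQ: never. GCQ: $(\epsilon_{q+1},\dots,\epsilon_n)\ne(1,\dots,1)$ or $\epsilon_q=(-1)^{k+1}$. - (5), $l=q-2$: $\tilde g=\epsilon_{q-1}x_{q-1}^2+x_q^3+\sum_{j\ge q+1}\epsilon_jx_j^2$. ACQ: $\epsilon_{q-1}=\epsilon_{q+1}=\dots=\epsilon_n=-1$. GCQ: $(\epsilon_{q+1},\dots,\epsilon_n)\ne(1,\dots,1)$. - (6), $l=q-3$, $(\ast)$: $\tilde g=\delta_1x_{q-1}^2+\delta_2x_{q-2}^2+\alpha x_{q-2}x_{q-1}+\sum_{j\ge q}\epsilon_jx_j^2$. ACQ: $\delta_1=\delta_2=-1$, $\alpha<2$, $\epsilon_q=\dots=\epsilon_n=-1$. GCQ: $(\epsilon_q,\dots,\epsilon_n)\ne(1,\dots,1)$. - (7), $l=q-3$: $\tilde g=\epsilon_{q-2}(x_{q-2}+\epsilon'_{q-1}x_{q-1})^2+\epsilon_{q-1}x_{q-1}^3+\sum_{j\ge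 q}\epsilon_jx_j^2$. ACQ: $\epsilon_{q-2}=\epsilon_q=\dots=\epsilon_n=-1$. GCQ: $(\epsilon_q,\dots,\epsilon_n)\ne(1,\dots,1)$. - (8), $l=q-3$: $\tilde g=\epsilon_{q-2}x_{q-2}^3+\epsilon_{q-1}x_{q-1}^2+\epsilon'_{q-1}x_{q-2}x_{q-1}+\sum_{j\ge q}\epsilon_jx_j^2$. ACQ: $\epsilon_{q-1}=\epsilon'_{q-1}=\epsilon_q=\dots=\epsilon_n=-1$. GCQ: $(\epsilon_q,\dots,\epsilon_n)\ne(1,\dots,1)$. - (9), $l=q-3$: $\tilde g=x_q^3+\epsilon_{01}x_{q-1}x_q+\epsilon_{02}x_{q-2}x_q+\epsilon_{12}x_{q-2}x_{q-1}+\sum_{j\ge q+1}\epsilon_jx_j^2$. ACQ: never. GCQ: $(\epsilon_{q+1},\dots,\epsilon_n)\ne(1,\dots,1)$ or $\epsilon_{01}=1$ or $\epsilon_{02}=1$. - (10), $l=q-4$, $(\ast\ast)$: $\tilde g=\sum_{j=1}^3\delta_jx_{q-4+j}^2+\sum_{1\le i<j\le3}\alpha_{ij}x_{q-4+i}x_{q-4+j}+\epsilon_0x_{q-3}x_{q-2}x_{q-1}+\sum_{j\ge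 q}\epsilon_jx_j^2$. ACQ: $\delta_1=\delta_2=\delta_3=-1$, $\epsilon_q=\dots=\epsilon_n=-1$, and for some distinct $i,j,k\in\{1,2,3\}$ either ($\alpha_{ij}\le0$, $\alpha_{ik}\le0$, $\alpha_{jk}<2$) or ($0<\alpha_{ij}<2$, $0<\alpha_{ik}<2$, $\alpha_{jk}+\frac{\alpha_{ij}\alpha_{ik}}2<2\sqrt{(1-\alpha_{ij}^2/4)(1-\alpha_{ik}^2/4)}$). GCQ: $(\epsilon_q,\dots,\epsilon_n)\ne(1,\dots,1)$. **(V) One equality and $q\ge1$ inequality constraints.** $g=(x_1,\dots,x_q)$ and $h$ as below. All these classes violate ACQ. They satisfy GCQ under the stated condition, and violate GCQ otherwise. - (1,k), $q=1$, $2\le k\le4$: $h=x_1^k+\sum_{j\ge2}\epsilon_jx_j^2$. GCQ: $\{\epsilon_2,\dots,\epsilon_n\}=\{1,-1\}$. - (2), $q=1$: $h=x_2^3+x_1^2+\sum_{j\ge3}\epsilon_jx_j^2$. GCQ: $\{\epsilon_3,\dots,\epsilon_n\}=\{1,-1\}$. - (3,k), $q=1$, $k=3,4$: $h=x_2^k+\epsilon_1x_1x_2+\sum_{j\ge3}\epsilon_jx_j^2$.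 GCQ: ($k$ even and some $\epsilon_j=-1$, $3\le j\le n$) or ($k$ odd and ($\epsilon_1=1$ or $\{\epsilon_3,\dots,\epsilon_n\}=\{1,-1\}$)). - (4), $q=2$, $(\ast)$: $h=\delta_1x_1^2+\delta_2x_2^2+\alpha x_1x_2+\sum_{j\ge3}\epsilon_jx_j^2$. GCQ: $\{\epsilon_3,\dots,\epsilon_n\}=\{1,-1\}$. - (5), $q=2$: $h=x_1^3+\epsilon_1x_2^2+\epsilon_2x_1x_2+\sum_{j\ge3}\epsilon_jx_j^2$. GCQ: $\{\epsilon_3,\dots,\epsilon_n\}=\{1,-1\}$. - (6), $q=2$: $h=(x_1+\epsilon_1x_2)^2+\epsilon_2x_2^3+\sum_{j\ge3}\epsilon_jx_j^2$. GCQ: $\{\epsilon_3,\dots,\epsilon_n\}=\{1,-1\}$. - (7), $q=2$: $h=x_3^3+\epsilon_1x_2x_3+\epsilon_2x_3x_1+\epsilon_3x_1x_2+\sum_{j\ge4}\epsilon_jx_j^2$. GCQ: $\{\epsilon_4,\dots,\epsilon_n\}=\{1,-1\}$ or $\epsilon_1=1$ or $\epsilon_2=1$. - (8), $q=3$, $(\ast\ast)$: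 $h=\sum_{j=1}^3\delta_jx_j^2+\sum_{1\le i<j\le3}\alpha_{ij}x_ix_j+\epsilon_1x_1x_2x_3+\sum_{j\ge4}\epsilon_jx_j^2$. GCQ: $\{\epsilon_4,\dots,\epsilon_n\}=\{1,-1\}$. -/

import Mathlib

open Filter Topology
open scoped ContDiff Matrix

noncomputable section

namespace CQ

/-! ### Constraint map-germs at the origin of `ℝⁿ`

A map-germ at `0` is given by a representative defined on all of `ℝⁿ`; every notion below
depends only on the values of the representative near `0`. -/

/-- The space `ℝⁿ`. -/
abbrev Vec (n : ℕ) : Type := Fin n → ℝ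

/-- The map `f` is `C^∞` on a neighbourhood of the origin. -/
def SmoothGerm {n : ℕ} {F : Type} [NormedAddCommGroup F] [NormedSpace ℝ F]
    (f : Vec n → F) : Prop :=
  ∀ᶠ x in 𝓝 (0 : Vec n), ContDiffAt ℝ ∞ f x

/-- The feasible set `M(g,h)`. -/
def feasibleSet {n q r : ℕ} (g : Vec n → Fin q → ℝ) (h : Vec n → Fin r → ℝ) : Set (Vec n) :=
  {x | (∀ i, g x i ≤ 0) ∧ ∀ j, h x j = 0}

/-- Indices of the inequality constraints that are active at the origin. -/
abbrev Active {n q : ℕ} (g : Vec n → Fin q → ℝ) : Type := {i : Fin q // g 0 i = 0}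

/-- The differential at the origin of the `i`-th component of `f`. -/
def diff {n m : ℕ} (f : Vec n → Fin m → ℝ) (i : Fin m) : Vec n →L[ℝ] ℝ :=
  fderiv ℝ (fun x => f x i) 0

/-! ### The four constraint qualifications -/

/-- LICQ: the Jacobi matrix of `(g_I, h)` at the origin has linearly independent rows. -/
def LICQ {n q r : ℕ} (g : Vec n → Fin q → ℝ) (h : Vec n → Fin r → ℝ) : Prop :=
  LinearIndependent ℝ (Sum.elim (fun i : Active g => diff g i.1) (fun j : Fin r => diff h j))

/-- MFCQ. -/
def MFCQ {n q r : ℕ} (g : Vec n → Fin q → ℝ) (h : Vec n → Fin r → ℝ) : Prop :=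
  LinearIndependent ℝ (diff h) ∧
    ∃ d : Vec n, (∀ i : Active g, diff g i.1 d < 0) ∧ ∀ j, diff h j d = 0

/-- The tangent cone `C⁺(g,h)`. -/
def tangentCone {n q r : ℕ} (g : Vec n → Fin q → ℝ) (h : Vec n → Fin r → ℝ) : Set (Vec n) :=
  {d | ∃ (x : ℕ → Vec n) (t : ℕ → ℝ), (∀ m, x m ∈ feasibleSet g h) ∧
    Tendsto x atTop (𝓝 0) ∧ (∀ m, 0 < t m) ∧ Tendsto (fun m => t m • x m) atTop (𝓝 d)}

/-- The linearized cone `L⁺(g,h)`. -/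
def linearizedCone {n q r : ℕ} (g : Vec n → Fin q → ℝ) (h : Vec n → Fin r → ℝ) : Set (Vec n) :=
  {d | (∀ i : Active g, diff g i.1 d ≤ 0) ∧ ∀ j, diff h j d = 0}

/-- The polar of a subset of `ℝⁿ`. -/
def polar {n : ℕ} (X : Set (Vec n)) : Set (Vec n) :=
  {v | ∀ d ∈ X, v ⬝ᵥ d ≤ 0}

/-- ACQ. -/
def ACQ {n q r : ℕ} (g : Vec n → Fin q → ℝ) (h : Vec n → Fin r → ℝ) : Prop :=
  tangentCone g h = linearizedCone g h

/-- GCQ. -/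
def GCQ {n q r : ℕ} (g : Vec n → Fin q → ℝ) (h : Vec n → Fin r → ℝ) : Prop :=
  polar (tangentCone g h) = polar (linearizedCone g h)

/-! ### `K[G]`-equivalence -/

/-- `φ` is a diffeomorphism-germ `(ℝⁿ,0) → (ℝⁿ,0)`. -/
def IsDiffeoGerm {n : ℕ} (φ : Vec n → Vec n) : Prop :=
  SmoothGerm φ ∧ φ 0 = 0 ∧ ∃ ψ : Vec n → Vec n, SmoothGerm ψ ∧ ψ 0 = 0 ∧
    (∀ᶠ x in 𝓝 (0 : Vec n), ψ (φ x) = x) ∧ ∀ᶠ x in 𝓝 (0 : Vec n), φ (ψ x) = x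

/-- The group generated by the diagonal matrices with positive diagonal entries and the
permutation matrices (their semidirect product). -/
def Ggp (q : ℕ) : Set (Matrix (Fin q) (Fin q) ℝ) :=
  {C | ∃ (c : Fin q → ℝ) (σ : Equiv.Perm (Fin q)), (∀ i, 0 < c i) ∧
    C = Matrix.diagonal c * σ.permMatrix ℝ}

/-- `(g,h)` and `(g',h')` are `K[G]`-equivalent:
`(g,h)(x) = (C(x) g'(φ x) + B(x) h'(φ x), A(x) h'(φ x))` near the origin, where `φ` (the inverse
of the coordinate change of the source) is a diffeomorphism-germ and the block matrix with
blocks `C, B, 0, A` is a smooth map-germ into the group `G`. -/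
def KGEquiv {n q r : ℕ} (g : Vec n → Fin q → ℝ) (h : Vec n → Fin r → ℝ)
    (g' : Vec n → Fin q → ℝ) (h' : Vec n → Fin r → ℝ) : Prop :=
  ∃ (φ : Vec n → Vec n) (C : Vec n → Matrix (Fin q) (Fin q) ℝ)
    (B : Vec n → Matrix (Fin q) (Fin r) ℝ) (A : Vec n → Matrix (Fin r) (Fin r) ℝ),
    IsDiffeoGerm φ ∧
    (∀ i j, SmoothGerm fun x => C x i j) ∧
    (∀ i j, SmoothGerm fun x => B x i j) ∧
    (∀ i j, SmoothGerm fun x => A x i j) ∧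
    ∀ᶠ x in 𝓝 (0 : Vec n), C x ∈ Ggp q ∧ IsUnit (A x) ∧
      g x = C x *ᵥ g' (φ x) + B x *ᵥ h' (φ x) ∧ h x = A x *ᵥ h' (φ x)

/-! ### Normal forms -/

/-- The coordinate `x_j`, numbered from `1` to `n` (and `0` for a number out of range, which
does not occur in an admissible normal form). -/
def coord {n : ℕ} (x : Vec n) (j : ℕ) : ℝ :=
  if hj : 1 ≤ j ∧ j ≤ n then x ⟨j - 1, by omega⟩ else 0

/-- `a` is `1` or `-1`. -/
def IsSign (a : ℝ) : Prop := a = 1 ∨ a = -1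

/-- The quadratic form `∑_{j=a}^{n} ε_j x_j²`. -/
def tail {n : ℕ} (ε : ℕ → ℝ) (a : ℕ) (x : Vec n) : ℝ :=
  ∑ j ∈ Finset.Icc a n, ε j * coord x j ^ 2

/-- Nondegeneracy of the binary form `δ₁ a² + δ₂ b² + α a b`. -/
def Star (δ : ℕ → ℝ) (α : ℝ) : Prop := 4 * δ 1 * δ 2 - α ^ 2 ≠ 0

/-- Nondegeneracy of the ternary form `∑ δ_i y_i² + ∑_{i<j} α_{ij} y_i y_j` and of its
restrictions to the coordinate planes. -/
def StarStar (δ : ℕ → ℝ) (α : ℕ → ℕ → ℝ) : Prop :=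
  (∀ i ∈ Finset.Icc 1 3, ∀ j ∈ Finset.Icc 1 3, i ≠ j → 4 * δ i * δ j - α i j ^ 2 ≠ 0) ∧
  4 * δ 1 * δ 2 * δ 3 + α 1 2 * α 1 3 * α 2 3
    - δ 3 * α 1 2 ^ 2 - δ 2 * α 1 3 ^ 2 - δ 1 * α 2 3 ^ 2 ≠ 0

/-- `{ε_a, …, ε_n} = {1, -1}`. -/
def BothSigns (ε : ℕ → ℝ) (a n : ℕ) : Prop := ε '' Set.Icc a n = {1, -1}

/-- `ε_a = ⋯ = ε_n = s`. -/
def AllEq (ε : ℕ → ℝ) (a n : ℕ) (s : ℝ) : Prop := ∀ j ∈ Set.Icc a n, ε j = s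

/-- The empty tuple of constraint functions. -/
def noConstraint {n : ℕ} : Vec n → Fin 0 → ℝ := fun _ j => j.elim0

/-- A single function as a one-component map. -/
def single {n : ℕ} (f : Vec n → ℝ) : Vec n → Fin 1 → ℝ := fun x _ => f x

/-- The map `(x_{a+1}, …, x_{a+m})`. -/
def coords {n : ℕ} (a m : ℕ) : Vec n → Fin m → ℝ := fun x i => coord x (a + i + 1)

/-! #### One equality constraint, no inequality constraints -/

/-- Types `(1,k)` and `(2)`. -/
inductive EqType
  | t1 (k : ℕ)
  | t2

namespace EqType

def form {n : ℕ} (ε : ℕ → ℝ) (x : Vec n) : EqType → ℝ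
  | t1 k => coord x 1 ^ k + tail ε 2 x
  | t2 => coord x 1 ^ 3 + ε 2 * coord x 1 * coord x 2 ^ 2 + coord x 3 ^ 2 + tail ε 4 x

/-- The range of the parameters; `n` is large enough for the quadratic part to be present. -/
def Admissible (n : ℕ) : EqType → Prop
  | t1 k => 2 ≤ k ∧ k ≤ 5 ∧ 2 ≤ n
  | t2 => 3 ≤ n

def GCQCond (n : ℕ) (ε : ℕ → ℝ) : EqType → Prop
  | t1 k => (k = 2 ∧ ∃ j ∈ Set.Icc 2 n, ε j = -1) ∨ (3 ≤ k ∧ BothSigns ε 2 n)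
  | t2 => ∃ j ∈ Set.Icc 4 n, ε j = -1

end EqType

/-! #### Inequality constraints only -/

/-- Types `(1,k)`, `(2)`, `(3,k)`, `(4,k)`, `(5)`, …, `(10)`, together with the parameters that
are not signs `ε_j`. -/
inductive IneqType
  | t1 (k : ℕ)
  | t2
  | t3 (k : ℕ)
  | t4 (k : ℕ)
  | t5
  | t6 (δ : ℕ → ℝ) (α : ℝ)
  | t7 (ε' : ℝ)
  | t8 (ε' : ℝ)
  | t9 (ε01 ε02 ε12 : ℝ)
  | t10 (δ : ℕ → ℝ) (α : ℕ → ℕ → ℝ)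

namespace IneqType

/-- `q - l`. -/
def gap : IneqType → ℕ
  | t1 _ => 1
  | t2 => 1
  | t3 _ => 2
  | t4 _ => 2
  | t5 => 2
  | t6 _ _ => 3
  | t7 _ => 3
  | t8 _ => 3
  | t9 _ _ _ => 3
  | t10 _ _ => 4

/-- The number `l`. -/
def len (q : ℕ) (T : IneqType) : ℕ := q - T.gap

/-- The function `g̃(x_{l+1}, …, x_n)`. -/
def form {n : ℕ} (q : ℕ) (ε : ℕ → ℝ) (x : Vec n) : IneqType → ℝ
  | t1 k => ε q * coord x q ^ k + tail ε (q + 1) x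
  | t2 => coord x q ^ 3 + ε (q + 1) * coord x q * coord x (q + 1) ^ 2 + tail ε (q + 2) x
  | t3 k => ε (q - 1) * coord x (q - 1) ^ k + tail ε q x
  | t4 k => ε q * coord x q ^ k + coord x (q - 1) * coord x q + tail ε (q + 1) x
  | t5 => ε (q - 1) * coord x (q - 1) ^ 2 + coord x q ^ 3 + tail ε (q + 1) x
  | t6 δ α => δ 1 * coord x (q - 1) ^ 2 + δ 2 * coord x (q - 2) ^ 2
      + α * coord x (q - 2) * coord x (q - 1) + tail ε q x
  | t7 ε' => ε (q - 2) * (coord x (q - 2) + ε' * coord x (q - 1)) ^ 2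
      + ε (q - 1) * coord x (q - 1) ^ 3 + tail ε q x
  | t8 ε' => ε (q - 2) * coord x (q - 2) ^ 3 + ε (q - 1) * coord x (q - 1) ^ 2
      + ε' * coord x (q - 2) * coord x (q - 1) + tail ε q x
  | t9 ε01 ε02 ε12 => coord x q ^ 3 + ε01 * coord x (q - 1) * coord x q
      + ε02 * coord x (q - 2) * coord x q + ε12 * coord x (q - 2) * coord x (q - 1)
      + tail ε (q + 1) x
  | t10 δ α => δ 1 * coord x (q - 3) ^ 2 + δ 2 * coord x (q - 2) ^ 2 + δ 3 * coord x (q - 1) ^ 2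
      + α 1 2 * coord x (q - 3) * coord x (q - 2) + α 1 3 * coord x (q - 3) * coord x (q - 1)
      + α 2 3 * coord x (q - 2) * coord x (q - 1)
      + ε 0 * coord x (q - 3) * coord x (q - 2) * coord x (q - 1) + tail ε q x

/-- The normal form `(x_1, …, x_{q-1}, ∑_{j ≤ l₁} x_j - ∑_{l₁ < j ≤ l} x_j + g̃)`. -/
def normalForm (n q l₁ : ℕ) (ε : ℕ → ℝ) (T : IneqType) : Vec n → Fin q → ℝ := fun x i =>
  if i.val + 1 < q then coord x (i.val + 1)
  else ∑ j ∈ Finset.Icc 1 l₁, coord x j - ∑ j ∈ Finset.Icc (l₁ + 1) (T.len q), coord x j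
    + T.form q ε x

/-- The range of the parameters; `q` is large enough for `l ≥ 0`, and `n` is large enough for the
sum of the `ε_j x_j²` to be nonempty. -/
def Admissible (n q : ℕ) (T : IneqType) : Prop :=
  T.gap ≤ q ∧
  match T with
  | t1 k => 2 ≤ k ∧ k ≤ 5 ∧ q + 1 ≤ n
  | t2 => q + 2 ≤ n
  | t3 k => 2 ≤ k ∧ k ≤ 4 ∧ q ≤ n
  | t4 k => (k = 3 ∨ k = 4) ∧ q + 1 ≤ n
  | t5 => q + 1 ≤ n
  | t6 δ α => IsSign (δ 1) ∧ IsSign (δ 2) ∧ Star δ α ∧ q ≤ n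
  | t7 ε' => IsSign ε' ∧ q ≤ n
  | t8 ε' => IsSign ε' ∧ q ≤ n
  | t9 ε01 ε02 ε12 => IsSign ε01 ∧ IsSign ε02 ∧ IsSign ε12 ∧ q + 1 ≤ n
  | t10 δ α => (∀ j ∈ Finset.Icc 1 3, IsSign (δ j)) ∧ (∀ i j, α i j = α j i) ∧
      StarStar δ α ∧ q ≤ n

/-- The condition on the coefficients `α_{ij}` in the ACQ criterion for type `(10)`. -/
def Dagger (α : ℕ → ℕ → ℝ) : Prop :=
  ∃ i ∈ Finset.Icc 1 3, ∃ j ∈ Finset.Icc 1 3, ∃ k ∈ Finset.Icc 1 3, i ≠ j ∧ i ≠ k ∧ j ≠ k ∧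
    ((α i j ≤ 0 ∧ α i k ≤ 0 ∧ α j k < 2) ∨
      (0 < α i j ∧ α i j < 2 ∧ 0 < α i k ∧ α i k < 2 ∧
        α j k + α i j * α i k / 2
          < 2 * Real.sqrt ((1 - α i j ^ 2 / 4) * (1 - α i k ^ 2 / 4))))

def ACQCond (n q : ℕ) (ε : ℕ → ℝ) : IneqType → Prop
  | t1 k => AllEq ε q n (-1) ∨ (3 ≤ k ∧ AllEq ε (q + 1) n (-1))
  | t2 => AllEq ε (q + 2) n (-1)
  | t3 k => AllEq ε (q - 1) n (-1) ∨ (3 ≤ k ∧ AllEq ε q n (-1))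
  | t4 _ => False
  | t5 => ε (q - 1) = -1 ∧ AllEq ε (q + 1) n (-1)
  | t6 δ α => δ 1 = -1 ∧ δ 2 = -1 ∧ α < 2 ∧ AllEq ε q n (-1)
  | t7 _ => ε (q - 2) = -1 ∧ AllEq ε q n (-1)
  | t8 ε' => ε (q - 1) = -1 ∧ ε' = -1 ∧ AllEq ε q n (-1)
  | t9 _ _ _ => False
  | t10 δ α => δ 1 = -1 ∧ δ 2 = -1 ∧ δ 3 = -1 ∧ AllEq ε q n (-1) ∧ Dagger α

def GCQCond (n q : ℕ) (ε : ℕ → ℝ) : IneqType → Prop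
  | t1 k => (k = 2 ∧ ¬ AllEq ε q n 1) ∨ ¬ AllEq ε (q + 1) n 1
  | t2 => ¬ AllEq ε (q + 2) n 1
  | t3 _ => ¬ AllEq ε q n 1
  | t4 k => ¬ AllEq ε (q + 1) n 1 ∨ ε q = (-1) ^ (k + 1)
  | t5 => ¬ AllEq ε (q + 1) n 1
  | t6 _ _ => ¬ AllEq ε q n 1
  | t7 _ => ¬ AllEq ε q n 1
  | t8 _ => ¬ AllEq ε q n 1
  | t9 ε01 ε02 _ => ¬ AllEq ε (q + 1) n 1 ∨ ε01 = 1 ∨ ε02 = 1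
  | t10 _ _ => ¬ AllEq ε q n 1

end IneqType

/-! #### One equality constraint and `q ≥ 1` inequality constraints -/

/-- Types `(1,k)`, `(2)`, `(3,k)`, `(4)`, …, `(8)`, together with the parameters that are not
signs `ε_j`. -/
inductive MixedType
  | t1 (k : ℕ)
  | t2
  | t3 (k : ℕ)
  | t4 (δ : ℕ → ℝ) (α : ℝ)
  | t5
  | t6
  | t7
  | t8 (δ : ℕ → ℝ) (α : ℕ → ℕ → ℝ)

namespace MixedType

/-- The number `q` of inequality constraints. -/
def numIneq : MixedType → ℕ
  | t1 _ => 1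
  | t2 => 1
  | t3 _ => 1
  | t4 _ _ => 2
  | t5 => 2
  | t6 => 2
  | t7 => 2
  | t8 _ _ => 3

/-- The equality constraint `h`; the inequality constraints are `x_1, …, x_q`. -/
def form {n : ℕ} (ε : ℕ → ℝ) (x : Vec n) : MixedType → ℝ
  | t1 k => coord x 1 ^ k + tail ε 2 x
  | t2 => coord x 2 ^ 3 + coord x 1 ^ 2 + tail ε 3 x
  | t3 k => coord x 2 ^ k + ε 1 * coord x 1 * coord x 2 + tail ε 3 x
  | t4 δ α => δ 1 * coord x 1 ^ 2 + δ 2 * coord x 2 ^ 2 + α * coord x 1 * coord x 2 + tail ε 3 x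
  | t5 => coord x 1 ^ 3 + ε 1 * coord x 2 ^ 2 + ε 2 * coord x 1 * coord x 2 + tail ε 3 x
  | t6 => (coord x 1 + ε 1 * coord x 2) ^ 2 + ε 2 * coord x 2 ^ 3 + tail ε 3 x
  | t7 => coord x 3 ^ 3 + ε 1 * coord x 2 * coord x 3 + ε 2 * coord x 3 * coord x 1
      + ε 3 * coord x 1 * coord x 2 + tail ε 4 x
  | t8 δ α => δ 1 * coord x 1 ^ 2 + δ 2 * coord x 2 ^ 2 + δ 3 * coord x 3 ^ 2
      + α 1 2 * coord x 1 * coord x 2 + α 1 3 * coord x 1 * coord x 3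
      + α 2 3 * coord x 2 * coord x 3
      + ε 1 * coord x 1 * coord x 2 * coord x 3 + tail ε 4 x

/-- The range of the parameters; `n` is large enough for the sum of the `ε_j x_j²` to be
nonempty. -/
def Admissible (n : ℕ) : MixedType → Prop
  | t1 k => 2 ≤ k ∧ k ≤ 4 ∧ 2 ≤ n
  | t2 => 3 ≤ n
  | t3 k => 3 ≤ k ∧ k ≤ 4 ∧ 3 ≤ n
  | t4 δ α => IsSign (δ 1) ∧ IsSign (δ 2) ∧ Star δ α ∧ 3 ≤ n
  | t5 => 3 ≤ n
  | t6 => 3 ≤ n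
  | t7 => 4 ≤ n
  | t8 δ α => (∀ j ∈ Finset.Icc 1 3, IsSign (δ j)) ∧ (∀ i j, α i j = α j i) ∧
      StarStar δ α ∧ 4 ≤ n

def GCQCond (n : ℕ) (ε : ℕ → ℝ) : MixedType → Prop
  | t1 _ => BothSigns ε 2 n
  | t2 => BothSigns ε 3 n
  | t3 k => (Even k ∧ ∃ j ∈ Set.Icc 3 n, ε j = -1) ∨ (Odd k ∧ (ε 1 = 1 ∨ BothSigns ε 3 n))
  | t4 _ _ => BothSigns ε 3 n
  | t5 => BothSigns ε 3 n
  | t6 => BothSigns ε 3 n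
  | t7 => BothSigns ε 4 n ∨ ε 1 = 1 ∨ ε 2 = 1
  | t8 _ _ => BothSigns ε 4 n

end MixedType

end CQ

end

open Filter Topology
open scoped ContDiff Matrix

noncomputable section

namespace CQ

/-! ### The contingent cone of a set at the origin -/

/-! All four conditions depend only on the differentials at the origin and on the tangent cone.
Under a `K[G]`-equivalence the differential `L` of the diffeomorphism carries the linearized cone
and the tangent cone of one germ onto those of the other: the invertible factor `A` preserves the
zero set of the equalities, the term with `B` vanishes on it, and a positive diagonal matrix times a
permutation only rescales and permutes inequalities. Hence ACQ and GCQ have to be decided for the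
normal forms alone (`KGEquiv.acq_gcq_iff`), and GCQ becomes the statement `PolarLE`: a linear
functional that is nonpositive on the tangent cone is nonpositive on the linearized cone. The LICQ
criterion is the inverse function theorem, applied to the constraints completed by linear
coordinates.

In a singular normal form one function `f` with vanishing differential remains, and `f (s • y) = s²
H(s, y)` with `H` continuous up to `s = 0` (`Blowup`). Directions `d` tangent to `f ≤ 0` or to `f =
0` satisfy `H 0 d ≤ 0` or `H 0 d = 0`; conversely, curves `s • γ s` with `γ s → d` produce tangent
directions.

With an equality constraint, a free coordinate vector on which `H 0` does not vanish lies in the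
linearized cone but is not tangent, so ACQ fails. With inequalities only and `l₁ > 0`, MFCQ holds
and implies ACQ. With `l₁ = 0`, the linearized constraints force `d_1 = ⋯ = d_l = 0`, and ACQ
amounts to `H 0 ≤ 0` on the resulting cone (`cone_subset_tcone_ineqSet_iff`); for type (10) this is
copositivity of a ternary form (`IneqType.dagger_iff`).

GCQ is decided by three mechanisms. A free coordinate with coefficient `-1` (for an inequality), or
two free coordinates with opposite signs (for an equality), allow every direction of the linearized
cone to be corrected without loss for a polar functional (`polarLE_ineqSet_of_neg`,
`polarLE_eqSet_of_signs`). If the quadratic part in the free coordinates has the obstructing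
definite sign and the remaining quadratic part is bounded by the square of a functional that is
nonpositive on the cone, then the tangent cone lies in a half-space missing a free direction
(`not_polarLE_of_sq_le`). The remaining forms couple a free coordinate `w` to a constrained
coordinate `u` through a product `x_u x_w`. There the higher-order term decides: either both, or the
relevant one, of the directions `±e_w` are tangent and the product absorbs everything else
(`le_zero_of_coupled_ineq`, `le_zero_of_coupled_eq`), or a sign argument confines the feasible set
to a half-space. -/

/-- The contingent cone at the origin of a set `M`, in terms of blown-up coordinates `x = s • y`. -/
def tcone {n : ℕ} (M : Set (Vec n)) : Set (Vec n) :=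
  {d | ∃ᶠ p in (𝓝[>] (0 : ℝ)) ×ˢ 𝓝 d, p.1 • p.2 ∈ M}

lemma tendsto_fst_smul_snd {n : ℕ} (d : Vec n) :
    Tendsto (fun p : ℝ × Vec n => p.1 • p.2) ((𝓝[>] (0 : ℝ)) ×ˢ 𝓝 d) (𝓝 0) := by
  have h1 : Tendsto (fun p : ℝ × Vec n => p.1) ((𝓝[>] (0 : ℝ)) ×ˢ 𝓝 d) (𝓝 0) :=
    tendsto_fst.mono_right nhdsWithin_le_nhds
  simpa using h1.smul (tendsto_snd (f := 𝓝[>] (0 : ℝ)) (g := 𝓝 d))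

lemma eventually_fst_pos {n : ℕ} (d : Vec n) :
    ∀ᶠ p : ℝ × Vec n in (𝓝[>] (0 : ℝ)) ×ˢ 𝓝 d, 0 < p.1 :=
  tendsto_fst.eventually (eventually_mem_nhdsWithin : ∀ᶠ s in 𝓝[>] (0 : ℝ), s ∈ Set.Ioi 0)

lemma mem_tcone_of_curve {n : ℕ} {M : Set (Vec n)} {d : Vec n} {γ : ℝ → Vec n}
    (hγ : Tendsto γ (𝓝[>] 0) (𝓝 d)) (h : ∀ᶠ s in 𝓝[>] (0 : ℝ), s • γ s ∈ M) : d ∈ tcone M := by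
  have : Tendsto (fun s => (s, γ s)) (𝓝[>] (0 : ℝ)) ((𝓝[>] (0 : ℝ)) ×ˢ 𝓝 d) :=
    tendsto_id.prodMk hγ
  exact this.frequently h.frequently

/-- For `d ≠ 0` the multipliers `t m` must tend to infinity, so `((t m)⁻¹, t m • x m)` is a sequence
in blown-up coordinates. For `d = 0` they may stay bounded; that case is covered by the origin being
feasible. -/
lemma tangentCone_eq_tcone {n q r : ℕ} {g : Vec n → Fin q → ℝ} {h : Vec n → Fin r → ℝ}
    (h0 : (0 : Vec n) ∈ feasibleSet g h) : tangentCone g h = tcone (feasibleSet g h) := by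
  ext d
  constructor
  · rintro ⟨x, t, hx, hx0, ht, htx⟩
    by_cases hd : d = 0
    · subst hd
      exact mem_tcone_of_curve (γ := fun _ => 0) tendsto_const_nhds
        (Eventually.of_forall fun s => by simpa using h0)
    · have hinv : Tendsto (fun m => (t m)⁻¹) atTop (𝓝[>] 0) := by
        refine tendsto_nhdsWithin_iff.2 ⟨?_, Eventually.of_forall fun m => inv_pos.2 (ht m)⟩
        -- The quotient equals `(t m)⁻¹` as soon as `x m ≠ 0`, and its denominator stays away from
        -- zero because `d ≠ 0`.
        have h1 : Tendsto (fun m => ‖x m‖ / ‖t m • x m‖) atTop (𝓝 (‖(0 : Vec n)‖ / ‖d‖)) :=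
          hx0.norm.div htx.norm (norm_ne_zero_iff.2 hd)
        rw [norm_zero, zero_div] at h1
        refine h1.congr' ?_
        filter_upwards [htx.eventually_ne hd] with m hm
        have hxm : ‖x m‖ ≠ 0 := by
          intro h
          exact hm (by rw [norm_eq_zero.1 h, smul_zero])
        rw [norm_smul, Real.norm_of_nonneg (ht m).le]
        field_simp
      have hT := hinv.prodMk htx
      refine hT.frequently (Eventually.of_forall fun m => ?_).frequently
      change (t m)⁻¹ • (t m • x m) ∈ _
      rw [inv_smul_smul₀ (ht m).ne']
      exact hx m
  · intro hd
    have hd' : ∃ᶠ p in (𝓝[>] (0 : ℝ)) ×ˢ 𝓝 d, p.1 • p.2 ∈ feasibleSet g h ∧ 0 < p.1 :=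
      Frequently.and_eventually hd (eventually_fst_pos d)
    obtain ⟨u, hu, hP⟩ := exists_seq_forall_of_frequently hd'
    refine ⟨fun m => (u m).1 • (u m).2, fun m => (u m).1⁻¹, fun m => (hP m).1,
      (tendsto_fst_smul_snd d).comp hu, fun m => inv_pos.2 (hP m).2, ?_⟩
    refine (tendsto_snd.comp hu).congr fun m => ?_
    simp [inv_smul_smul₀ (hP m).2.ne']

/-- Closedness of the contingent cone. It permits perturbing a direction so that weak inequalities
become strict and passing to the limit afterwards. -/
lemma tcone_of_tendsto {n : ℕ} {M : Set (Vec n)} {d : Vec n} {γ : ℝ → Vec n}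
    (hγ : Tendsto γ (𝓝[>] 0) (𝓝 d)) (h : ∀ᶠ s in 𝓝[>] (0 : ℝ), γ s ∈ tcone M) : d ∈ tcone M := by
  refine frequently_iff.2 fun {U} hU => ?_
  obtain ⟨a, ha, b, hb, hab⟩ := mem_prod_iff.1 hU
  obtain ⟨b', hb', hbo, hdb⟩ := mem_nhds_iff.1 hb
  obtain ⟨s, hs, hsb⟩ := (h.and (hγ.eventually (hbo.mem_nhds hdb))).exists
  obtain ⟨p, hp, hpM⟩ := frequently_iff.1 hs (prod_mem_prod ha (hbo.mem_nhds hsb))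
  exact ⟨p, hab ⟨hp.1, hb' hp.2⟩, hpM⟩

/-- The limit is taken jointly in the scale and the direction, since the direction varies along a
sequence defining a tangent vector. -/
lemma tendsto_blowup {n : ℕ} {F : Type*} [NormedAddCommGroup F] [NormedSpace ℝ F]
    {f : Vec n → F} {f' : Vec n →L[ℝ] F} (hf : HasFDerivAt f f' 0) (h0 : f 0 = 0) (d : Vec n) :
    Tendsto (fun p : ℝ × Vec n => p.1⁻¹ • f (p.1 • p.2)) ((𝓝[>] (0 : ℝ)) ×ˢ 𝓝 d)
      (𝓝 (f' d)) := by
  have h1 := (hasFDerivAt_iff_isLittleO_nhds_zero.1 hf)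
  simp only [zero_add, h0, sub_zero] at h1
  have h2 := h1.comp_tendsto (tendsto_fst_smul_snd d)
  have h3 : (fun p : ℝ × Vec n => p.1⁻¹ • (f (p.1 • p.2) - f' (p.1 • p.2)))
      =o[(𝓝[>] (0 : ℝ)) ×ˢ 𝓝 d] (fun p : ℝ × Vec n => p.1⁻¹ • (p.1 • p.2)) :=
    (Asymptotics.isBigO_refl _ _).smul_isLittleO h2
  have h4 : (fun p : ℝ × Vec n => p.1⁻¹ • (p.1 • p.2)) =ᶠ[(𝓝[>] (0 : ℝ)) ×ˢ 𝓝 d]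
      fun p => p.2 := by
    filter_upwards [eventually_fst_pos d] with p hp
    rw [inv_smul_smul₀ hp.ne']
  have h5 : Tendsto (fun p : ℝ × Vec n => p.1⁻¹ • (f (p.1 • p.2) - f' (p.1 • p.2)))
      ((𝓝[>] (0 : ℝ)) ×ˢ 𝓝 d) (𝓝 0) := by
    have h6 := (h3.trans_eventuallyEq h4).trans_isBigO
      ((tendsto_snd (f := 𝓝[>] (0 : ℝ)) (g := 𝓝 d)).isBigO_one ℝ)
    exact (Asymptotics.isLittleO_one_iff ℝ).1 h6
  have h7 : Tendsto (fun p : ℝ × Vec n => f' p.2) ((𝓝[>] (0 : ℝ)) ×ˢ 𝓝 d) (𝓝 (f' d)) :=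
    (f'.continuous.tendsto d).comp tendsto_snd
  have h8 := h5.add h7
  rw [zero_add] at h8
  refine h8.congr' ?_
  filter_upwards [eventually_fst_pos d] with p hp
  rw [smul_sub, map_smul, inv_smul_smul₀ hp.ne', sub_add_cancel]

/-- In blown-up coordinates `φ` acts by `(s, y) ↦ (s, s⁻¹ • φ (s • y))`, and by differentiability
this tends to `φ' d` in the second component. -/
lemma tcone_map {n : ℕ} {M M' : Set (Vec n)} {φ : Vec n → Vec n} {φ' : Vec n →L[ℝ] Vec n}
    (hφ : HasFDerivAt φ φ' 0) (h0 : φ 0 = 0) (h : ∀ᶠ x in 𝓝 (0 : Vec n), x ∈ M → φ x ∈ M')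
    {d : Vec n} (hd : d ∈ tcone M) : φ' d ∈ tcone M' := by
  have hT : Tendsto (fun p : ℝ × Vec n => (p.1, p.1⁻¹ • φ (p.1 • p.2)))
      ((𝓝[>] (0 : ℝ)) ×ˢ 𝓝 d) ((𝓝[>] (0 : ℝ)) ×ˢ 𝓝 (φ' d)) :=
    tendsto_fst.prodMk (tendsto_blowup hφ h0 d)
  refine hT.frequently ?_
  have hd' : ∃ᶠ p in (𝓝[>] (0 : ℝ)) ×ˢ 𝓝 d, p.1 • p.2 ∈ M := hd
  refine (hd'.and_eventually ((eventually_fst_pos d).and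
    ((tendsto_fst_smul_snd d).eventually h))).mono ?_
  rintro p ⟨hM, hp, himp⟩
  change p.1 • (p.1⁻¹ • φ (p.1 • p.2)) ∈ M'
  rw [smul_inv_smul₀ hp.ne']
  exact himp hM

lemma tcone_le_of_fderiv {n : ℕ} {M : Set (Vec n)} {f : Vec n → ℝ} {f' : Vec n →L[ℝ] ℝ}
    (hf : HasFDerivAt f f' 0) (h0 : f 0 = 0) (h : ∀ x ∈ M, f x ≤ 0)
    {d : Vec n} (hd : d ∈ tcone M) : f' d ≤ 0 := by
  by_contra! hlt
  have h1 := (tendsto_blowup hf h0 d).eventually (lt_mem_nhds hlt)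
  have hd' : ∃ᶠ p in (𝓝[>] (0 : ℝ)) ×ˢ 𝓝 d, p.1 • p.2 ∈ M := hd
  obtain ⟨p, hM, hp, hlt⟩ := (hd'.and_eventually ((eventually_fst_pos d).and h1)).exists
  have := h _ hM
  rw [smul_eq_mul] at hlt
  have := mul_nonpos_of_nonneg_of_nonpos (inv_pos.2 hp).le this
  linarith

/-- A constraint map-germ all of whose components vanish and are differentiable at the origin. -/
structure IsCentered {n m : ℕ} (f : Vec n → Fin m → ℝ) : Prop where
  zero : f 0 = 0
  diffAt : ∀ i, DifferentiableAt ℝ (fun x => f x i) 0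

lemma IsCentered.hasFDerivAt {n m : ℕ} {f : Vec n → Fin m → ℝ} (hf : IsCentered f) (i : Fin m) :
    HasFDerivAt (fun x => f x i) (diff f i) 0 := (hf.diffAt i).hasFDerivAt

lemma mem_feasibleSet_zero {n q r : ℕ} {g : Vec n → Fin q → ℝ} {h : Vec n → Fin r → ℝ}
    (hg : g 0 = 0) (hh : h 0 = 0) : (0 : Vec n) ∈ feasibleSet g h := by
  simp [feasibleSet, hg, hh]

lemma mem_linearizedCone {n q r : ℕ} {g : Vec n → Fin q → ℝ} {h : Vec n → Fin r → ℝ}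
    (hg : g 0 = 0) {d : Vec n} :
    d ∈ linearizedCone g h ↔ (∀ i, diff g i d ≤ 0) ∧ ∀ j, diff h j d = 0 := by
  simp [linearizedCone, hg, Active]

lemma tangentCone_subset_linearizedCone {n q r : ℕ} {g : Vec n → Fin q → ℝ}
    {h : Vec n → Fin r → ℝ} (hg : IsCentered g) (hh : IsCentered h) :
    tangentCone g h ⊆ linearizedCone g h := by
  intro d hd
  rw [tangentCone_eq_tcone (mem_feasibleSet_zero hg.zero hh.zero)] at hd
  rw [mem_linearizedCone hg.zero]
  refine ⟨fun i => tcone_le_of_fderiv (hg.hasFDerivAt i) (by simp [hg.zero])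
    (fun x hx => hx.1 i) hd, fun j => le_antisymm ?_ ?_⟩
  · exact tcone_le_of_fderiv (hh.hasFDerivAt j) (by simp [hh.zero]) (fun x hx => (hx.2 j).le) hd
  -- An equality is a pair of inequalities; this is the one for `-h`.
  · have := tcone_le_of_fderiv (hh.hasFDerivAt j).neg (by simp [hh.zero])
      (fun x hx => by simp [hx.2 j]) hd
    simpa using this

/-! ### Polars in terms of linear functionals -/

/-- Every vector of the polar of `C` lies in the polar of `L`, in terms of linear functionals. -/
def PolarLE {n : ℕ} (C L : Set (Vec n)) : Prop :=
  ∀ ℓ : Vec n →ₗ[ℝ] ℝ, (∀ d ∈ C, ℓ d ≤ 0) → ∀ d ∈ L, ℓ d ≤ 0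

lemma exists_dotProduct_eq {n : ℕ} (ℓ : Vec n →ₗ[ℝ] ℝ) : ∃ v : Vec n, ∀ d, ℓ d = v ⬝ᵥ d := by
  refine ⟨fun i => ℓ (Pi.single i 1), fun d => ?_⟩
  conv_lhs => rw [pi_eq_sum_univ' d]
  simp [dotProduct, map_sum, mul_comm]

/-- One inclusion of polars is automatic because the tangent cone is contained in the linearized
cone. Functionals replace the scalar product because they transform by composition under linear
isomorphisms. -/
lemma GCQ_iff_polarLE {n q r : ℕ} {g : Vec n → Fin q → ℝ} {h : Vec n → Fin r → ℝ}
    (hsub : tangentCone g h ⊆ linearizedCone g h) :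
    GCQ g h ↔ PolarLE (tangentCone g h) (linearizedCone g h) := by
  constructor
  · intro hG ℓ hℓ d hd
    obtain ⟨v, hv⟩ := exists_dotProduct_eq ℓ
    have : v ∈ polar (tangentCone g h) := fun d hd => by rw [← hv]; exact hℓ d hd
    rw [hG] at this
    rw [hv]; exact this d hd
  · intro hP
    refine Set.Subset.antisymm (fun v hv d hd => ?_) (fun v hv d hd => hv d (hsub hd))
    let ℓ : Vec n →ₗ[ℝ] ℝ := dotProductBilin ℝ ℝ v
    exact hP ℓ (fun d hd => hv d hd) d hd

lemma ACQ.gcq {n q r : ℕ} {g : Vec n → Fin q → ℝ} {h : Vec n → Fin r → ℝ} (H : ACQ g h) :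
    GCQ g h := congrArg polar H

/-- If there are no equality constraints, MFCQ implies ACQ. -/
lemma MFCQ.acq {n q : ℕ} {g : Vec n → Fin q → ℝ} {h : Vec n → Fin 0 → ℝ} (hg : IsCentered g)
    (H : MFCQ g h) : ACQ g h := by
  have hh : IsCentered h := ⟨Subsingleton.elim _ _, fun i => i.elim0⟩
  refine Set.Subset.antisymm (tangentCone_subset_linearizedCone hg hh) fun d hd => ?_
  obtain ⟨-, e, he, -⟩ := H
  rw [tangentCone_eq_tcone (mem_feasibleSet_zero hg.zero hh.zero)]
  rw [mem_linearizedCone hg.zero] at hd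
  -- Adding a small multiple of the MFCQ vector `e` makes every linearized inequality strict, so a
  -- short initial piece of the ray is feasible; then `η → 0` by closedness.
  have hlim : Tendsto (fun η : ℝ => d + η • e) (𝓝[>] 0) (𝓝 d) := by
    have : Continuous fun η : ℝ => d + η • e := by fun_prop
    simpa using (this.tendsto 0).mono_left nhdsWithin_le_nhds
  refine tcone_of_tendsto hlim ?_
  filter_upwards [self_mem_nhdsWithin] with η hη
  refine mem_tcone_of_curve (γ := fun _ => d + η • e) tendsto_const_nhds ?_
  have key : ∀ i, ∀ᶠ s in 𝓝[>] (0 : ℝ), g (s • (d + η • e)) i ≤ 0 := by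
    intro i
    have h1 : diff g i (d + η • e) < 0 := by
      have h2 := he ⟨i, by simp [hg.zero]⟩
      have h3 := hd.1 i
      rw [map_add, map_smul, smul_eq_mul]
      have : η * diff g i e < 0 := mul_neg_of_pos_of_neg hη h2
      linarith
    have h4 := (tendsto_blowup (hg.hasFDerivAt i) (by simp [hg.zero]) (d + η • e)).comp
      ((tendsto_id (x := 𝓝[>] (0 : ℝ))).prodMk (tendsto_const_nhds (x := d + η • e)))
    filter_upwards [h4.eventually (gt_mem_nhds h1), self_mem_nhdsWithin] with s hs hs0
    simp only [Function.comp, id, smul_eq_mul] at hs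
    by_contra! hc
    have := mul_pos (inv_pos.2 hs0) hc
    linarith
  filter_upwards [eventually_all.2 key] with s hs
  exact ⟨hs, fun j => j.elim0⟩

/-! ### Invariance under `K[G]`-equivalence -/

lemma SmoothGerm.differentiableAt {n : ℕ} {F : Type} [NormedAddCommGroup F] [NormedSpace ℝ F]
    {f : Vec n → F} (hf : SmoothGerm f) : DifferentiableAt ℝ f 0 :=
  (hf.self_of_nhds).differentiableAt (by simp)

/-- The chain rule applied to both composites shows that the two differentials at the origin are
inverse to each other. -/
lemma IsDiffeoGerm.exists_equiv {n : ℕ} {φ : Vec n → Vec n} (hφ : IsDiffeoGerm φ) :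
    ∃ (L : Vec n ≃L[ℝ] Vec n) (ψ : Vec n → Vec n), HasFDerivAt φ (L : Vec n →L[ℝ] Vec n) 0 ∧
      HasFDerivAt ψ (L.symm : Vec n →L[ℝ] Vec n) 0 ∧ φ 0 = 0 ∧ ψ 0 = 0 ∧
      ∀ᶠ x in 𝓝 (0 : Vec n), φ (ψ x) = x := by
  obtain ⟨hs, h0, ψ, hψs, hψ0, h1, h2⟩ := hφ
  have hd := hs.differentiableAt.hasFDerivAt
  have hd' := hψs.differentiableAt.hasFDerivAt
  have e1 : (fderiv ℝ ψ 0).comp (fderiv ℝ φ 0) = ContinuousLinearMap.id ℝ _ := by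
    have hc : HasFDerivAt (ψ ∘ φ) ((fderiv ℝ ψ 0).comp (fderiv ℝ φ 0)) 0 :=
      HasFDerivAt.comp (0 : Vec n) (by rw [h0]; exact hd') hd
    exact hc.unique ((hasFDerivAt_id _).congr_of_eventuallyEq h1)
  have e2 : (fderiv ℝ φ 0).comp (fderiv ℝ ψ 0) = ContinuousLinearMap.id ℝ _ := by
    have hc : HasFDerivAt (φ ∘ ψ) ((fderiv ℝ φ 0).comp (fderiv ℝ ψ 0)) 0 :=
      HasFDerivAt.comp (0 : Vec n) (by rw [hψ0]; exact hd) hd'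
    exact hc.unique ((hasFDerivAt_id _).congr_of_eventuallyEq h2)
  let L : Vec n ≃L[ℝ] Vec n := ContinuousLinearEquiv.equivOfInverse (fderiv ℝ φ 0) (fderiv ℝ ψ 0)
    (fun x => by simpa using DFunLike.congr_fun e1 x)
    (fun x => by simpa using DFunLike.congr_fun e2 x)
  exact ⟨L, ψ, hd, hd', h0, hψ0, h2⟩

lemma mulVec_Ggp {q : ℕ} (c : Fin q → ℝ) (σ : Equiv.Perm (Fin q)) (v : Fin q → ℝ) (i : Fin q) :
    ((Matrix.diagonal c * σ.permMatrix ℝ) *ᵥ v) i = c i * v (σ i) := by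
  rw [← Matrix.mulVec_mulVec, Matrix.mulVec_diagonal, Matrix.permMatrix_mulVec]
  rfl

/-- In the product rule the derivative of `A` is multiplied by `f (φ 0) = 0` and drops out. -/
lemma hasFDerivAt_mulVec {n m k : ℕ} {A : Vec n → Matrix (Fin m) (Fin k) ℝ}
    (hA : ∀ i j, SmoothGerm fun x => A x i j) {f : Vec n → Fin k → ℝ} (hf : IsCentered f)
    {φ : Vec n → Vec n} {φ' : Vec n →L[ℝ] Vec n} (hφ : HasFDerivAt φ φ' 0) (h0 : φ 0 = 0)
    (i : Fin m) :
    HasFDerivAt (fun x => (A x *ᵥ f (φ x)) i) (∑ j, A 0 i j • (diff f j).comp φ') 0 := by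
  have : (fun x => (A x *ᵥ f (φ x)) i) = fun x => ∑ j, A x i j * f (φ x) j := by
    ext x; simp [Matrix.mulVec, dotProduct]
  rw [this]
  refine HasFDerivAt.fun_sum fun j _ => ?_
  have hc : HasFDerivAt (fun x => f (φ x) j) ((diff f j).comp φ') 0 :=
    HasFDerivAt.comp (g := fun y => f y j) (0 : Vec n) (by rw [h0]; exact hf.hasFDerivAt j) hφ
  have := (hA i j).differentiableAt.hasFDerivAt.fun_mul hc
  simpa [h0, hf.zero] using this

/-- The effect of a `K[G]`-equivalence on the differentials and the tangent cone. -/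
lemma KGEquiv.exists_linear {n q r : ℕ} {g g' : Vec n → Fin q → ℝ} {h h' : Vec n → Fin r → ℝ}
    (H : KGEquiv g h g' h') (hg' : IsCentered g') (hh' : IsCentered h') :
    IsCentered g ∧ IsCentered h ∧
    ∃ (L : Vec n ≃L[ℝ] Vec n) (c : Fin q → ℝ) (σ : Equiv.Perm (Fin q))
      (B : Matrix (Fin q) (Fin r) ℝ) (A : Matrix (Fin r) (Fin r) ℝ),
      (∀ i, 0 < c i) ∧ IsUnit A ∧
      (∀ i d, diff g i d = c i * diff g' (σ i) (L d) + (B *ᵥ fun j => diff h' j (L d)) i) ∧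
      (∀ i d, diff h i d = (A *ᵥ fun j => diff h' j (L d)) i) ∧
      ∀ d, d ∈ tangentCone g h ↔ L d ∈ tangentCone g' h' := by
  obtain ⟨φ, C, B, A, hφ, hC, hB, hA, hev⟩ := H
  obtain ⟨L, ψ, hL, hL', h0, hψ0, hφψ⟩ := hφ.exists_equiv
  obtain ⟨⟨c, σ, hc, hCc⟩, hA0, hg0, hh0⟩ := hev.self_of_nhds
  have g0 : g 0 = 0 := by rw [hg0, h0, hg'.zero, hh'.zero]; simp
  have h00 : h 0 = 0 := by rw [hh0, h0, hh'.zero]; simp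
  have dg : ∀ i, HasFDerivAt (fun x => g x i)
      (∑ j, C 0 i j • (diff g' j).comp (L : Vec n →L[ℝ] Vec n)
        + ∑ j, B 0 i j • (diff h' j).comp (L : Vec n →L[ℝ] Vec n)) 0 := fun i => by
    refine ((hasFDerivAt_mulVec hC hg' hL h0 i).add
      (hasFDerivAt_mulVec hB hh' hL h0 i)).congr_of_eventuallyEq ?_
    filter_upwards [hev] with x hx
    rw [hx.2.2.1]; rfl
  have dh : ∀ i, HasFDerivAt (fun x => h x i)
      (∑ j, A 0 i j • (diff h' j).comp (L : Vec n →L[ℝ] Vec n)) 0 := fun i => by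
    refine (hasFDerivAt_mulVec hA hh' hL h0 i).congr_of_eventuallyEq ?_
    filter_upwards [hev] with x hx
    rw [hx.2.2.2]
  -- Invertibility of `A x` identifies the equality constraints. Once these hold, the term with `B
  -- x` vanishes and the sign conditions are merely permuted.
  have hM : ∀ᶠ x in 𝓝 (0 : Vec n), (x ∈ feasibleSet g h ↔ φ x ∈ feasibleSet g' h') := by
    filter_upwards [hev] with x hx
    obtain ⟨⟨c, σ, hc, hCc⟩, hA, hg, hh⟩ := hx
    have hiff : (∀ j, h x j = 0) ↔ ∀ j, h' (φ x) j = 0 := by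
      rw [← funext_iff (g := fun _ => (0 : ℝ)), ← funext_iff (g := fun _ => (0 : ℝ)), hh]
      constructor
      · intro h1
        exact Matrix.mulVec_injective_of_isUnit hA
          (by rw [h1]; exact (Matrix.mulVec_zero (A x)).symm)
      · intro h1
        rw [h1]; exact Matrix.mulVec_zero _
    change (_ ∧ _) ↔ (_ ∧ _)
    rw [hiff]
    refine and_congr_left fun h1 => ?_
    have h2 : h' (φ x) = 0 := funext h1
    rw [hg, h2, Matrix.mulVec_zero, add_zero, hCc]
    constructor
    · intro h3 i
      have := h3 (σ.symm i)
      rw [mulVec_Ggp] at this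
      simp only [Equiv.apply_symm_apply] at this
      by_contra! hcon
      have := mul_pos (hc (σ.symm i)) hcon
      linarith
    · intro h3 i
      rw [mulVec_Ggp]
      exact mul_nonpos_of_nonneg_of_nonpos (hc i).le (h3 _)
  refine ⟨⟨g0, fun i => (dg i).differentiableAt⟩, ⟨h00, fun i => (dh i).differentiableAt⟩,
    L, c, σ, B 0, A 0, hc, hA0, fun i d => ?_, fun i d => ?_, fun d => ?_⟩
  · rw [diff, (dg i).fderiv]
    rw [← mulVec_Ggp c σ (fun j => diff g' j (L d)), ← hCc]
    simp [Matrix.mulVec, dotProduct]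
  · rw [diff, (dh i).fderiv]
    simp [Matrix.mulVec, dotProduct]
  · rw [tangentCone_eq_tcone (mem_feasibleSet_zero g0 h00),
      tangentCone_eq_tcone (mem_feasibleSet_zero hg'.zero hh'.zero)]
    constructor
    · exact tcone_map hL h0 (hM.mono fun x hx => hx.1)
    -- The reverse inclusion transports along the inverse germ `ψ`, whose differential is `L.symm`.
    · intro hd
      have hcont : Tendsto ψ (𝓝 0) (𝓝 0) := by
        simpa [ContinuousAt, hψ0] using hL'.continuousAt
      have := tcone_map hL' hψ0 (M := feasibleSet g' h') (M' := feasibleSet g h) (by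
        filter_upwards [hcont.eventually hM, hφψ] with x hx hx'
        intro h1
        rw [hx, hx']
        exact h1) hd
      simpa using this

section invariance

variable {n q r : ℕ} {g g' : Vec n → Fin q → ℝ} {h h' : Vec n → Fin r → ℝ}

/-- The linear version of the correspondence of feasible sets: `A` is invertible, `B` acts only on
vanishing quantities, and the factors `c i` are positive. -/
lemma KGEquiv.linearizedCone_iff {L : Vec n ≃L[ℝ] Vec n} {c : Fin q → ℝ}
    {σ : Equiv.Perm (Fin q)} {B : Matrix (Fin q) (Fin r) ℝ} {A : Matrix (Fin r) (Fin r) ℝ}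
    (hg : IsCentered g) (hg' : IsCentered g') (hc : ∀ i, 0 < c i) (hA : IsUnit A)
    (dg : ∀ i d, diff g i d = c i * diff g' (σ i) (L d) + (B *ᵥ fun j => diff h' j (L d)) i)
    (dh : ∀ i d, diff h i d = (A *ᵥ fun j => diff h' j (L d)) i) (d : Vec n) :
    d ∈ linearizedCone g h ↔ L d ∈ linearizedCone g' h' := by
  rw [mem_linearizedCone hg.zero, mem_linearizedCone hg'.zero]
  have hiff : (∀ j, diff h j d = 0) ↔ ∀ j, diff h' j (L d) = 0 := by
    constructor
    · intro h1
      refine funext_iff.1 (Matrix.mulVec_injective_of_isUnit hA (a₂ := 0) ?_)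
      rw [Matrix.mulVec_zero]
      exact funext fun i => by rw [← dh, h1]; rfl
    · intro h1 j
      rw [dh, show (fun j => diff h' j (L d)) = 0 from funext h1, Matrix.mulVec_zero]; rfl
  rw [hiff]
  refine and_congr_left fun h1 => ?_
  have h2 : (fun j => diff h' j (L d)) = 0 := funext h1
  simp only [dg, h2, Matrix.mulVec_zero, Pi.zero_apply, add_zero]
  constructor
  · intro h3 i
    have := h3 (σ.symm i)
    simp only [Equiv.apply_symm_apply] at this
    by_contra! hcon
    have := mul_pos (hc (σ.symm i)) hcon
    linarith
  · intro h3 i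
    exact mul_nonpos_of_nonneg_of_nonpos (hc i).le (h3 _)

/-- The same isomorphism `L` relates both pairs of cones. For GCQ, functionals are pulled back along
`L` or `L.symm`. -/
lemma KGEquiv.acq_gcq_iff (H : KGEquiv g h g' h') (hg' : IsCentered g') (hh' : IsCentered h') :
    (ACQ g h ↔ ACQ g' h') ∧ (GCQ g h ↔ GCQ g' h') := by
  obtain ⟨hg, hh, L, c, σ, B, A, hc, hA, dg, dh, hT⟩ := H.exists_linear hg' hh'
  have hLc := linearizedCone_iff hg hg' hc hA dg dh
  constructor
  · simp only [ACQ, Set.ext_iff, hT, hLc]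
    exact (L.surjective.forall
      (p := fun x => x ∈ tangentCone g' h' ↔ x ∈ linearizedCone g' h')).symm
  · rw [GCQ_iff_polarLE (tangentCone_subset_linearizedCone hg hh),
      GCQ_iff_polarLE (tangentCone_subset_linearizedCone hg' hh')]
    constructor
    · intro hP ℓ hℓ d hd
      have := hP (ℓ ∘ₗ (L : Vec n →ₗ[ℝ] Vec n)) (fun e he => hℓ _ ((hT e).1 he)) (L.symm d)
        ((hLc _).2 (by simpa using hd))
      simpa using this
    · intro hP ℓ hℓ d hd
      have := hP (ℓ ∘ₗ (L.symm : Vec n →ₗ[ℝ] Vec n))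
        (fun e he => hℓ _ ((hT _).2 (by simpa using he))) (L d) ((hLc _).1 hd)
      simpa using this

/-! ### LICQ and MFCQ under equivalence -/

lemma not_LICQ_of_diff_eq_zero {j : Fin r} (hj : diff h j = 0) : ¬ LICQ g h := fun H =>
  H.ne_zero (Sum.inr j) (by simpa using hj)

lemma not_MFCQ_of_diff_eq_zero {j : Fin r} (hj : diff h j = 0) : ¬ MFCQ g h := fun H =>
  H.1.ne_zero j hj

lemma KGEquiv.diff_eq_zero (H : KGEquiv g h g' h') (hg' : IsCentered g') (hh' : IsCentered h')
    (hz : ∀ j, diff h' j = 0) (j : Fin r) : diff h j = 0 := by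
  obtain ⟨hg, hh, L, c, σ, B, A, hc, hA, dg, dh, hT⟩ := H.exists_linear hg' hh'
  ext1 d
  rw [dh]
  simp [hz, Matrix.mulVec, dotProduct]

/-- Linearly independent functionals take arbitrary values. -/
lemma exists_forall_apply_eq {ι : Type*} [Finite ι] {f : ι → (Vec n →L[ℝ] ℝ)}
    (hf : LinearIndependent ℝ f) (y : ι → ℝ) : ∃ d, ∀ i, f i d = y i := by
  classical
  have := Fintype.ofFinite ι
  let F : Vec n →ₗ[ℝ] (ι → ℝ) := LinearMap.pi fun i => (f i : Vec n →ₗ[ℝ] ℝ)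
  have hF : Function.Surjective F := by
    -- Dually, a functional on `ι → ℝ` that vanishes on the image has its values on the unit vectors
    -- as coefficients of a linear relation among the `f i`.
    rw [← LinearMap.dualMap_injective_iff, injective_iff_map_eq_zero]
    intro φ hφ
    have h1 : ∀ v, φ v = ∑ i, v i * φ (Pi.single i 1) := fun v => by
      conv_lhs => rw [pi_eq_sum_univ' v]
      simp
    have h2 : ∑ i, φ (Pi.single i 1) • f i = 0 := by
      ext1 d
      have := LinearMap.congr_fun hφ d
      rw [LinearMap.dualMap_apply, h1] at this
      simpa [F, mul_comm] using this
    have h3 := Fintype.linearIndependent_iff.1 hf _ h2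
    exact LinearMap.ext fun v => by rw [h1]; simp [h3]
  obtain ⟨d, hd⟩ := hF y
  exact ⟨d, fun i => by rw [← hd]; rfl⟩

/-- By independence of the differentials of `(g', h')`, a relation among those of `(g, h)` can be
tested on arbitrary values `y`, `z`. The choice `z = 0` and `y` a unit vector kills the coefficients
of `g`; then `z` with `A z` a unit vector kills those of `h`. -/
lemma KGEquiv.licq (H : KGEquiv g h g' h') (hg' : IsCentered g') (hh' : IsCentered h')
    (hl : LinearIndependent ℝ (Sum.elim (diff g') (diff h'))) :
    LinearIndependent ℝ (Sum.elim (diff g) (diff h)) := by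
  obtain ⟨hg, hh, L, c, σ, B, A, hc, hA, dg, dh, hT⟩ := H.exists_linear hg' hh'
  rw [Fintype.linearIndependent_iff]
  intro a ha
  have hsurj := exists_forall_apply_eq hl
  simp only [Fintype.sum_sum_type, Sum.elim_inl, Sum.elim_inr] at ha
  have ha' : ∀ y : Fin q → ℝ, ∀ z : Fin r → ℝ,
      ∑ i, a (Sum.inl i) * (c i * y (σ i) + (B *ᵥ z) i)
        + ∑ j, a (Sum.inr j) * (A *ᵥ z) j = 0 := by
    intro y z
    obtain ⟨d, hd⟩ := hsurj (Sum.elim y z)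
    have h1 : ∀ i, diff g' i d = y i := fun i => hd (Sum.inl i)
    have h2 : (fun j => diff h' j d) = z := funext fun j => hd (Sum.inr j)
    have := DFunLike.congr_fun ha (L.symm d)
    simpa [dg, dh, h1, h2] using this
  have hal : ∀ i, a (Sum.inl i) = 0 := by
    intro i
    have := ha' (Pi.single (σ i) 1) 0
    simp only [Matrix.mulVec_zero, Pi.zero_apply, add_zero, mul_zero, Finset.sum_const_zero] at this
    rw [Finset.sum_eq_single i (fun k _ hk => by
      rw [Pi.single_eq_of_ne (fun h => hk (σ.injective h))]; simp) (by simp)] at this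
    simpa [(hc i).ne'] using this
  have har : ∀ j, a (Sum.inr j) = 0 := by
    intro j
    obtain ⟨z, hz⟩ := (Matrix.mulVec_surjective_iff_isUnit.2 hA) (Pi.single j 1)
    have := ha' 0 z
    simpa [hal, hz, Pi.single_apply] using this
  rintro (i | j)
  exacts [hal i, har j]

/-- Used to refute LICQ: in the singular normal forms the last differential is a combination of the
others, so its value cannot be prescribed independently. -/
lemma KGEquiv.exists_diff_of_licq {h h' : Vec n → Fin 0 → ℝ} (H : KGEquiv g h g' h')
    (hg' : IsCentered g') (hl : LICQ g h) (y : Fin q → ℝ) : ∃ d, ∀ i, diff g' i d = y i := by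
  obtain ⟨hg, hh, L, c, σ, B, A, hc, hA, dg, dh, hT⟩ :=
    H.exists_linear hg' ⟨Subsingleton.elim _ _, fun i => i.elim0⟩
  obtain ⟨d, hd⟩ := exists_forall_apply_eq hl
    (Sum.elim (fun i => c i.1 * y (σ i.1)) fun j => j.elim0)
  refine ⟨L d, fun i => ?_⟩
  have := hd (Sum.inl ⟨σ.symm i, by simp [hg.zero]⟩)
  simpa [dg, (hc _).ne', Matrix.mulVec, dotProduct] using this

lemma KGEquiv.mfcq_iff {h h' : Vec n → Fin 0 → ℝ} (H : KGEquiv g h g' h')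
    (hg' : IsCentered g') : MFCQ g h ↔ ∃ d, ∀ i, diff g' i d < 0 := by
  obtain ⟨hg, hh, L, c, σ, B, A, hc, hA, dg, dh, hT⟩ :=
    H.exists_linear hg' ⟨Subsingleton.elim _ _, fun i => i.elim0⟩
  have dg' : ∀ i d, diff g i d = c i * diff g' (σ i) (L d) := fun i d => by
    rw [dg]; simp [Matrix.mulVec, dotProduct]
  constructor
  · rintro ⟨-, d, hd, -⟩
    refine ⟨L d, fun i => ?_⟩
    have := hd ⟨σ.symm i, by simp [hg.zero]⟩
    rw [dg', Equiv.apply_symm_apply] at this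
    exact (smul_neg_iff_of_pos_left (hc _)).1 this
  · rintro ⟨d, hd⟩
    refine ⟨linearIndependent_empty_type, L.symm d, fun i => ?_, fun j => j.elim0⟩
    rw [dg', ContinuousLinearEquiv.apply_symm_apply]
    exact mul_neg_of_pos_of_neg (hc _) (hd _)

end invariance

/-! ### Regular germs -/

/-- The inverse function theorem, with the inverse smooth on a whole neighbourhood of the origin and
not just at it. -/
lemma isDiffeoGerm_of_hasFDerivAt {n : ℕ} {φ : Vec n → Vec n} (hs : SmoothGerm φ) (h0 : φ 0 = 0)
    (L : Vec n ≃L[ℝ] Vec n) (hL : HasFDerivAt φ (L : Vec n →L[ℝ] Vec n) 0) : IsDiffeoGerm φ := by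
  have hc : ContDiffAt ℝ ∞ φ 0 := hs.self_of_nhds
  have hne : (∞ : WithTop ℕ∞) ≠ 0 := by simp
  let e := hc.toOpenPartialHomeomorph φ hL hne
  have he : (e : Vec n → Vec n) = φ := rfl
  have hsrc : (0 : Vec n) ∈ e.source := hc.mem_toOpenPartialHomeomorph_source hL hne
  have htgt : (0 : Vec n) ∈ e.target := by
    have := hc.image_mem_toOpenPartialHomeomorph_target hL hne
    rwa [h0] at this
  have hs0 : e.symm 0 = 0 := by
    have := e.left_inv hsrc
    rwa [he, h0] at this
  have hcont : Tendsto e.symm (𝓝 0) (𝓝 0) := by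
    have := e.continuousAt_symm htgt
    rwa [ContinuousAt, hs0] at this
  -- Invertible operators form an open set and the derivative of `φ` is continuous at the origin.
  have hinv : ∀ᶠ x in 𝓝 (0 : Vec n), fderiv ℝ φ x ∈
      Set.range ((↑) : (Vec n ≃L[ℝ] Vec n) → Vec n →L[ℝ] Vec n) := by
    have h1 := hc.continuousAt_fderiv hne
    rw [ContinuousAt, hL.fderiv] at h1
    exact h1.eventually (ContinuousLinearEquiv.nhds L)
  refine ⟨hs, h0, e.symm, ?_, hs0, ?_, ?_⟩
  · filter_upwards [hcont.eventually (hinv.and hs), e.open_target.mem_nhds htgt] with y hy hyt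
    obtain ⟨⟨L', hL'⟩, hy2⟩ := hy
    refine e.contDiffAt_symm (f₀' := L') hyt ?_ hy2
    rw [hL']
    exact (hy2.differentiableAt (by simp)).hasFDerivAt
  · filter_upwards [e.open_source.mem_nhds hsrc] with x hx using e.left_inv hx
  · filter_upwards [e.open_target.mem_nhds htgt] with x hx using e.right_inv hx

/-- The missing functionals are linear coordinates on the common kernel of the `F i`, composed with
a projection `P` onto that kernel. -/
lemma exists_extension {n m : ℕ} {F : Fin m → (Vec n →L[ℝ] ℝ)} (hF : LinearIndependent ℝ F) :
    m ≤ n ∧ ∃ G : Fin n → (Vec n →L[ℝ] ℝ), (∀ (k : Fin n) (hk : k.1 < m), G k = F ⟨k, hk⟩) ∧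
      ∀ d, (∀ k, G k d = 0) → d = 0 := by
  let Φ : Vec n →ₗ[ℝ] (Fin m → ℝ) := LinearMap.pi fun i => (F i : Vec n →ₗ[ℝ] ℝ)
  have hΦ : Function.Surjective Φ := fun y => by
    obtain ⟨d, hd⟩ := exists_forall_apply_eq hF y
    exact ⟨d, funext hd⟩
  have hrank := LinearMap.finrank_range_add_finrank_ker Φ
  rw [LinearMap.range_eq_top.2 hΦ, finrank_top, Module.finrank_fin_fun, Module.finrank_fin_fun]
    at hrank
  have hmn : m ≤ n := by omega
  obtain ⟨P, hP⟩ := LinearMap.exists_leftInverse_of_injective (LinearMap.ker Φ).subtype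
    (Submodule.ker_subtype _)
  let κ : LinearMap.ker Φ ≃ₗ[ℝ] (Fin (n - m) → ℝ) :=
    LinearEquiv.ofFinrankEq _ _ (by rw [Module.finrank_fin_fun]; omega)
  let G : Fin n → (Vec n →L[ℝ] ℝ) := fun k =>
    if hk : k.1 < m then F ⟨k, hk⟩
    else LinearMap.toContinuousLinearMap
      (LinearMap.proj (⟨k.1 - m, by omega⟩ : Fin (n - m)) ∘ₗ κ.toLinearMap ∘ₗ P)
  refine ⟨hmn, G, fun k hk => dif_pos hk, fun d hd => ?_⟩
  have hker : d ∈ LinearMap.ker Φ := by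
    rw [LinearMap.mem_ker]
    ext i
    have := hd ⟨i, by omega⟩
    simpa [G, Φ] using this
  have h1 : P d = ⟨d, hker⟩ := LinearMap.congr_fun hP ⟨d, hker⟩
  have h2 : κ ⟨d, hker⟩ = 0 := by
    ext i
    have := hd ⟨m + i, by omega⟩
    simpa [G, h1] using this
  simpa using h2

lemma coord_of_le {n : ℕ} (x : Vec n) {j : ℕ} (h1 : 1 ≤ j) (h2 : j ≤ n) :
    coord x j = x ⟨j - 1, by omega⟩ := dif_pos ⟨h1, h2⟩

/-- The coordinate `x_j` as a linear functional. -/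
def coordL (n j : ℕ) : Vec n →L[ℝ] ℝ :=
  if hj : 1 ≤ j ∧ j ≤ n then ContinuousLinearMap.proj ⟨j - 1, by omega⟩ else 0

@[simp] lemma coordL_apply {n : ℕ} (j : ℕ) (x : Vec n) : coordL n j x = coord x j := by
  by_cases hj : 1 ≤ j ∧ j ≤ n <;> simp [coordL, coord, hj]

lemma hasFDerivAt_coord {n : ℕ} (j : ℕ) (x : Vec n) :
    HasFDerivAt (fun x => coord x j) (coordL n j) x :=
  (coordL n j).hasFDerivAt.congr_of_eventuallyEq
    (Eventually.of_forall fun y => (coordL_apply j y).symm)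

lemma isCentered_coords {n : ℕ} (a m : ℕ) : IsCentered (coords (n := n) a m) :=
  ⟨funext fun i => by change coord 0 _ = 0; rw [← coordL_apply, map_zero],
    fun _ => (hasFDerivAt_coord _ _).differentiableAt⟩

lemma diff_coords {n : ℕ} (a m : ℕ) (i : Fin m) :
    diff (coords (n := n) a m) i = coordL n (a + i + 1) := (hasFDerivAt_coord _ _).fderiv

lemma linearIndependent_regular {n s r : ℕ} (hsr : s + r ≤ n) :
    LinearIndependent ℝ (Sum.elim (diff (coords (n := n) 0 s)) (diff (coords (n := n) s r))) := by
  rw [Fintype.linearIndependent_iff]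
  intro a ha
  simp only [Fintype.sum_sum_type, Sum.elim_inl, Sum.elim_inr, diff_coords] at ha
  -- Evaluation at a unit vector isolates one coefficient. The numbering from `1` in `coord` makes
  -- the coordinate `a + i + 1` the entry with index `a + i`.
  have key : ∀ k : Fin n, ∑ i, a (Sum.inl i) * (if i.1 = k.1 then 1 else 0)
      + ∑ j, a (Sum.inr j) * (if s + j.1 = k.1 then 1 else 0) = (0 : ℝ) := fun k => by
    have := DFunLike.congr_fun ha (Pi.single k 1)
    simp only [add_apply, sum_apply, smul_apply, coordL_apply, smul_eq_mul,
      zero_apply] at this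
    refine Eq.trans ?_ this
    congr 1 <;> refine Finset.sum_congr rfl fun i _ => ?_
    · rw [coord_of_le _ (by omega) (by omega)]
      simp [Pi.single_apply, Fin.ext_iff]
    · rw [coord_of_le _ (by omega) (by omega)]
      simp [Pi.single_apply, Fin.ext_iff]
  rintro (i | j)
  · have := key ⟨i, by omega⟩
    rw [Finset.sum_eq_single i (fun b _ hb => by simp [Fin.val_ne_of_ne hb]) (by simp),
      Finset.sum_eq_zero (fun b _ => by rw [if_neg (by simp only []; omega), mul_zero])] at this
    simpa using this
  · have := key ⟨s + j, by omega⟩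
    rw [Finset.sum_eq_zero (fun b _ => by rw [if_neg (by simp only []; omega), mul_zero]),
      Finset.sum_eq_single j (fun b _ hb => by simp [Fin.val_ne_of_ne hb]) (by simp)] at this
    simpa using this

lemma smoothGerm_apply {n m : ℕ} {f : Vec n → Fin m → ℝ} (hf : SmoothGerm f) (i : Fin m) :
    SmoothGerm fun x => f x i :=
  Eventually.mono hf fun _ hx => contDiffAt_pi.1 hx i

lemma smoothGerm_const {n : ℕ} (c : ℝ) : SmoothGerm fun _ : Vec n => c :=
  Eventually.of_forall fun _ => contDiffAt_const

/-- LICQ holds exactly for the regular class. -/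
theorem LICQ_iff_regular {n q r : ℕ} (g : Vec n → Fin q → ℝ) (h : Vec n → Fin r → ℝ)
    (hg : SmoothGerm g) (hh : SmoothGerm h) (h0 : h 0 = 0) :
    LICQ g h ↔ ∃ (s : ℕ) (e : Fin s ≃ Active g), s + r ≤ n ∧
      KGEquiv (fun x a => g x (e a).1) h (coords 0 s) (coords s r) := by
  have hre : ∀ (s : ℕ) (e : Fin s ≃ Active g), LICQ g h ↔
      LinearIndependent ℝ (Sum.elim (diff fun x a => g x (e a).1) (diff h)) := fun s e => by
    rw [LICQ, ← linearIndependent_equiv (Equiv.sumCongr e (Equiv.refl (Fin r)))]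
    have : Sum.elim (fun i : Active g => diff g i.1) (fun j => diff h j) ∘
        Equiv.sumCongr e (Equiv.refl (Fin r)) =
        Sum.elim (diff fun x a => g x (e a).1) (diff h) := by
      ext1 (i | j) <;> rfl
    rw [this]
  constructor
  · intro hl
    let s := Fintype.card (Active g)
    let e : Fin s ≃ Active g := (Fintype.equivFin _).symm
    rw [hre s e, ← linearIndependent_equiv finSumFinEquiv.symm] at hl
    obtain ⟨hsr, G, hG, hG0⟩ := exists_extension hl
    refine ⟨s, e, hsr, ?_⟩
    have hG1 : ∀ a : Fin s, G ⟨a, by omega⟩ = diff (fun x a => g x (e a).1) a := fun a => by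
      rw [hG _ (show a.1 < s + r by omega)]
      simp only [Function.comp]
      rw [show (⟨a.1, by omega⟩ : Fin (s + r)) = finSumFinEquiv (Sum.inl a) from rfl,
        Equiv.symm_apply_apply, Sum.elim_inl]
    have hG2 : ∀ b : Fin r, G ⟨s + b, by omega⟩ = diff h b := fun b => by
      rw [hG _ (show s + b.1 < s + r by omega)]
      simp only [Function.comp]
      rw [show (⟨s + b.1, by omega⟩ : Fin (s + r)) = finSumFinEquiv (Sum.inr b) from rfl,
        Equiv.symm_apply_apply, Sum.elim_inr]
    -- The active constraints, the equalities and the completing functionals serve as new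
    -- coordinates. The differential of `φ` at the origin is `G`, which is injective, so `φ` is a
    -- diffeomorphism-germ and the equivalence holds with `C = 1`, `B = 0`, `A = 1`.
    let φ : Vec n → Vec n := fun x k =>
      if h1 : k.1 < s then g x (e ⟨k, h1⟩).1
      else if h2 : k.1 < s + r then h x ⟨k.1 - s, by omega⟩ else G k x
    have hφ1 : ∀ x (a : Fin s), φ x ⟨a, by omega⟩ = g x (e a).1 := fun x a => by simp [φ]
    have hφ2 : ∀ x (b : Fin r), φ x ⟨s + b, by omega⟩ = h x b := fun x b => by simp [φ]
    have hφ3 : ∀ x (k : Fin n), s + r ≤ k.1 → φ x k = G k x := fun x k hk => by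
      simp only [φ]
      rw [dif_neg (by omega), dif_neg (by omega)]
    have hcase : ∀ k : Fin n, (∃ a : Fin s, k = ⟨a, by omega⟩) ∨
        (∃ b : Fin r, k = ⟨s + b, by omega⟩) ∨ s + r ≤ k.1 := fun k => by
      by_cases h1 : k.1 < s
      · exact Or.inl ⟨⟨k, h1⟩, rfl⟩
      · by_cases h2 : k.1 < s + r
        · exact Or.inr (Or.inl ⟨⟨k.1 - s, by omega⟩, Fin.ext (by simp only []; omega)⟩)
        · exact Or.inr (Or.inr (by omega))
    have hsm : SmoothGerm φ := by
      filter_upwards [hg, hh] with x hx hx'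
      refine contDiffAt_pi.2 fun k => ?_
      rcases hcase k with ⟨a, rfl⟩ | ⟨b, rfl⟩ | hk
      · simp only [hφ1]; exact contDiffAt_pi.1 hx _
      · simp only [hφ2]; exact contDiffAt_pi.1 hx' _
      · simp only [hφ3 _ _ hk]; exact (G k).contDiff.contDiffAt
    have hφ0 : φ 0 = 0 := funext fun k => by
      rcases hcase k with ⟨a, rfl⟩ | ⟨b, rfl⟩ | hk
      · rw [hφ1]; exact (e a).2
      · rw [hφ2, h0]; rfl
      · rw [hφ3 _ _ hk, map_zero]; rfl
    have hder : HasFDerivAt φ (ContinuousLinearMap.pi G) 0 := by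
      have hk : ∀ k, HasFDerivAt (fun x => φ x k) (G k) 0 := fun k => ?_
      · exact hasFDerivAt_pi.2 hk
      rcases hcase k with ⟨a, rfl⟩ | ⟨b, rfl⟩ | hk
      · simp only [hφ1, hG1]
        exact (smoothGerm_apply hg (e a).1).differentiableAt.hasFDerivAt
      · simp only [hφ2, hG2]
        exact (smoothGerm_apply hh b).differentiableAt.hasFDerivAt
      · simp only [hφ3 _ _ hk]; exact (G k).hasFDerivAt
    have hinj : Function.Injective (ContinuousLinearMap.pi G : Vec n →L[ℝ] Vec n) := by
      refine (injective_iff_map_eq_zero _).2 fun d hd => hG0 d fun k => congrFun hd k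
    let L : Vec n ≃L[ℝ] Vec n :=
      (LinearEquiv.ofInjectiveEndo ((ContinuousLinearMap.pi G : Vec n →L[ℝ] Vec n) :
        Vec n →ₗ[ℝ] Vec n) hinj).toContinuousLinearEquiv
    have hL : (L : Vec n →L[ℝ] Vec n) = ContinuousLinearMap.pi G := by ext1 d; rfl
    refine ⟨φ, fun _ => 1, fun _ => 0, fun _ => 1,
      isDiffeoGerm_of_hasFDerivAt hsm hφ0 L (by rw [hL]; exact hder),
      fun i j => smoothGerm_const _, fun i j => smoothGerm_const _, fun i j => smoothGerm_const _,
      Eventually.of_forall fun x => ⟨⟨fun _ => 1, 1, fun _ => one_pos, by simp⟩, isUnit_one,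
        ?_, ?_⟩⟩
    · rw [Matrix.one_mulVec, Matrix.zero_mulVec, add_zero]
      ext a
      change g x (e a).1 = _
      rw [← hφ1 x a, coords, coord_of_le _ (by omega) (by omega)]
      congr 1
      exact Fin.ext (by simp)
    · rw [Matrix.one_mulVec]
      ext b
      rw [← hφ2 x b, coords, coord_of_le _ (by omega) (by omega)]
      rfl
  · rintro ⟨s, e, hsr, H⟩
    rw [hre s e]
    exact H.licq (isCentered_coords _ _) (isCentered_coords _ _) (linearIndependent_regular hsr)

/-! ### Coordinates -/

section coordinates

variable {n : ℕ}

@[simp] lemma coord_smul (s : ℝ) (x : Vec n) (j : ℕ) : coord (s • x) j = s * coord x j := by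
  simp only [← coordL_apply, map_smul, smul_eq_mul]

@[simp] lemma coord_zero (j : ℕ) : coord (0 : Vec n) j = 0 := by
  simp only [← coordL_apply, map_zero]

@[fun_prop] lemma continuous_coord (j : ℕ) : Continuous fun x : Vec n => coord x j := by
  simp only [← coordL_apply]; fun_prop

@[fun_prop] lemma differentiable_coord (j : ℕ) : Differentiable ℝ fun x : Vec n => coord x j :=
  fun x => (hasFDerivAt_coord j x).differentiableAt

@[simp] lemma tail_smul (ε : ℕ → ℝ) (a : ℕ) (s : ℝ) (x : Vec n) :
    tail ε a (s • x) = s ^ 2 * tail ε a x := by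
  simp only [tail, Finset.mul_sum, coord_smul]
  exact Finset.sum_congr rfl fun j _ => by ring

@[simp] lemma tail_zero (ε : ℕ → ℝ) (a : ℕ) : tail ε a (0 : Vec n) = 0 := by simp [tail]

@[fun_prop] lemma continuous_tail (ε : ℕ → ℝ) (a : ℕ) : Continuous fun x : Vec n => tail ε a x := by
  unfold tail; fun_prop

@[fun_prop] lemma differentiable_tail (ε : ℕ → ℝ) (a : ℕ) :
    Differentiable ℝ fun x : Vec n => tail ε a x := by
  unfold tail; fun_prop

/-- Replace the coordinate `x_j` by `r`. -/
def upd (x : Vec n) (j : ℕ) (r : ℝ) : Vec n := fun i => if i.val + 1 = j then r else x i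

lemma coord_upd_self (x : Vec n) {j : ℕ} (h1 : 1 ≤ j) (h2 : j ≤ n) (r : ℝ) :
    coord (upd x j r) j = r := by
  rw [coord_of_le _ h1 h2, upd, if_pos (by simp only []; omega)]

lemma coord_upd_ne (x : Vec n) {i j : ℕ} (h : i ≠ j) (r : ℝ) :
    coord (upd x j r) i = coord x i := by
  unfold coord
  split_ifs with hi
  · rw [upd, if_neg (by simp only []; omega)]
  · rfl

lemma upd_eq (x : Vec n) {j : ℕ} (h1 : 1 ≤ j) (h2 : j ≤ n) (r : ℝ) :
    upd x j r = x + (r - coord x j) • upd 0 j 1 := by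
  ext i
  by_cases hi : i.val + 1 = j
  · subst hi
    simp [upd, coord_of_le x h1 h2]
  · simp [upd, hi]

lemma map_upd (ℓ : Vec n →ₗ[ℝ] ℝ) (x : Vec n) {j : ℕ} (h1 : 1 ≤ j) (h2 : j ≤ n) (r : ℝ) :
    ℓ (upd x j r) = ℓ x + (r - coord x j) * ℓ (upd 0 j 1) := by
  rw [upd_eq x h1 h2, map_add, map_smul, smul_eq_mul]

lemma upd_coord (x : Vec n) {j : ℕ} (h1 : 1 ≤ j) (h2 : j ≤ n) : upd x j (coord x j) = x := by
  rw [upd_eq x h1 h2, sub_self, zero_smul, add_zero]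

lemma tail_upd_of_lt (ε : ℕ → ℝ) {a j : ℕ} (h : j < a) (x : Vec n) (r : ℝ) :
    tail ε a (upd x j r) = tail ε a x := by
  refine Finset.sum_congr rfl fun i hi => ?_
  rw [coord_upd_ne _ (by have := (Finset.mem_Icc.1 hi).1; omega)]

lemma tail_upd (ε : ℕ → ℝ) {a j : ℕ} (h1 : 1 ≤ j) (ha : a ≤ j) (h2 : j ≤ n) (x : Vec n) (r : ℝ) :
    tail ε a (upd x j r) = tail ε a x + ε j * (r ^ 2 - coord x j ^ 2) := by
  have hj : j ∈ Finset.Icc a n := Finset.mem_Icc.2 ⟨ha, h2⟩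
  unfold tail
  rw [← Finset.add_sum_erase _ _ hj, ← Finset.add_sum_erase (Finset.Icc a n)
    (fun i => ε i * coord x i ^ 2) hj, coord_upd_self _ h1 h2]
  rw [Finset.sum_congr rfl fun i hi => by rw [coord_upd_ne x (Finset.ne_of_mem_erase hi) r]]
  ring

lemma tail_of_allEq_one {ε : ℕ → ℝ} {a : ℕ} (h : AllEq ε a n 1) {x : Vec n} {m : ℕ}
    (ha : a ≤ m) (hm : m ≤ n) : coord x m ^ 2 ≤ tail ε a x := by
  have := Finset.single_le_sum (s := Finset.Icc a n) (f := fun j => ε j * coord x j ^ 2)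
    (fun j hj => by rw [h j (by simpa using hj)]; positivity) (Finset.mem_Icc.2 ⟨ha, hm⟩)
  simpa [tail, h m ⟨ha, hm⟩] using this

lemma tail_nonneg {ε : ℕ → ℝ} {a : ℕ} (h : AllEq ε a n 1) (x : Vec n) : 0 ≤ tail ε a x :=
  Finset.sum_nonneg fun j hj => by rw [h j (by simpa using hj)]; positivity

lemma tail_neg (ε : ℕ → ℝ) (a : ℕ) (x : Vec n) : tail (fun j => -ε j) a x = -tail ε a x := by
  simp [tail]

lemma tail_nonpos {ε : ℕ → ℝ} {a : ℕ} (h : AllEq ε a n (-1)) (x : Vec n) : tail ε a x ≤ 0 := by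
  have := tail_nonneg (ε := fun j => -ε j) (a := a) (fun j hj => by simp [h j hj]) x
  rw [tail_neg] at this
  linarith

lemma tendsto_upd {x : Vec n} {j : ℕ} {F : Filter ℝ} {r : ℝ → ℝ} {c : ℝ}
    (hr : Tendsto r F (𝓝 c)) {y : ℝ → Vec n} (hy : Tendsto y F (𝓝 x)) :
    Tendsto (fun s => upd (y s) j (r s)) F (𝓝 (upd x j c)) := by
  refine tendsto_pi_nhds.2 fun i => ?_
  by_cases hi : i.val + 1 = j
  · simpa [upd, hi] using hr
  · simpa [upd, hi] using tendsto_pi_nhds.1 hy i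

/-- Vectors with `d_1 = ⋯ = d_l = 0` and `d_1, …, d_p ≤ 0`. -/
def cone (n l p : ℕ) : Set (Vec n) :=
  {d | (∀ j, 1 ≤ j → j ≤ l → coord d j = 0) ∧ ∀ j, 1 ≤ j → j ≤ p → coord d j ≤ 0}

lemma zero_mem_cone (l p : ℕ) : (0 : Vec n) ∈ cone n l p := by simp [cone]

lemma upd_mem_cone {l p j : ℕ} {d : Vec n} (hd : d ∈ cone n l p) {r : ℝ} (hl : l < j) (hn : j ≤ n)
    (hr : j ≤ p → r ≤ 0) : upd d j r ∈ cone n l p := by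
  refine ⟨fun i h1 h2 => ?_, fun i h1 h2 => ?_⟩
  · rw [coord_upd_ne _ (by omega)]; exact hd.1 i h1 h2
  · by_cases hij : i = j
    · subst hij; rw [coord_upd_self _ h1 hn]; exact hr h2
    · rw [coord_upd_ne _ hij]; exact hd.2 i h1 h2

lemma smul_mem_cone {l p : ℕ} {d : Vec n} (hd : d ∈ cone n l p) {s : ℝ} (hs : 0 ≤ s) :
    s • d ∈ cone n l p :=
  ⟨fun i h1 h2 => by rw [coord_smul, hd.1 i h1 h2, mul_zero],
    fun i h1 h2 => by rw [coord_smul]; exact mul_nonpos_of_nonneg_of_nonpos hs (hd.2 i h1 h2)⟩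

end coordinates

/-! ### Functions with a quadratic blow-up -/

/-- `f` vanishes to second order at the origin and `f (s • y) = s² H(s,y)`; the quadratic part of
`f` is `H(0, ·)`. -/
structure Blowup {n : ℕ} (f : Vec n → ℝ) (H : ℝ → Vec n → ℝ) : Prop where
  eq : ∀ s y, f (s • y) = s ^ 2 * H s y
  cont : Continuous fun p : ℝ × Vec n => H p.1 p.2
  diffAt : DifferentiableAt ℝ f 0

namespace Blowup

variable {n : ℕ} {f : Vec n → ℝ} {H : ℝ → Vec n → ℝ} (hB : Blowup f H)
include hB

lemma map_zero : f 0 = 0 := by simpa using hB.eq 0 0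

lemma tendsto_prod (d : Vec n) :
    Tendsto (fun p : ℝ × Vec n => H p.1 p.2) ((𝓝[>] (0 : ℝ)) ×ˢ 𝓝 d) (𝓝 (H 0 d)) := by
  refine (hB.cont.tendsto (0, d)).mono_left ?_
  rw [nhds_prod_eq]
  exact prod_mono nhdsWithin_le_nhds le_rfl

lemma tendsto_fst (d : Vec n) : Tendsto (fun s => H s d) (𝓝[>] 0) (𝓝 (H 0 d)) :=
  (hB.tendsto_prod d).comp (tendsto_id.prodMk tendsto_const_nhds)

lemma apply_zero {s : ℝ} (hs : 0 < s) : H s 0 = 0 := by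
  have := hB.eq s 0
  rw [smul_zero, hB.map_zero] at this
  have h2 : s ^ 2 ≠ 0 := by positivity
  simpa [h2, hs.ne'] using this.symm

/-- At `s = 0` the scaling identity carries no information, so the value is obtained as a limit for
`s → 0⁺`. -/
lemma apply_zero_zero : H 0 0 = 0 := by
  refine tendsto_nhds_unique (hB.tendsto_fst 0) (tendsto_const_nhds.congr' ?_)
  filter_upwards [self_mem_nhdsWithin] with s hs using (hB.apply_zero hs).symm

/-- The difference quotient of `f` along `d` is `s * H s d`, which tends to zero. -/
lemma fderiv_eq_zero : fderiv ℝ f 0 = 0 := by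
  ext1 d
  have h1 := (tendsto_blowup hB.diffAt.hasFDerivAt hB.map_zero d).comp
    ((tendsto_id (x := 𝓝[>] (0 : ℝ))).prodMk (tendsto_const_nhds (x := d)))
  have h2 : Tendsto (fun s : ℝ => s * H s d) (𝓝[>] 0) (𝓝 (0 * H 0 d)) :=
    (tendsto_id.mono_left nhdsWithin_le_nhds).mul (hB.tendsto_fst d)
  rw [zero_mul] at h2
  refine tendsto_nhds_unique h1 (h2.congr' ?_)
  filter_upwards [self_mem_nhdsWithin] with s hs
  have hs' : s ≠ 0 := ne_of_gt hs
  simp only [Function.comp, id, smul_eq_mul, hB.eq]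
  field_simp

/-- The second-order necessary condition: if `H 0 d > 0`, then by continuity `f` is positive at all
`s • y` with `s > 0` small and `y` near `d`. -/
lemma le_of_mem_tcone {M : Set (Vec n)} (hM : ∀ x ∈ M, f x ≤ 0) {d : Vec n} (hd : d ∈ tcone M) :
    H 0 d ≤ 0 := by
  by_contra! hlt
  have hd' : ∃ᶠ p in (𝓝[>] (0 : ℝ)) ×ˢ 𝓝 d, p.1 • p.2 ∈ M := hd
  obtain ⟨p, hpM, hp, hp'⟩ := (hd'.and_eventually ((eventually_fst_pos d).and
    ((hB.tendsto_prod d).eventually (lt_mem_nhds hlt)))).exists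
  have := hM _ hpM
  rw [hB.eq] at this
  have : 0 < p.1 ^ 2 * H p.1 p.2 := by positivity
  linarith

lemma neg : Blowup (fun x => -f x) (fun s y => -H s y) :=
  ⟨fun s y => by rw [hB.eq]; ring, hB.cont.neg, hB.diffAt.neg⟩

lemma eq_of_mem_tcone {M : Set (Vec n)} (hM : ∀ x ∈ M, f x = 0) {d : Vec n} (hd : d ∈ tcone M) :
    H 0 d = 0 :=
  le_antisymm (hB.le_of_mem_tcone (fun x hx => (hM x hx).le) hd)
    (by simpa using hB.neg.le_of_mem_tcone (fun x hx => by simp [hM x hx]) hd)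

end Blowup

lemma nonpos_of_forall_pos {a b : ℝ} (h : ∀ s > 0, a ≤ s * b) : a ≤ 0 := by
  by_contra! ha
  -- This value of `s` satisfies `s * b ≤ a / 2`.
  have := h (a / (2 * (|b| + 1))) (by positivity)
  have h2 : a / (2 * (|b| + 1)) * b ≤ a / (2 * (|b| + 1)) * (|b| + 1) :=
    mul_le_mul_of_nonneg_left (by linarith [le_abs_self b]) (by positivity)
  have h3 : a / (2 * (|b| + 1)) * (|b| + 1) = a / 2 := by field_simp
  linarith

lemma not_polarLE {n : ℕ} {C L : Set (Vec n)} (ℓ : Vec n →L[ℝ] ℝ) (hC : ∀ d ∈ C, ℓ d ≤ 0)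
    {d : Vec n} (hd : d ∈ L) (hpos : 0 < ℓ d) : ¬ PolarLE C L := fun h => by
  have := h (ℓ : Vec n →ₗ[ℝ] ℝ) hC d hd
  exact absurd this (not_le.2 hpos)

lemma functional_le_of_mem_tcone {n : ℕ} {M : Set (Vec n)} (ℓ : Vec n →L[ℝ] ℝ)
    (h : ∀ x ∈ M, ℓ x ≤ 0) : ∀ d ∈ tcone M, ℓ d ≤ 0 := fun _ hd =>
  tcone_le_of_fderiv ℓ.hasFDerivAt (map_zero ℓ) h hd

/-- If on `C` the coordinate `d_m` is dominated by a functional `w` that is nonpositive there,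
then `C` lies in a half-space that does not contain the line spanned by the `m`-th unit vector. -/
lemma not_polarLE_of_sq_le {n l p m : ℕ} {C : Set (Vec n)} (hl : l < m) (hp : p < m) (hn : m ≤ n)
    (w : Vec n →L[ℝ] ℝ) (hw : w (upd 0 m 1) = 0)
    (hC : ∀ d ∈ C, w d ≤ 0 ∧ coord d m ^ 2 ≤ w d ^ 2) : ¬ PolarLE C (cone n l p) := by
  -- On `C` the bound gives `d_m ≤ -w d`, while the functional takes the value `1` at the `m`-th
  -- unit vector.
  refine not_polarLE (coordL n m + w) (fun d hd => ?_)
    (upd_mem_cone (zero_mem_cone l p) (j := m) (r := 1) hl hn (fun h => by omega)) ?_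
  · obtain ⟨h1, h2⟩ := hC d hd
    have := abs_le_of_sq_le_sq' (a := coord d m) (b := -w d) (by simpa using h2) (by linarith)
    rw [add_apply, coordL_apply]
    linarith [this.2]
  · rw [add_apply, coordL_apply, hw, coord_upd_self _ (by omega) hn]
    norm_num

/-! ### One inequality constraint on a cone -/

/-- The feasible set given by `x_1, …, x_p ≤ 0` and `f x ≤ x_1 + ⋯ + x_l`. -/
def ineqSet {n : ℕ} (l p : ℕ) (f : Vec n → ℝ) : Set (Vec n) :=
  {x | (∀ j, 1 ≤ j → j ≤ p → coord x j ≤ 0) ∧ f x ≤ ∑ j ∈ Finset.Icc 1 l, coord x j}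

section ineq

variable {n l p : ℕ} {f : Vec n → ℝ} {H : ℝ → Vec n → ℝ}

lemma nonpos_of_mem_ineqSet (hlp : l ≤ p) {x : Vec n} (hx : x ∈ ineqSet l p f) : f x ≤ 0 :=
  hx.2.trans (Finset.sum_nonpos fun j hj => by
    have := Finset.mem_Icc.1 hj
    exact hx.1 j this.1 (this.2.trans hlp))

/-- On the cone the first `l` coordinates vanish, hence so does the linear side of the constraint,
and the ray through `d` is feasible without correction. -/
lemma mem_tcone_ineqSet (hB : Blowup f H) {d : Vec n} (hd : d ∈ cone n l p)
    (h : ∀ᶠ s in 𝓝[>] (0 : ℝ), H s d ≤ 0) : d ∈ tcone (ineqSet l p f) := by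
  refine mem_tcone_of_curve (γ := fun _ => d) tendsto_const_nhds ?_
  filter_upwards [h, self_mem_nhdsWithin] with s hs hs0
  have hm := smul_mem_cone hd (le_of_lt hs0)
  refine ⟨hm.2, ?_⟩
  rw [hB.eq, Finset.sum_eq_zero fun j hj => by
    have := Finset.mem_Icc.1 hj
    exact hm.1 j this.1 this.2]
  exact mul_nonpos_of_nonneg_of_nonpos (sq_nonneg s) hs

lemma mem_tcone_ineqSet_of_neg (hB : Blowup f H) {d : Vec n} (hd : d ∈ cone n l p)
    (h : H 0 d < 0) : d ∈ tcone (ineqSet l p f) :=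
  mem_tcone_ineqSet hB hd
    (((hB.tendsto_fst d).eventually (gt_mem_nhds h)).mono fun _ hs => le_of_lt hs)

/-- Necessity is the second-order condition. For sufficiency, the `j`-th unit vector forces `e =
-1`; moving the `j`-th coordinate away from zero then makes `H 0` strictly negative, and the
boundary case follows by closedness. -/
lemma cone_subset_tcone_ineqSet_iff (hB : Blowup f H) (hlp : l ≤ p) {j : ℕ} (hp : p < j)
    (hn : j ≤ n) {e : ℝ} (he : IsSign e)
    (hu : ∀ d r, H 0 (upd d j r) = H 0 d + e * (r ^ 2 - coord d j ^ 2)) :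
    cone n l p ⊆ tcone (ineqSet l p f) ↔ ∀ d ∈ cone n l p, H 0 d ≤ 0 := by
  constructor
  · exact fun h d hd => hB.le_of_mem_tcone (fun x hx => nonpos_of_mem_ineqSet hlp hx) (h hd)
  · intro h d hd
    have he1 : e = -1 := by
      rcases he with rfl | rfl
      · have := h _ (upd_mem_cone (zero_mem_cone l p) (j := j) (r := 1) (by omega) hn
          (fun h => by omega))
        rw [hu, hB.apply_zero_zero] at this
        norm_num at this
      · rfl
    subst he1
    -- `c` is a sign of `d_j`, so that adding `c * s` strictly increases the square of that
    -- coordinate.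
    obtain ⟨c, hc, hcs⟩ : ∃ c : ℝ, c ^ 2 = 1 ∧ 0 ≤ c * coord d j := by
      rcases le_total 0 (coord d j) with h1 | h1
      · exact ⟨1, by norm_num, by linarith⟩
      · exact ⟨-1, by norm_num, by linarith⟩
    have hlim : Tendsto (fun s : ℝ => coord d j + c * s) (𝓝[>] 0) (𝓝 (coord d j)) := by
      have : Continuous fun s : ℝ => coord d j + c * s := by fun_prop
      simpa using (this.tendsto 0).mono_left nhdsWithin_le_nhds
    have hlim' := tendsto_upd (j := j) hlim (tendsto_const_nhds (x := d))
    rw [upd_coord d (by omega) hn] at hlim'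
    refine tcone_of_tendsto hlim' ?_
    filter_upwards [self_mem_nhdsWithin] with s (hs : 0 < s)
    refine mem_tcone_ineqSet_of_neg hB (upd_mem_cone hd (by omega) hn fun h => by omega) ?_
    rw [hu]
    have h1 := h d hd
    have h2 : (coord d j + c * s) ^ 2 - coord d j ^ 2 = 2 * s * (c * coord d j) + s ^ 2 := by
      linear_combination s ^ 2 * hc
    have h3 : 0 ≤ 2 * s * (c * coord d j) := by positivity
    have h4 : 0 < s ^ 2 := by positivity
    rw [h2]
    linarith

/-- A large shift of the `j`-th coordinate in either direction makes `H 0` negative, so both shifted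
vectors are tangent. Averaging the two inequalities for `ℓ` gives `ℓ d ≤ 0`. -/
lemma polarLE_ineqSet_of_neg (hB : Blowup f H) (hlp : l ≤ p) {j : ℕ} (hp : p < j) (hn : j ≤ n)
    (hu : ∀ d r, H 0 (upd d j r) = H 0 d + (-1) * (r ^ 2 - coord d j ^ 2)) :
    PolarLE (tcone (ineqSet l p f)) (cone n l p) := by
  intro ℓ hℓ d hd
  -- Chosen so that `N ≥ 1` and `N - 2 |d_j| = |H 0 d| + 1`; a shift by `±N` then lowers `H 0` by at
  -- least `|H 0 d| + 1`.
  set N := 2 * |coord d j| + |H 0 d| + 1 with hN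
  have hN0 : 1 ≤ N := by have := abs_nonneg (coord d j); have := abs_nonneg (H 0 d); linarith
  have key : ∀ c : ℝ, c ^ 2 = 1 → ℓ d + c * N * ℓ (upd 0 j 1) ≤ 0 := by
    intro c hc
    have := hℓ _ (mem_tcone_ineqSet_of_neg hB (upd_mem_cone hd (j := j) (r := coord d j + c * N)
      (by omega) hn fun h => by omega) ?_)
    · rw [map_upd ℓ _ (by omega) hn] at this
      linarith
    · rw [hu]
      have hcabs : |c| = 1 := by
        have : |c| ^ 2 = 1 := by rw [sq_abs]; exact hc
        nlinarith [abs_nonneg c]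
      have h1 : -(|coord d j|) ≤ c * coord d j := by
        have := neg_abs_le (c * coord d j)
        rwa [abs_mul, hcabs, one_mul] at this
      have h2 : (coord d j + c * N) ^ 2 - coord d j ^ 2 = N * (N + 2 * (c * coord d j)) := by
        linear_combination N ^ 2 * hc
      have h3 : |H 0 d| + 1 ≤ N + 2 * (c * coord d j) := by linarith
      have h4 : |H 0 d| + 1 ≤ N * (N + 2 * (c * coord d j)) := by
        have := abs_nonneg (H 0 d)
        nlinarith
      have := le_abs_self (H 0 d)
      rw [h2]; linarith
  have h1 := key 1 (by norm_num)
  have h2 := key (-1) (by norm_num)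
  linarith

/-- A criterion for a free coordinate `w` that is coupled to a constrained coordinate `u`. -/
lemma le_zero_of_coupled_ineq (hB : Blowup f H) {u w : ℕ} (hl : l < u) (hup : u ≤ p) (hpw : p < w)
    (hwn : w ≤ n) {D : Set (Vec n)} (hD : D ⊆ cone n l p) (hDw : ∀ d ∈ D, ∀ r, upd d w r ∈ D)
    (hDu : ∀ d ∈ D, ∀ r ≤ 0, upd d u r ∈ D) {T : Vec n → ℝ} (hT : ∀ d r, T (upd d w r) = T d)
    (hH : ∀ d ∈ D, H 0 d = coord d u * coord d w + T d)
    (hneg : upd 0 w (-1) ∈ tcone (ineqSet l p f)) {ℓ : Vec n →ₗ[ℝ] ℝ}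
    (hℓ : ∀ d ∈ tcone (ineqSet l p f), ℓ d ≤ 0) {d : Vec n} (hd : d ∈ D) : ℓ d ≤ 0 := by
  have hw : 0 ≤ ℓ (upd 0 w 1) := by
    have := hℓ _ hneg
    rw [map_upd ℓ _ (by omega) hwn] at this
    simp at this
    exact this
  have key : ∀ d ∈ D, coord d u < 0 → ℓ d ≤ 0 := by
    intro d hd hu
    -- For `d_u < 0` this makes `d_u * X + T d` negative. As `X ≥ d_w` and `ℓ` is nonnegative at the
    -- `w`-th unit vector, passing from `d` to the tangent vector cannot decrease `ℓ`.
    set X := |coord d w| + |T d| / (-coord d u) + 1 with hX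
    have := hℓ _ (mem_tcone_ineqSet_of_neg hB (hD (hDw d hd X)) ?_)
    · rw [map_upd ℓ _ (by omega) hwn] at this
      have h1 : 0 ≤ X - coord d w := by
        have : 0 ≤ |T d| / (-coord d u) := div_nonneg (abs_nonneg _) (by linarith)
        linarith [le_abs_self (coord d w)]
      have := mul_nonneg h1 hw
      linarith
    · rw [hH _ (hDw d hd X), coord_upd_ne _ (by omega), coord_upd_self _ (by omega) hwn, hT]
      have h1 : coord d u * X = coord d u * |coord d w| - |T d| + coord d u := by
        have := hu.ne
        rw [hX]; field_simp; ring
      have h2 := mul_nonpos_of_nonpos_of_nonneg hu.le (abs_nonneg (coord d w))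
      linarith [le_abs_self (T d)]
  -- The case `d_u = 0` is reached by lowering `d_u` by an arbitrarily small `s`.
  refine nonpos_of_forall_pos (b := ℓ (upd 0 u 1)) fun s hs => ?_
  have hdu := (hD hd).2 u (by omega) hup
  have := key (upd d u (coord d u - s)) (hDu d hd _ (by linarith)) (by
    rw [coord_upd_self _ (by omega) (by omega)]; linarith)
  rw [map_upd ℓ _ (by omega) (by omega)] at this
  linarith

end ineq

/-! ### One equality constraint on a cone -/

/-- The feasible set given by `x_1, …, x_p ≤ 0` and `f x = 0`. -/
def eqSet {n : ℕ} (p : ℕ) (f : Vec n → ℝ) : Set (Vec n) :=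
  {x | (∀ j, 1 ≤ j → j ≤ p → coord x j ≤ 0) ∧ f x = 0}

section equality

variable {n p : ℕ} {f : Vec n → ℝ} {H : ℝ → Vec n → ℝ}

lemma mem_tcone_eqSet (hB : Blowup f H) {d : Vec n} {γ : ℝ → Vec n}
    (hγ : Tendsto γ (𝓝[>] 0) (𝓝 d)) (hc : ∀ᶠ s in 𝓝[>] (0 : ℝ), γ s ∈ cone n 0 p)
    (h : ∀ᶠ s in 𝓝[>] (0 : ℝ), H s (γ s) = 0) : d ∈ tcone (eqSet p f) := by
  refine mem_tcone_of_curve hγ ?_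
  filter_upwards [h, hc, self_mem_nhdsWithin] with s hs hsc hs0
  exact ⟨(smul_mem_cone hsc (le_of_lt hs0)).2, by rw [hB.eq, hs, mul_zero]⟩

/-- `H 0` vanishes on the tangent cone of the zero set, whereas the free unit vector belongs to the
linearized cone. -/
lemma not_cone_subset_tcone_eqSet (hB : Blowup f H) {j : ℕ} (hp : p < j) (hn : j ≤ n)
    (hj : H 0 (upd 0 j 1) ≠ 0) : ¬ cone n 0 p ⊆ tcone (eqSet p f) := fun h =>
  hj (hB.eq_of_mem_tcone (fun x hx => hx.2) (h (upd_mem_cone (zero_mem_cone 0 p) (j := j) (r := 1)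
    (by omega) hn (fun h => by omega))))

/-- The four vectors `±e_j ± e_k` are isotropic, hence tangent, so a polar functional vanishes at
`e_j` and `e_k`. The coordinates `j` and `k` can therefore be altered freely, and suitable square
roots solve `H s = 0` exactly for every `s`. -/
lemma polarLE_eqSet_of_signs (hB : Blowup f H) {j k : ℕ} (hjk : j ≠ k) (hpj : p < j) (hjn : j ≤ n)
    (hpk : p < k) (hkn : k ≤ n)
    (hj : ∀ s d r, H s (upd d j r) = H s d + (r ^ 2 - coord d j ^ 2))
    (hk : ∀ s d r, H s (upd d k r) = H s d - (r ^ 2 - coord d k ^ 2)) :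
    PolarLE (tcone (eqSet p f)) (cone n 0 p) := by
  intro ℓ hℓ d hd
  have hmem : ∀ d ∈ cone n 0 p, ∀ a b, upd (upd d j a) k b ∈ cone n 0 p := fun d hd a b =>
    upd_mem_cone (upd_mem_cone hd (by omega) hjn fun h => by omega) (by omega) hkn
      fun h => by omega
  have hmap : ∀ d a b, ℓ (upd (upd d j a) k b) =
      ℓ d + (a - coord d j) * ℓ (upd 0 j 1) + (b - coord d k) * ℓ (upd 0 k 1) := fun d a b => by
    rw [map_upd ℓ _ (by omega) hkn, map_upd ℓ _ (by omega) hjn, coord_upd_ne _ hjk.symm]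
  have hH : ∀ s d a b, H s (upd (upd d j a) k b) =
      H s d + (a ^ 2 - coord d j ^ 2) - (b ^ 2 - coord d k ^ 2) := fun s d a b => by
    rw [hk, hj, coord_upd_ne _ hjk.symm]
  have hunit : ∀ a b : ℝ, a ^ 2 = b ^ 2 → a * ℓ (upd 0 j 1) + b * ℓ (upd 0 k 1) ≤ 0 := by
    intro a b hab
    have := hℓ _ (mem_tcone_eqSet hB (γ := fun _ => upd (upd 0 j a) k b) tendsto_const_nhds
      (Eventually.of_forall fun s => hmem 0 (zero_mem_cone 0 p) a b) ?_)
    · rw [hmap] at this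
      simpa using this
    · filter_upwards [self_mem_nhdsWithin] with s hs
      rw [hH, hB.apply_zero hs, hab]
      simp
  have h1 := hunit 1 1 rfl
  have h2 := hunit 1 (-1) (by norm_num)
  have h3 := hunit (-1) 1 (by norm_num)
  have h4 := hunit (-1) (-1) rfl
  have hj0 : ℓ (upd 0 j 1) = 0 := by linarith
  have hk0 : ℓ (upd 0 k 1) = 0 := by linarith
  set d₀ := upd (upd d j 0) k 0
  have hdj : coord d₀ j = 0 := by
    rw [coord_upd_ne _ hjk, coord_upd_self _ (by omega) hjn]
  have hdk : coord d₀ k = 0 := coord_upd_self _ (by omega) hkn _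
  -- At most one root is nonzero: it compensates the negative part of `H s d₀` in the coordinate `j`
  -- or its positive part in the coordinate `k`. Continuity of both parts gives convergence.
  have hlim : Tendsto (fun s => upd (upd d₀ j (√(max (-H s d₀) 0))) k (√(max (H s d₀) 0)))
      (𝓝[>] 0) (𝓝 (upd (upd d₀ j (√(max (-H 0 d₀) 0))) k (√(max (H 0 d₀) 0)))) := by
    have ht := hB.tendsto_fst d₀
    exact tendsto_upd (ht.max tendsto_const_nhds).sqrt
      (tendsto_upd (ht.neg.max tendsto_const_nhds).sqrt tendsto_const_nhds)
  have := hℓ _ (mem_tcone_eqSet hB hlim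
    (Eventually.of_forall fun s => hmem _ (hmem d hd _ _) _ _) (Eventually.of_forall fun s => by
      rw [hH, hdj, hdk, Real.sq_sqrt (le_max_right _ _), Real.sq_sqrt (le_max_right _ _)]
      rcases le_total 0 (H s d₀) with h | h
      · rw [max_eq_left h, max_eq_right (by linarith)]; ring
      · rw [max_eq_right h, max_eq_left (by linarith)]; ring))
  rw [hmap, hmap, hj0, hk0] at this
  simpa using this

/-- A criterion for a free coordinate `w` that is coupled to a constrained coordinate `u`. -/
lemma le_zero_of_coupled_eq (hB : Blowup f H) {u w m k : ℕ} (hu1 : 1 ≤ u) (hup : u ≤ p)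
    (hpw : p < w) (hwn : w ≤ n) (hm : m ≠ 0) (hk : k ≠ 0) {D : Set (Vec n)} (hD : D ⊆ cone n 0 p)
    (hDw : ∀ d ∈ D, ∀ r, upd d w r ∈ D) (hDu : ∀ d ∈ D, ∀ r ≤ 0, upd d u r ∈ D) {T : Vec n → ℝ}
    (hTw : ∀ d r, T (upd d w r) = T d) (hTu : ∀ d r, T (upd d u r) = T d) {e : ℝ} (he : e ≠ 0)
    (hH : ∀ d ∈ D, ∀ s, H s d = s ^ m * coord d w ^ k + e * coord d u * coord d w + T d)
    {ℓ : Vec n →ₗ[ℝ] ℝ} (hℓ : ∀ d ∈ tcone (eqSet p f), ℓ d ≤ 0) (hw : ℓ (upd 0 w 1) = 0)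
    {d : Vec n} (hd : d ∈ D) : ℓ d ≤ 0 := by
  have key : ∀ d ∈ D, coord d u < 0 → ℓ d ≤ 0 := by
    intro d hd hu
    -- As `ℓ` vanishes at the `w`-th unit vector, any value `X` of that coordinate will do.
    suffices h : ∃ X, upd d w X ∈ tcone (eqSet p f) by
      obtain ⟨X, hX⟩ := h
      have := hℓ _ hX
      rw [map_upd ℓ _ (by omega) hwn, hw] at this
      linarith
    by_cases hT : T d = 0
    · refine ⟨0, mem_tcone_eqSet hB (γ := fun _ => upd d w 0) tendsto_const_nhds
        (Eventually.of_forall fun s => hD (hDw d hd 0)) (Eventually.of_forall fun s => ?_)⟩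
      rw [hH _ (hDw d hd 0), hTw, hT, coord_upd_self _ (by omega) hwn]
      simp [hk]
    · set X := -T d / (e * coord d u) with hX
      have heu : e * coord d u ≠ 0 := mul_ne_zero he hu.ne
      have hX0 : X ≠ 0 := div_ne_zero (neg_ne_zero.2 hT) heu
      set c : ℝ → ℝ := fun s => -(T d + s ^ m * X ^ k) / (e * X) with hc
      have hc0 : c 0 = coord d u := by
        simp only [hc, zero_pow hm, zero_mul, add_zero]
        have := hu.ne
        rw [div_eq_iff (mul_ne_zero he hX0), hX]
        field_simp
      have hct : Tendsto c (𝓝[>] 0) (𝓝 (coord d u)) := by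
        have : Continuous c := by fun_prop
        rw [← hc0]
        exact (this.tendsto 0).mono_left nhdsWithin_le_nhds
      have hlim := tendsto_upd (j := u) hct (tendsto_const_nhds (x := upd d w X))
      have hcu : coord (upd d w X) u = coord d u := coord_upd_ne _ (by omega) _
      rw [← hcu, upd_coord _ hu1 (by omega)] at hlim
      have hev := hct.eventually (gt_mem_nhds hu)
      refine ⟨X, mem_tcone_eqSet hB hlim ?_ ?_⟩
      · filter_upwards [hev] with s hs using hD (hDu _ (hDw d hd X) _ (le_of_lt hs))
      · filter_upwards [hev] with s hs
        rw [hH _ (hDu _ (hDw d hd X) _ (le_of_lt hs)), hTu, hTw, coord_upd_self _ hu1 (by omega),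
          coord_upd_ne _ (by omega), coord_upd_self _ (by omega) hwn]
        simp only [hc]
        field_simp
        ring
  -- Again the boundary `d_u = 0` is approached from `d_u < 0`.
  refine nonpos_of_forall_pos (b := ℓ (upd 0 u 1)) fun s hs => ?_
  have hdu := (hD hd).2 u (by omega) hup
  have := key (upd d u (coord d u - s)) (hDu d hd _ (by linarith)) (by
    rw [coord_upd_self _ (by omega) (by omega)]; linarith)
  rw [map_upd ℓ _ (by omega) (by omega)] at this
  linarith

end equality

/-! ### Blow-ups of the normal forms -/

/-- The blow-up of the normal form. -/
def EqType.blow {n : ℕ} (ε : ℕ → ℝ) (s : ℝ) (x : Vec n) : EqType → ℝ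
  | t1 k => s ^ (k - 2) * coord x 1 ^ k + tail ε 2 x
  | t2 => s * (coord x 1 ^ 3 + ε 2 * coord x 1 * coord x 2 ^ 2) + coord x 3 ^ 2 + tail ε 4 x

lemma EqType.blowup {n : ℕ} (ε : ℕ → ℝ) {T : EqType} (hT : T.Admissible n) :
    Blowup (fun x : Vec n => T.form ε x) (fun s x => T.blow ε s x) := by
  cases T with
  | t1 k =>
    obtain ⟨m, rfl⟩ : ∃ m, k = m + 2 := ⟨k - 2, by have := hT.1; omega⟩
    simp only [form, blow, Nat.add_sub_cancel]
    exact ⟨fun s x => by simp only [coord_smul, tail_smul]; ring, by fun_prop, by fun_prop⟩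
  | t2 =>
    simp only [form, blow]
    exact ⟨fun s x => by simp only [coord_smul, tail_smul]; ring, by fun_prop, by fun_prop⟩

/-- The blow-up of the function `g̃`. -/
def IneqType.blow {n : ℕ} (q : ℕ) (ε : ℕ → ℝ) (s : ℝ) (x : Vec n) : IneqType → ℝ
  | t1 k => ε q * s ^ (k - 2) * coord x q ^ k + tail ε (q + 1) x
  | t2 => s * (coord x q ^ 3 + ε (q + 1) * coord x q * coord x (q + 1) ^ 2) + tail ε (q + 2) x
  | t3 k => ε (q - 1) * s ^ (k - 2) * coord x (q - 1) ^ k + tail ε q x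
  | t4 k => ε q * s ^ (k - 2) * coord x q ^ k + coord x (q - 1) * coord x q + tail ε (q + 1) x
  | t5 => ε (q - 1) * coord x (q - 1) ^ 2 + s * coord x q ^ 3 + tail ε (q + 1) x
  | t6 δ α => δ 1 * coord x (q - 1) ^ 2 + δ 2 * coord x (q - 2) ^ 2
      + α * coord x (q - 2) * coord x (q - 1) + tail ε q x
  | t7 ε' => ε (q - 2) * (coord x (q - 2) + ε' * coord x (q - 1)) ^ 2
      + s * (ε (q - 1) * coord x (q - 1) ^ 3) + tail ε q x
  | t8 ε' => s * (ε (q - 2) * coord x (q - 2) ^ 3) + ε (q - 1) * coord x (q - 1) ^ 2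
      + ε' * coord x (q - 2) * coord x (q - 1) + tail ε q x
  | t9 ε01 ε02 ε12 => s * coord x q ^ 3 + ε01 * coord x (q - 1) * coord x q
      + ε02 * coord x (q - 2) * coord x q + ε12 * coord x (q - 2) * coord x (q - 1)
      + tail ε (q + 1) x
  | t10 δ α => δ 1 * coord x (q - 3) ^ 2 + δ 2 * coord x (q - 2) ^ 2 + δ 3 * coord x (q - 1) ^ 2
      + α 1 2 * coord x (q - 3) * coord x (q - 2) + α 1 3 * coord x (q - 3) * coord x (q - 1)
      + α 2 3 * coord x (q - 2) * coord x (q - 1)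
      + s * (ε 0 * coord x (q - 3) * coord x (q - 2) * coord x (q - 1)) + tail ε q x

/-- The least exponent in the normal form that is admitted. -/
def IneqType.PowLE : IneqType → Prop
  | t1 k => 2 ≤ k
  | t3 k => 2 ≤ k
  | t4 k => 2 ≤ k
  | _ => True

lemma IneqType.Admissible.powLE {n q : ℕ} {T : IneqType} (hT : T.Admissible n q) : T.PowLE := by
  obtain ⟨-, h⟩ := hT
  cases T with
  | t1 k => exact h.1
  | t3 k => exact h.1
  | t4 k => rcases h.1 with rfl | rfl <;> simp [PowLE]
  | _ => trivial

lemma IneqType.blowup {n : ℕ} (q : ℕ) (ε : ℕ → ℝ) {T : IneqType} (hT : T.PowLE) :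
    Blowup (fun x : Vec n => T.form q ε x) (fun s x => T.blow q ε s x) := by
  cases T with
  | t1 k | t3 k | t4 k =>
    obtain ⟨m, rfl⟩ : ∃ m, k = m + 2 := ⟨k - 2, by have : 2 ≤ k := hT; omega⟩
    simp only [form, blow, Nat.add_sub_cancel]
    exact ⟨fun s x => by simp only [coord_smul, tail_smul]; ring, by fun_prop, by fun_prop⟩
  | _ =>
    simp only [form, blow]
    exact ⟨fun s x => by simp only [coord_smul, tail_smul]; ring, by fun_prop, by fun_prop⟩

/-- The blow-up of the equality constraint. -/
def MixedType.blow {n : ℕ} (ε : ℕ → ℝ) (s : ℝ) (x : Vec n) : MixedType → ℝ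
  | t1 k => s ^ (k - 2) * coord x 1 ^ k + tail ε 2 x
  | t2 => s * coord x 2 ^ 3 + coord x 1 ^ 2 + tail ε 3 x
  | t3 k => s ^ (k - 2) * coord x 2 ^ k + ε 1 * coord x 1 * coord x 2 + tail ε 3 x
  | t4 δ α => δ 1 * coord x 1 ^ 2 + δ 2 * coord x 2 ^ 2 + α * coord x 1 * coord x 2 + tail ε 3 x
  | t5 => s * coord x 1 ^ 3 + ε 1 * coord x 2 ^ 2 + ε 2 * coord x 1 * coord x 2 + tail ε 3 x
  | t6 => (coord x 1 + ε 1 * coord x 2) ^ 2 + s * (ε 2 * coord x 2 ^ 3) + tail ε 3 x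
  | t7 => s * coord x 3 ^ 3 + ε 1 * coord x 2 * coord x 3 + ε 2 * coord x 3 * coord x 1
      + ε 3 * coord x 1 * coord x 2 + tail ε 4 x
  | t8 δ α => δ 1 * coord x 1 ^ 2 + δ 2 * coord x 2 ^ 2 + δ 3 * coord x 3 ^ 2
      + α 1 2 * coord x 1 * coord x 2 + α 1 3 * coord x 1 * coord x 3
      + α 2 3 * coord x 2 * coord x 3
      + s * (ε 1 * coord x 1 * coord x 2 * coord x 3) + tail ε 4 x

lemma MixedType.blowup {n : ℕ} (ε : ℕ → ℝ) {T : MixedType} (hT : T.Admissible n) :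
    Blowup (fun x : Vec n => T.form ε x) (fun s x => T.blow ε s x) := by
  cases T with
  | t1 k | t3 k =>
    obtain ⟨m, rfl⟩ : ∃ m, k = m + 2 := ⟨k - 2, by have := hT.1; omega⟩
    simp only [form, blow, Nat.add_sub_cancel]
    exact ⟨fun s x => by simp only [coord_smul, tail_smul]; ring, by fun_prop, by fun_prop⟩
  | _ =>
    simp only [form, blow]
    exact ⟨fun s x => by simp only [coord_smul, tail_smul]; ring, by fun_prop, by fun_prop⟩

/-! ### The constraint qualifications in terms of the model sets -/

section eqClass

variable {n p : ℕ} {f : Vec n → ℝ} {H : ℝ → Vec n → ℝ}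

lemma feasibleSet_eq_eqSet : feasibleSet (coords 0 p) (single f) = eqSet p f := by
  ext x
  refine and_congr ⟨fun h j h1 h2 => ?_, fun h i => h _ (by omega) (by omega)⟩
    ⟨fun h => h 0, fun h _ => h⟩
  have := h ⟨j - 1, by omega⟩
  rwa [coords, show 0 + (j - 1) + 1 = j by omega] at this

lemma Blowup.isCentered_single (hB : Blowup f H) : IsCentered (single f) :=
  ⟨funext fun _ => hB.map_zero, fun _ => hB.diffAt⟩

lemma Blowup.diff_single (hB : Blowup f H) (j : Fin 1) : diff (single f) j = 0 :=
  hB.fderiv_eq_zero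

lemma linearizedCone_eq_cone (hB : Blowup f H) :
    linearizedCone (coords 0 p) (single f) = cone n 0 p := by
  ext d
  rw [mem_linearizedCone (isCentered_coords 0 p).zero]
  simp only [hB.diff_single, diff_coords, coordL_apply, zero_apply, implies_true, and_true]
  refine ⟨fun h => ⟨fun j h1 h2 => by omega, fun j h1 h2 => ?_⟩,
    fun h i => h.2 _ (by omega) (by omega)⟩
  have := h ⟨j - 1, by omega⟩
  rwa [show 0 + (j - 1) + 1 = j by omega] at this

/-- The constraint qualifications for a class with one equality constraint of vanishing
differential and inequality constraints `x_1, …, x_p`. -/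
theorem eqClass (hB : Blowup f H) {g : Vec n → Fin p → ℝ} {h : Vec n → Fin 1 → ℝ}
    (hK : KGEquiv g h (coords 0 p) (single f)) {j : ℕ} (hp : p < j) (hn : j ≤ n)
    (hj : H 0 (upd 0 j 1) ≠ 0) :
    ¬ LICQ g h ∧ ¬ MFCQ g h ∧ ¬ ACQ g h ∧
      (GCQ g h ↔ PolarLE (tcone (eqSet p f)) (cone n 0 p)) := by
  have hc := isCentered_coords (n := n) 0 p
  have hs := hB.isCentered_single
  have hz := hK.diff_eq_zero hc hs hB.diff_single 0
  obtain ⟨hA, hG⟩ := hK.acq_gcq_iff hc hs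
  have hsub := tangentCone_subset_linearizedCone hc hs
  rw [hA, hG, GCQ_iff_polarLE hsub, ACQ, linearizedCone_eq_cone hB,
    tangentCone_eq_tcone (mem_feasibleSet_zero hc.zero hs.zero), feasibleSet_eq_eqSet]
  exact ⟨not_LICQ_of_diff_eq_zero hz, not_MFCQ_of_diff_eq_zero hz,
    fun h => not_cone_subset_tcone_eqSet hB hp hn hj h.symm.subset, Iff.rfl⟩

end eqClass

section ineqClass

variable {n q l₁ : ℕ} {ε : ℕ → ℝ} {T : IneqType}

lemma IneqType.one_le_gap (T : IneqType) : 1 ≤ T.gap := by cases T <;> simp [gap]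

lemma hasFDerivAt_normalForm (hT : T.PowLE) (i : Fin q) :
    HasFDerivAt (fun x => T.normalForm n q l₁ ε x i)
      (if i.val + 1 < q then coordL n (i.val + 1)
        else ∑ j ∈ Finset.Icc 1 l₁, coordL n j - ∑ j ∈ Finset.Icc (l₁ + 1) (T.len q), coordL n j)
      0 := by
  unfold IneqType.normalForm
  split_ifs with hi
  · exact hasFDerivAt_coord _ _
  · have hB := IneqType.blowup (n := n) q ε hT
    have h1 := hB.diffAt.hasFDerivAt
    rw [hB.fderiv_eq_zero] at h1
    have h2 := ((HasFDerivAt.fun_sum (u := Finset.Icc 1 l₁)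
      fun j _ => hasFDerivAt_coord j (0 : Vec n)).fun_sub
      (HasFDerivAt.fun_sum (u := Finset.Icc (l₁ + 1) (T.len q))
        fun j _ => hasFDerivAt_coord j (0 : Vec n))).fun_add h1
    rw [add_zero] at h2
    exact h2

lemma isCentered_normalForm (hT : T.PowLE) : IsCentered (T.normalForm n q l₁ ε) :=
  ⟨funext fun i => by
    have := (IneqType.blowup (n := n) q ε hT).map_zero
    simp [IneqType.normalForm, this],
    fun i => (hasFDerivAt_normalForm hT i).differentiableAt⟩

lemma diff_normalForm_of_lt (hT : T.PowLE) {j : ℕ} (h1 : 1 ≤ j) (hj : j < q) (d : Vec n) :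
    diff (T.normalForm n q l₁ ε) ⟨j - 1, by omega⟩ d = coord d j := by
  rw [diff, (hasFDerivAt_normalForm hT _).fderiv, if_pos (by simp only []; omega), coordL_apply]
  simp only []
  rw [Nat.sub_add_cancel h1]

lemma diff_normalForm_last (hT : T.PowLE) (hq : 1 ≤ q) (d : Vec n) :
    diff (T.normalForm n q l₁ ε) ⟨q - 1, by omega⟩ d =
      ∑ j ∈ Finset.Icc 1 l₁, coord d j - ∑ j ∈ Finset.Icc (l₁ + 1) (T.len q), coord d j := by
  rw [diff, (hasFDerivAt_normalForm hT _).fderiv, if_neg (by simp only []; omega)]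
  simp

lemma forall_fin_iff {q : ℕ} (hq : 1 ≤ q) (P : Fin q → Prop) :
    (∀ i, P i) ↔ (∀ j, ∀ h1 : 1 ≤ j, ∀ hj : j < q, P ⟨j - 1, by omega⟩) ∧ P ⟨q - 1, by omega⟩ := by
  refine ⟨fun h => ⟨fun j h1 hj => h _, h _⟩, fun h i => ?_⟩
  by_cases hi : i.val + 1 < q
  · exact h.1 (i.val + 1) (by omega) hi
  · have : i = ⟨q - 1, by omega⟩ := Fin.ext (by simp only []; omega)
    rw [this]; exact h.2

/-- LICQ and MFCQ for the classes with inequality constraints only, and ACQ, GCQ in terms of the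
model cones if `l₁ = 0`. -/
theorem ineqClass (hT : T.PowLE) (hq : T.gap ≤ q) (hqn : q ≤ n)
    (hl : l₁ ≤ (T.len q + 1) / 2) {g : Vec n → Fin q → ℝ} {h : Vec n → Fin 0 → ℝ}
    (hK : KGEquiv g h (T.normalForm n q l₁ ε) noConstraint) :
    ¬ LICQ g h ∧ (MFCQ g h ↔ 0 < l₁) ∧ (0 < l₁ → ACQ g h ∧ GCQ g h) ∧
      (l₁ = 0 →
        (ACQ g h ↔ cone n (T.len q) (q - 1) ⊆
          tcone (ineqSet (T.len q) (q - 1) fun x => T.form q ε x)) ∧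
        (GCQ g h ↔ PolarLE (tcone (ineqSet (T.len q) (q - 1) fun x => T.form q ε x))
          (cone n (T.len q) (q - 1)))) := by
  have hgap := T.one_le_gap
  have hlen : T.len q + 1 ≤ q := by unfold IneqType.len; omega
  have hq1 : 1 ≤ q := by omega
  have hc := isCentered_normalForm (n := n) (q := q) (l₁ := l₁) (ε := ε) hT
  have hc' : IsCentered (noConstraint (n := n)) := ⟨Subsingleton.elim _ _, fun i => i.elim0⟩
  have hM : MFCQ g h ↔ 0 < l₁ := by
    rw [hK.mfcq_iff hc]
    simp only [forall_fin_iff hq1, diff_normalForm_last hT hq1]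
    constructor
    · rintro ⟨d, hd, hd'⟩
      by_contra! h0
      obtain rfl : l₁ = 0 := by omega
      -- For `l₁ = 0` the last differential is minus a sum of coordinates that the other constraints
      -- make negative, so it cannot be negative as well.
      have : ∑ j ∈ Finset.Icc (0 + 1) (T.len q), coord d j ≤ 0 :=
        Finset.sum_nonpos fun j hj => by
          have := Finset.mem_Icc.1 hj
          have h2 := hd j (by omega) (by omega)
          rw [diff_normalForm_of_lt hT (by omega) (by omega)] at h2
          exact h2.le
      simp at hd'
      linarith
    · intro h0
      -- The first coordinate enters the last differential with a plus sign; its size `n + 1`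
      -- outweighs the at most `n` entries `-1` that are subtracted.
      refine ⟨fun i => if i.val = 0 then -(n + 1) else -1, fun j h1 hj => ?_, ?_⟩
      · rw [diff_normalForm_of_lt hT h1 hj, coord_of_le _ h1 (by omega)]
        split_ifs
        · have : (0 : ℝ) ≤ n := n.cast_nonneg
          linarith
        · norm_num
      · have h1 : ∑ j ∈ Finset.Icc 1 l₁,
            coord (n := n) (fun i => if i.val = 0 then -((n : ℝ) + 1) else -1) j ≤ -(n + 1) := by
          rw [← Finset.add_sum_erase _ _ (Finset.mem_Icc.2 ⟨le_rfl, h0⟩)]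
          have h2 : ∑ j ∈ (Finset.Icc 1 l₁).erase 1,
              coord (n := n) (fun i => if i.val = 0 then -((n : ℝ) + 1) else -1) j ≤ 0 := by
            refine Finset.sum_nonpos fun j hj => ?_
            have := Finset.mem_Icc.1 (Finset.mem_of_mem_erase hj)
            rw [coord_of_le _ this.1 (by omega)]
            have : (0 : ℝ) ≤ n := n.cast_nonneg
            split_ifs <;> linarith
          rw [coord_of_le _ le_rfl (by omega)]
          simp only [Nat.sub_self, if_true]
          linarith
        have h2 : ∑ j ∈ Finset.Icc (l₁ + 1) (T.len q),
            coord (n := n) (fun i => if i.val = 0 then -((n : ℝ) + 1) else -1) j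
            = -((T.len q + 1 - (l₁ + 1) : ℕ) : ℝ) := by
          rw [Finset.sum_congr rfl (g := fun _ => (-1 : ℝ)) fun j hj => ?_]
          · simp
          · have := Finset.mem_Icc.1 hj
            rw [coord_of_le _ (by omega) (by omega), if_neg (by simp only []; omega)]
        have h3 : ((T.len q + 1 - (l₁ + 1) : ℕ) : ℝ) ≤ n := by
          exact_mod_cast (by omega : T.len q + 1 - (l₁ + 1) ≤ n)
        linarith
  refine ⟨fun hL => ?_, hM, fun h0 => ?_, fun h0 => ?_⟩
  -- Value `0` for the first `q - 1` differentials and `1` for the last is impossible, since the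
  -- last is a combination of the others.
  · obtain ⟨d, hd⟩ := hK.exists_diff_of_licq hc hL fun i => if i.val + 1 < q then 0 else 1
    have h1 : ∀ j, 1 ≤ j → j < q → coord d j = 0 := fun j h1 hj => by
      have := hd ⟨j - 1, by omega⟩
      rwa [diff_normalForm_of_lt hT h1 hj, if_pos (by simp only []; omega)] at this
    have h2 := hd ⟨q - 1, by omega⟩
    rw [diff_normalForm_last hT hq1, if_neg (by simp only []; omega),
      Finset.sum_eq_zero fun j hj => by
        have := Finset.mem_Icc.1 hj
        exact h1 j (by omega) (by omega),
      Finset.sum_eq_zero fun j hj => by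
        have := Finset.mem_Icc.1 hj
        exact h1 j (by omega) (by omega)] at h2
    norm_num at h2
  · have := (hM.2 h0).acq (hK.exists_linear hc hc').1
    exact ⟨this, this.gcq⟩
  -- The last linearized constraint reads `d_1 + ⋯ + d_l ≥ 0`; with all `d_j ≤ 0` this forces `d_1 =
  -- ⋯ = d_l = 0`.
  · subst h0
    have hlin : linearizedCone (T.normalForm n q 0 ε) noConstraint = cone n (T.len q) (q - 1) := by
      ext d
      rw [mem_linearizedCone hc.zero, forall_fin_iff hq1, diff_normalForm_last hT hq1]
      simp only [IsEmpty.forall_iff, and_true]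
      constructor
      · rintro ⟨h1, h2⟩
        have h1' : ∀ j, 1 ≤ j → j ≤ q - 1 → coord d j ≤ 0 := fun j hj hj' => by
          have := h1 j hj (by omega)
          rwa [diff_normalForm_of_lt hT hj (by omega)] at this
        refine ⟨fun j hj hj' => ?_, h1'⟩
        simp only [zero_add, Finset.Icc_eq_empty_of_lt zero_lt_one, Finset.sum_empty, zero_sub,
          Left.neg_nonpos_iff] at h2
        have h3 := (Finset.sum_eq_zero_iff_of_nonpos (s := Finset.Icc 1 (T.len q)) (f := coord d)
          fun j hj => h1' j (Finset.mem_Icc.1 hj).1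
            (by have := (Finset.mem_Icc.1 hj).2; omega)).1
          (le_antisymm (Finset.sum_nonpos fun j hj => h1' j (Finset.mem_Icc.1 hj).1
            (by have := (Finset.mem_Icc.1 hj).2; omega)) h2)
        exact h3 j (Finset.mem_Icc.2 ⟨hj, hj'⟩)
      · rintro ⟨h1, h2⟩
        refine ⟨fun j hj hj' => ?_, ?_⟩
        · rw [diff_normalForm_of_lt hT hj hj']
          exact h2 j hj (by omega)
        · rw [Finset.sum_eq_zero (s := Finset.Icc (0 + 1) (T.len q)) fun j hj =>
            h1 j (by have := Finset.mem_Icc.1 hj; omega) (Finset.mem_Icc.1 hj).2]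
          simp
    have hfeas : feasibleSet (T.normalForm n q 0 ε) noConstraint =
        ineqSet (T.len q) (q - 1) fun x => T.form q ε x := by
      ext x
      simp only [feasibleSet, ineqSet, Set.mem_ofPred_eq, IsEmpty.forall_iff, and_true]
      rw [forall_fin_iff hq1]
      refine and_congr ⟨fun h j h1 h2 => ?_, fun h j h1 h2 => ?_⟩ ?_
      · have := h j h1 (by omega)
        rwa [IneqType.normalForm, if_pos (by simp only []; omega), Nat.sub_add_cancel h1] at this
      · rw [IneqType.normalForm, if_pos (by simp only []; omega), Nat.sub_add_cancel h1]
        exact h j h1 (by omega)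
      · rw [IneqType.normalForm, if_neg (by simp only []; omega)]
        simp only [zero_add, Finset.Icc_eq_empty_of_lt zero_lt_one, Finset.sum_empty, zero_sub]
        constructor <;> intro h <;> linarith
    obtain ⟨hA, hG⟩ := hK.acq_gcq_iff hc hc'
    have hsub := tangentCone_subset_linearizedCone hc hc'
    rw [hA, hG, GCQ_iff_polarLE hsub, ACQ, Set.Subset.antisymm_iff, and_iff_right hsub, hlin,
      tangentCone_eq_tcone (mem_feasibleSet_zero hc.zero hc'.zero), hfeas]
    exact ⟨Iff.rfl, Iff.rfl⟩

end ineqClass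

/-! ### Signs -/

lemma IsSign.sq {a : ℝ} (h : IsSign a) : a ^ 2 = 1 := by rcases h with rfl | rfl <;> norm_num

lemma IsSign.ne_zero {a : ℝ} (h : IsSign a) : a ≠ 0 := by rcases h with rfl | rfl <;> norm_num

lemma IsSign.eq_neg_one {a : ℝ} (h : IsSign a) (h1 : a ≠ 1) : a = -1 := h.resolve_left h1

lemma IsSign.eq_neg_one_of_nonpos {a : ℝ} (h : IsSign a) (h1 : a ≤ 0) : a = -1 :=
  h.resolve_left fun h2 => by rw [h2] at h1; norm_num at h1

lemma exists_of_not_allEq {ε : ℕ → ℝ} (hε : ∀ j, IsSign (ε j)) {a n : ℕ} (h : ¬ AllEq ε a n 1) :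
    ∃ j, a ≤ j ∧ j ≤ n ∧ ε j = -1 := by
  simp only [AllEq, not_forall] at h
  obtain ⟨j, hj, h1⟩ := h
  exact ⟨j, hj.1, hj.2, (hε j).eq_neg_one h1⟩

lemma bothSigns_iff {ε : ℕ → ℝ} (hε : ∀ j, IsSign (ε j)) {a n : ℕ} : BothSigns ε a n ↔
    (∃ j, a ≤ j ∧ j ≤ n ∧ ε j = 1) ∧ ∃ j, a ≤ j ∧ j ≤ n ∧ ε j = -1 := by
  constructor
  · intro h
    have h1 : (1 : ℝ) ∈ ε '' Set.Icc a n := by rw [h]; simp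
    have h2 : (-1 : ℝ) ∈ ε '' Set.Icc a n := by rw [h]; simp
    obtain ⟨j, hj, hj1⟩ := h1
    obtain ⟨k, hk, hk1⟩ := h2
    exact ⟨⟨j, hj.1, hj.2, hj1⟩, k, hk.1, hk.2, hk1⟩
  · rintro ⟨⟨j, hj, hj', hj1⟩, k, hk, hk', hk1⟩
    refine Set.Subset.antisymm ?_ ?_
    · rintro _ ⟨i, -, rfl⟩; exact hε i
    · rintro x (rfl | rfl)
      exacts [⟨j, ⟨hj, hj'⟩, hj1⟩, ⟨k, ⟨hk, hk'⟩, hk1⟩]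

lemma allEq_of_not_bothSigns {ε : ℕ → ℝ} (hε : ∀ j, IsSign (ε j)) {a n : ℕ}
    (h : ¬ BothSigns ε a n) : AllEq ε a n 1 ∨ AllEq ε a n (-1) := by
  rw [bothSigns_iff hε, not_and_or] at h
  push Not at h
  rcases h with h | h
  · exact Or.inr fun j hj => (hε j).eq_neg_one (h j hj.1 hj.2)
  · exact Or.inl fun j hj => (hε j).resolve_right (h j hj.1 hj.2)

lemma coord_le_of_mem_tcone {n j : ℕ} {M : Set (Vec n)} (h : ∀ x ∈ M, coord x j ≤ 0) {d : Vec n}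
    (hd : d ∈ tcone M) : coord d j ≤ 0 := by
  simpa using functional_le_of_mem_tcone (coordL n j) (by simpa using h) d hd

lemma tcone_eqSet_subset_cone {n p : ℕ} {f : Vec n → ℝ} : tcone (eqSet p f) ⊆ cone n 0 p :=
  fun _ hd => ⟨fun j h1 h2 => by omega,
    fun j h1 h2 => coord_le_of_mem_tcone (fun x hx => hx.1 j h1 h2) hd⟩

/-- A definite quadratic form in the free coordinates, bounded in terms of the constrained ones,
prevents GCQ. -/
lemma not_polarLE_eqSet {n p m a : ℕ} {f : Vec n → ℝ} {H : ℝ → Vec n → ℝ} (hB : Blowup f H)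
    (hpm : p < m) (ha : a ≤ m) (hm : m ≤ n) {ε : ℕ → ℝ} (hε : AllEq ε a n 1 ∨ AllEq ε a n (-1))
    (w : Vec n →L[ℝ] ℝ) (hw : w (upd 0 m 1) = 0) (hwC : ∀ d ∈ cone n 0 p, w d ≤ 0)
    (hH : ∀ d ∈ cone n 0 p, |H 0 d - tail ε a d| ≤ w d ^ 2) :
    ¬ PolarLE (tcone (eqSet p f)) (cone n 0 p) := by
  refine not_polarLE_of_sq_le (by omega) hpm hm w hw fun d hd =>
    ⟨hwC d (tcone_eqSet_subset_cone hd), ?_⟩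
  have h1 := hB.eq_of_mem_tcone (fun x hx => hx.2) hd
  have h2 := abs_le.1 (hH d (tcone_eqSet_subset_cone hd))
  rcases hε with hε | hε
  · have := tail_of_allEq_one hε (x := d) ha hm
    linarith
  · have := tail_of_allEq_one (ε := fun j => -ε j) (fun j hj => by simp [hε j hj]) (x := d) ha hm
    rw [tail_neg] at this
    linarith

/-! ### One equality constraint, no inequality constraints -/

/-- The squares with nonzero coefficient in `H 0` decide: two opposite signs give GCQ, and
definiteness forces one coordinate to vanish on the tangent cone. For `k = 2` the term `x_1²` counts
as a square with sign `+`, as does `x_3²` in the second type. -/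
lemma EqType.polarLE_iff {n : ℕ} {ε : ℕ → ℝ} {T : EqType} (hε : ∀ j, IsSign (ε j))
    (hT : T.Admissible n) :
    PolarLE (tcone (eqSet 0 fun x : Vec n => T.form ε x)) (cone n 0 0) ↔ T.GCQCond n ε := by
  have hB := EqType.blowup ε hT
  cases T with
  | t1 k =>
    obtain ⟨hk2, -, hn⟩ := hT
    have htail : ∀ j, 2 ≤ j → j ≤ n → ∀ s (d : Vec n) r, (t1 k).blow ε s (upd d j r) =
        (t1 k).blow ε s d + ε j * (r ^ 2 - coord d j ^ 2) := fun j hj hjn s d r => by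
      simp only [blow]
      rw [tail_upd _ (by omega) hj hjn, coord_upd_ne _ (by omega)]
      ring
    constructor
    · intro hP
      by_contra hcon
      simp only [GCQCond, not_or, not_and] at hcon
      obtain ⟨h1, h2⟩ := hcon
      by_cases hk : k = 2
      · subst hk
        have hall : AllEq ε 2 n 1 := fun j hj =>
          (hε j).resolve_right fun h => h1 rfl ⟨j, hj, h⟩
        refine not_polarLE_of_sq_le (m := 2) (by omega) (by omega) hn 0 (by simp)
          (fun d hd => ?_) hP
        have h3 := hB.eq_of_mem_tcone (fun x hx => hx.2) hd
        simp only [blow, Nat.sub_self, pow_zero, one_mul] at h3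
        have h4 := tail_of_allEq_one hall (x := d) le_rfl hn
        have h5 := sq_nonneg (coord d 1)
        simp only [zero_apply, le_refl, true_and]
        linarith
      -- For `k ≥ 3` the power of `x_1` disappears at `s = 0`, so `H 0` is the tail itself and `w =
      -- 0` suffices.
      · refine not_polarLE_eqSet hB (m := 2) (by omega) le_rfl hn
          (allEq_of_not_bothSigns hε (h2 (by omega))) 0 (by simp) (by simp) (fun d _ => ?_) hP
        simp [blow, zero_pow (show k - 2 ≠ 0 by omega)]
    · rintro (⟨rfl, j, hj, hj1⟩ | ⟨hk3, hb⟩)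
      · refine polarLE_eqSet_of_signs hB (j := 1) (k := j) (by have := hj.1; omega) (by omega)
          (by omega) (by have := hj.1; omega) hj.2 (fun s d r => ?_) (fun s d r => ?_)
        · simp only [blow]
          rw [tail_upd_of_lt _ (by omega), coord_upd_self _ le_rfl (by omega)]
          ring
        · rw [htail j hj.1 hj.2, hj1]; ring
      · obtain ⟨⟨j, hj, hj', hj1⟩, i, hi, hi', hi1⟩ := (bothSigns_iff hε).1 hb
        refine polarLE_eqSet_of_signs hB (j := j) (k := i)
          (by rintro rfl; rw [hj1] at hi1; norm_num at hi1) (by omega) hj' (by omega) hi'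
          (fun s d r => ?_) (fun s d r => ?_)
        · rw [htail j hj hj', hj1]; ring
        · rw [htail i hi hi', hi1]; ring
  | t2 =>
    have hn : 3 ≤ n := hT
    constructor
    · intro hP
      by_contra hcon
      have hall : AllEq ε 4 n 1 := fun j hj =>
        (hε j).resolve_right fun h => hcon ⟨j, hj, h⟩
      refine not_polarLE_of_sq_le (m := 3) (by omega) (by omega) hn 0 (by simp)
        (fun d hd => ?_) hP
      have h3 := hB.eq_of_mem_tcone (fun x hx => hx.2) hd
      simp only [blow, zero_mul, zero_add] at h3
      have h4 := tail_nonneg hall d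
      simp only [zero_apply, le_refl, true_and]
      linarith
    · rintro ⟨j, hj, hj1⟩
      have hj4 := hj.1
      refine polarLE_eqSet_of_signs hB (j := 3) (k := j) (by omega) (by omega)
          hn (by omega) hj.2 (fun s d r => ?_) (fun s d r => ?_)
      · simp only [blow]
        rw [tail_upd_of_lt _ (by omega), coord_upd_self _ (by omega) hn,
          coord_upd_ne _ (by omega), coord_upd_ne _ (by omega)]
        ring
      · simp only [blow]
        rw [tail_upd _ (by omega) hj.1 hj.2, coord_upd_ne _ (by omega), coord_upd_ne _ (by omega),
          coord_upd_ne _ (by omega), hj1]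
        ring

theorem EqType.classification {n : ℕ} {ε : ℕ → ℝ} {T : EqType} (hε : ∀ j, IsSign (ε j))
    (hT : T.Admissible n) {g : Vec n → Fin 0 → ℝ} {h : Vec n → Fin 1 → ℝ}
    (hK : KGEquiv g h noConstraint (single fun x => T.form ε x)) :
    ¬ LICQ g h ∧ ¬ MFCQ g h ∧ ¬ ACQ g h ∧ (GCQ g h ↔ T.GCQCond n ε) := by
  -- The case without inequalities is the model with `p = 0`.
  rw [show noConstraint = coords (n := n) 0 0 from Subsingleton.elim _ _] at hK
  rw [← polarLE_iff hε hT]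
  cases T with
  | t1 k =>
    obtain ⟨hk2, -, hn⟩ := id hT
    refine eqClass (EqType.blowup ε hT) hK (j := 2) (by omega) hn ?_
    simp only [blow]
    rw [tail_upd _ (by omega) le_rfl hn, coord_upd_ne _ (by omega)]
    simpa [show k ≠ 0 by omega] using (hε 2).ne_zero
  | t2 =>
    refine eqClass (EqType.blowup ε hT) hK (j := 3) (by omega) hT ?_
    simp only [blow]
    rw [tail_upd_of_lt _ (by omega), coord_upd_self _ (by omega) hT]
    simp

/-! ### One equality constraint and inequality constraints -/

namespace MixedType

/-- The number of the first coordinate in the sum of the `ε_j x_j²`. -/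
def tailStart : MixedType → ℕ
  | t1 _ => 2
  | t2 => 3
  | t3 _ => 3
  | t4 _ _ => 3
  | t5 => 3
  | t6 => 3
  | t7 => 4
  | t8 _ _ => 4

lemma numIneq_lt_tailStart (T : MixedType) : T.numIneq < T.tailStart := by
  cases T <;> simp [numIneq, tailStart]

lemma Admissible.tailStart_le {n : ℕ} {T : MixedType} (hT : T.Admissible n) :
    T.tailStart ≤ n := by
  cases T with
  | t1 k | t3 k => exact hT.2.2
  | t4 δ α | t8 δ α => exact hT.2.2.2
  | _ => exact hT

lemma blow_upd {n : ℕ} (ε : ℕ → ℝ) (T : MixedType) {j : ℕ} (hj : T.tailStart ≤ j) (hn : j ≤ n)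
    (s : ℝ) (d : Vec n) (r : ℝ) :
    T.blow ε s (upd d j r) = T.blow ε s d + ε j * (r ^ 2 - coord d j ^ 2) := by
  cases T <;> simp only [tailStart] at hj <;> simp only [blow] <;>
    simp (disch := omega) only [coord_upd_ne] <;> rw [tail_upd _ (by omega) hj hn] <;> ring

lemma polarLE_of_bothSigns {n : ℕ} {ε : ℕ → ℝ} {T : MixedType} (hε : ∀ j, IsSign (ε j))
    (hT : T.Admissible n) (hb : BothSigns ε T.tailStart n) :
    PolarLE (tcone (eqSet T.numIneq fun x : Vec n => T.form ε x)) (cone n 0 T.numIneq) := by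
  have := T.numIneq_lt_tailStart
  obtain ⟨⟨j, hj, hj', hj1⟩, i, hi, hi', hi1⟩ := (bothSigns_iff hε).1 hb
  refine polarLE_eqSet_of_signs (blowup ε hT) (j := j) (k := i)
    (by rintro rfl; rw [hj1] at hi1; norm_num at hi1) (by omega) hj' (by omega) hi'
    (fun s d r => ?_) (fun s d r => ?_)
  · rw [blow_upd ε T hj hj', hj1]; ring
  · rw [blow_upd ε T hi hi', hi1]; ring

lemma not_polarLE_of_not_bothSigns {n : ℕ} {ε : ℕ → ℝ} {T : MixedType} (hε : ∀ j, IsSign (ε j))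
    (hT : T.Admissible n) (hb : ¬ BothSigns ε T.tailStart n) (w : Vec n →L[ℝ] ℝ)
    (hw : w (upd 0 T.tailStart 1) = 0) (hwC : ∀ d ∈ cone n 0 T.numIneq, w d ≤ 0)
    (hH : ∀ d ∈ cone n 0 T.numIneq, |T.blow ε 0 d - tail ε T.tailStart d| ≤ w d ^ 2) :
    ¬ PolarLE (tcone (eqSet T.numIneq fun x : Vec n => T.form ε x)) (cone n 0 T.numIneq) :=
  not_polarLE_eqSet (blowup ε hT) T.numIneq_lt_tailStart le_rfl hT.tailStart_le
    (allEq_of_not_bothSigns hε hb) w hw hwC hH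

end MixedType

/-! ### Bounds for quadratic forms on the negative orthant -/

/-- For `u, v ≤ 0` all monomials `u²`, `v²`, `uv` are nonnegative and controlled by `(u + v)²`. This
provides the functional `w` for `not_polarLE_of_sq_le`, since a multiple of `u + v` is nonpositive
on the cone. -/
lemma abs_binary_form_le {a b u v α : ℝ} (ha : IsSign a) (hb : IsSign b) (hu : u ≤ 0)
    (hv : v ≤ 0) : |a * u ^ 2 + b * v ^ 2 + α * u * v| ≤ ((1 + |α|) * (u + v)) ^ 2 := by
  have huv : 0 ≤ u * v := mul_nonneg_of_nonpos_of_nonpos hu hv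
  have h1 : |a * u ^ 2 + b * v ^ 2 + α * u * v| ≤ u ^ 2 + v ^ 2 + |α| * (u * v) := by
    refine (abs_add_three _ _ _).trans (le_of_eq ?_)
    rw [abs_mul, abs_mul, mul_assoc, abs_mul, abs_of_nonneg huv, abs_of_nonneg (sq_nonneg u),
      abs_of_nonneg (sq_nonneg v)]
    rcases ha with rfl | rfl <;> rcases hb with rfl | rfl <;> simp
  have h2 : 0 ≤ |α| := abs_nonneg α
  have h3 : (1 + |α|) * (u + v) ^ 2 ≤ ((1 + |α|) * (u + v)) ^ 2 := by
    rw [mul_pow]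
    exact mul_le_mul_of_nonneg_right (by nlinarith) (sq_nonneg _)
  nlinarith [mul_nonneg h2 (sq_nonneg (u + v)),
    mul_nonneg h2 (add_nonneg (sq_nonneg u) (sq_nonneg v)), mul_nonneg h2 huv]

/-- As in the binary case, with every monomial controlled by `(u + v + w)²`. -/
lemma abs_ternary_form_le {a b c u v w α β γ : ℝ} (ha : IsSign a) (hb : IsSign b) (hc : IsSign c)
    (hu : u ≤ 0) (hv : v ≤ 0) (hw : w ≤ 0) :
    |a * u ^ 2 + b * v ^ 2 + c * w ^ 2 + α * u * v + β * u * w + γ * v * w|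
      ≤ ((1 + |α| + |β| + |γ|) * (u + v + w)) ^ 2 := by
  have huv : 0 ≤ u * v := mul_nonneg_of_nonpos_of_nonpos hu hv
  have huw : 0 ≤ u * w := mul_nonneg_of_nonpos_of_nonpos hu hw
  have hvw : 0 ≤ v * w := mul_nonneg_of_nonpos_of_nonpos hv hw
  have key : ∀ e : ℝ, IsSign e → ∀ x : ℝ, |e * x ^ 2| = x ^ 2 := by
    rintro e (rfl | rfl) x <;> simp
  have h1 : |a * u ^ 2 + b * v ^ 2 + c * w ^ 2 + α * u * v + β * u * w + γ * v * w| ≤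
      u ^ 2 + v ^ 2 + w ^ 2 + |α| * (u * v) + |β| * (u * w) + |γ| * (v * w) := by
    refine (abs_add_le _ _).trans (add_le_add ((abs_add_le _ _).trans
      (add_le_add ((abs_add_le _ _).trans (add_le_add ((abs_add_three _ _ _).trans ?_) ?_)) ?_)) ?_)
    · rw [key a ha, key b hb, key c hc]
    · rw [mul_assoc, abs_mul, abs_of_nonneg huv]
    · rw [mul_assoc, abs_mul, abs_of_nonneg huw]
    · rw [mul_assoc, abs_mul, abs_of_nonneg hvw]
  have hα := abs_nonneg α
  have hβ := abs_nonneg β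
  have hγ := abs_nonneg γ
  set S := (u + v + w) ^ 2 with hS
  have hS0 : 0 ≤ S := sq_nonneg _
  have e1 : u * v ≤ S := by nlinarith [sq_nonneg u, sq_nonneg v, sq_nonneg w]
  have e2 : u * w ≤ S := by nlinarith [sq_nonneg u, sq_nonneg v, sq_nonneg w]
  have e3 : v * w ≤ S := by nlinarith [sq_nonneg u, sq_nonneg v, sq_nonneg w]
  have e4 : u ^ 2 + v ^ 2 + w ^ 2 ≤ S := by nlinarith
  have h2 : (1 + |α| + |β| + |γ|) * S ≤ ((1 + |α| + |β| + |γ|) * (u + v + w)) ^ 2 := by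
    rw [mul_pow]
    refine mul_le_mul_of_nonneg_right ?_ hS0
    have : 0 ≤ |α| + |β| + |γ| := by positivity
    nlinarith
  have f1 := mul_le_mul_of_nonneg_left e1 hα
  have f2 := mul_le_mul_of_nonneg_left e2 hβ
  have f3 := mul_le_mul_of_nonneg_left e3 hγ
  linarith

lemma functional_unit_eq_zero {n j : ℕ} (h1 : 1 ≤ j) (hn : j ≤ n) {ℓ : Vec n →ₗ[ℝ] ℝ}
    {C : Set (Vec n)} (hℓ : ∀ d ∈ C, ℓ d ≤ 0)
    (hC : ∀ c : ℝ, c ^ 2 = 1 → upd 0 j c ∈ C) : ℓ (upd 0 j 1) = 0 := by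
  have e1 := hℓ _ (hC 1 (by norm_num))
  have e2 := hℓ _ (hC (-1) (by norm_num))
  rw [map_upd ℓ _ h1 hn] at e2
  simp at e2
  linarith

lemma tendsto_upd_zero {n j : ℕ} (h1 : 1 ≤ j) (hn : j ≤ n) {d : Vec n} (hd : coord d j = 0)
    {c : ℝ} : Tendsto (fun s : ℝ => upd d j (c * s)) (𝓝[>] 0) (𝓝 d) := by
  have hc : Tendsto (fun s : ℝ => c * s) (𝓝[>] 0) (𝓝 (coord d j)) := by
    have : Continuous fun s : ℝ => c * s := by fun_prop
    simpa [hd] using (this.tendsto 0).mono_left nhdsWithin_le_nhds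
  have := tendsto_upd (j := j) hc (tendsto_const_nhds (x := d))
  rwa [upd_coord _ h1 hn] at this

/-- The germ `x₃³ + x_u x₃ + c x_a x₃ + c' x_a x_u + …` satisfies GCQ on `{x₁, x₂ ≤ 0}`. -/
lemma polarLE_eqSet_cubic {n a u : ℕ} {f : Vec n → ℝ} {H : ℝ → Vec n → ℝ} (hB : Blowup f H)
    {ε : ℕ → ℝ} {c c' : ℝ} (hau : a ≠ u) (ha : 1 ≤ a) (ha' : a ≤ 2) (hu : 1 ≤ u) (hu' : u ≤ 2)
    (hn : 3 ≤ n)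
    (hH : ∀ s d, H s d = s * coord d 3 ^ 3 + coord d u * coord d 3 + c * coord d a * coord d 3
      + c' * coord d a * coord d u + tail ε 4 d) :
    PolarLE (tcone (eqSet 2 f)) (cone n 0 2) := by
  intro ℓ hℓ d hd
  have hw : ℓ (upd 0 3 1) = 0 := by
    refine functional_unit_eq_zero (by omega) hn hℓ fun e he => ?_
    -- For `e = ±1`, the choice `x_u = -s` cancels the cubic term: `s e³ - s e = 0`.
    refine mem_tcone_eqSet hB (tendsto_upd_zero (j := u) (c := -1) hu (by omega)
      (by rw [coord_upd_ne _ (by omega), coord_zero])) ?_ (Eventually.of_forall fun s => ?_)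
    · filter_upwards [self_mem_nhdsWithin] with s (hs : 0 < s)
      exact upd_mem_cone (upd_mem_cone (zero_mem_cone 0 2) (by omega) hn (by omega)) (by omega)
        (by omega) (fun _ => by linarith)
    · rw [hH]
      simp (disch := omega) only [coord_upd_ne, coord_upd_self, tail_upd_of_lt, coord_zero,
        tail_zero]
      linear_combination s * e * he
  -- All terms vanish on the ray through `-e_a`, so this direction is tangent.
  have hea : 0 ≤ ℓ (upd 0 a 1) := by
    have := hℓ _ (mem_tcone_eqSet hB (d := upd 0 a (-1)) (γ := fun _ => upd 0 a (-1))
      tendsto_const_nhds (Eventually.of_forall fun s => upd_mem_cone (zero_mem_cone 0 2)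
        (by omega) (by omega) (by norm_num)) (Eventually.of_forall fun s => by
          rw [hH]
          simp (disch := omega) only [coord_upd_ne, coord_upd_self, tail_upd_of_lt, coord_zero,
            tail_zero]
          ring))
    rw [map_upd ℓ _ ha (by omega)] at this
    simpa using this
  -- On `d_a = 0` only the product `x_u x_3`, the cubic term and the tail survive, so the coupled
  -- criterion applies. Restoring `d_a ≤ 0` afterwards does not increase `ℓ`, because `ℓ` is
  -- nonnegative at `e_a`.
  have h0 := le_zero_of_coupled_eq hB (u := u) (w := 3) (m := 1) (k := 3) (p := 2) hu hu'
    (by omega) hn one_ne_zero (by omega) (D := {d | d ∈ cone n 0 2 ∧ coord d a = 0})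
    (fun d hd => hd.1)
    (fun d hd r => ⟨upd_mem_cone hd.1 (by omega) hn (by omega), by
      rw [coord_upd_ne _ (by omega)]; exact hd.2⟩)
    (fun d hd r hr => ⟨upd_mem_cone hd.1 (by omega) (by omega) (fun _ => hr), by
      rw [coord_upd_ne _ hau]; exact hd.2⟩) (T := tail ε 4)
    (fun d r => tail_upd_of_lt _ (by omega) _ _) (fun d r => tail_upd_of_lt _ (by omega) _ _)
    one_ne_zero (fun d hd s => by rw [hH, hd.2]; ring) hℓ hw (d := upd d a 0)
    ⟨upd_mem_cone hd (by omega) (by omega) (fun _ => le_rfl),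
      coord_upd_self _ ha (by omega) _⟩
  rw [map_upd ℓ _ ha (by omega)] at h0
  have := mul_nonpos_of_nonpos_of_nonneg (hd.2 a ha ha') hea
  linarith

/-- If `a, b ≤ 0`, the term `x (x² - a - b)` dominates `a b` for `x > -(a + b)`. -/
lemma add_le_zero_of_cubic {x a b c t : ℝ} (ha : a ≤ 0) (hb : b ≤ 0) (hc : IsSign c)
    (ht : 0 ≤ t) (h : x ^ 3 - b * x - a * x + c * a * b + t ≤ 0) : x + a + b ≤ 0 := by
  by_contra! hcon
  have hab : 0 ≤ a * b := mul_nonneg_of_nonpos_of_nonpos ha hb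
  have hx : 0 < x := by linarith
  have h1 : 0 < x ^ 3 := by positivity
  -- Together with `c a b ≥ -a b`, the left-hand side of `h` is at least `x³ + a² + a b + b² > 0`.
  have h2 : (a + b) ^ 2 ≤ -(a + b) * x := by nlinarith
  have h3 : -(a * b) ≤ c * a * b := by
    rcases hc with rfl | rfl <;> linarith
  nlinarith [sq_nonneg a, sq_nonneg b]

namespace MixedType

/-- If both vectors `±e_2` are tangent, the coupling `x_1 x_2` yields GCQ. They are tangent if
`x_2⁴` can be cancelled by a negative square, or `x_2³` by `x_1 x_2` with `x_1 < 0`. Otherwise,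
unless the tail has both signs, the equation fixes the sign of `x_2` on the feasible set. -/
lemma polarLE_iff_t3 {n k : ℕ} {ε : ℕ → ℝ} (hε : ∀ j, IsSign (ε j)) (hT : (t3 k).Admissible n) :
    PolarLE (tcone (eqSet 1 fun x : Vec n => (t3 k).form ε x)) (cone n 0 1) ↔
      (t3 k).GCQCond n ε := by
  have hB := blowup ε hT
  obtain ⟨hk3, hk4, hn⟩ := id hT
  have main : (∀ c : ℝ, c ^ 2 = 1 →
      upd 0 2 c ∈ tcone (eqSet 1 fun x : Vec n => (t3 k).form ε x)) →
      PolarLE (tcone (eqSet 1 fun x : Vec n => (t3 k).form ε x)) (cone n 0 1) := by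
    intro hc ℓ hℓ d hd
    have hw := functional_unit_eq_zero (by omega) (by omega) hℓ hc
    exact le_zero_of_coupled_eq hB (u := 1) (w := 2) (m := k - 2) (k := k) (p := 1) le_rfl le_rfl
      (by omega) (by omega) (by omega) (by omega) (D := cone n 0 1) subset_rfl
      (fun d hd r => upd_mem_cone hd (by omega) (by omega) (by omega))
      (fun d hd r hr => upd_mem_cone hd (by omega) (by omega) (fun _ => hr)) (T := tail ε 3)
      (fun d r => tail_upd_of_lt _ (by omega) _ _) (fun d r => tail_upd_of_lt _ (by omega) _ _)
      (hε 1).ne_zero (fun d _ s => rfl) hℓ hw hd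
  constructor
  · intro hP
    by_contra hcon
    simp only [GCQCond, not_or, not_and] at hcon
    obtain ⟨hc1, hc2⟩ := hcon
    obtain rfl | rfl : k = 3 ∨ k = 4 := by omega
    · obtain ⟨h1, h2⟩ := hc2 (by decide)
      have hε1 := (hε 1).eq_neg_one h1
      -- `σ` is the sign of the definite tail. The constraint becomes `x_2 (x_2² - x_1) = -tail`,
      -- whose second factor is nonnegative, so `σ x_2 ≤ 0` on the feasible set.
      obtain ⟨σ, hσ, hall⟩ : ∃ σ, IsSign σ ∧ AllEq (fun j => σ * ε j) 3 n 1 := by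
        rcases allEq_of_not_bothSigns hε h2 with h | h
        · exact ⟨1, Or.inl rfl, fun j hj => by simp [h j hj]⟩
        · exact ⟨-1, Or.inr rfl, fun j hj => by simp [h j hj]⟩
      have ht : ∀ x : Vec n, 0 ≤ σ * tail ε 3 x := fun x => by
        have := tail_nonneg hall x
        simpa [tail, Finset.mul_sum, mul_assoc] using this
      refine not_polarLE (σ • coordL n 2) (functional_le_of_mem_tcone _ fun x hx => ?_)
        (d := upd 0 2 σ) (upd_mem_cone (zero_mem_cone 0 1) (by omega) (by omega) (by omega)) ?_ hP
      · obtain ⟨hx1, hx2⟩ := hx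
        have hx1 := hx1 1 le_rfl le_rfl
        have hx3 := ht x
        simp only [form, hε1] at hx2
        rw [smul_apply, coordL_apply, smul_eq_mul]
        by_contra! hcon
        have h3 : σ * coord x 2 * (coord x 2 ^ 2 - coord x 1) = -(σ * tail ε 3 x) := by
          linear_combination σ * hx2
        have h4 : coord x 2 ≠ 0 := by rintro h; rw [h] at hcon; simp at hcon
        have h5 : 0 < coord x 2 ^ 2 - coord x 1 := by
          have : 0 < coord x 2 ^ 2 := by positivity
          linarith
        have := mul_pos hcon h5
        linarith
      · rw [smul_apply, coordL_apply, smul_eq_mul, coord_upd_self _ (by omega) (by omega), ← sq,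
          hσ.sq]
        norm_num
    · have hall : AllEq ε 3 n 1 := fun j hj =>
        (hε j).resolve_right fun h => hc1 (by decide) ⟨j, hj, h⟩
      -- With `x_2⁴` and the tail nonnegative, the product `ε_1 x_1 x_2` must be nonpositive, which
      -- excludes `ε_1 x_2 < 0`.
      refine not_polarLE (-ε 1 • coordL n 2) (functional_le_of_mem_tcone _ fun x hx => ?_)
        (d := upd 0 2 (-ε 1)) (upd_mem_cone (zero_mem_cone 0 1) (by omega) (by omega) (by omega))
        ?_ hP
      · obtain ⟨hx1, hx2⟩ := hx
        have hx1 := hx1 1 le_rfl le_rfl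
        have hx3 := tail_nonneg hall x
        simp only [form] at hx2
        rw [smul_apply, coordL_apply, smul_eq_mul]
        by_contra! hcon
        have h4 : coord x 2 ≠ 0 := by rintro h; rw [h] at hcon; simp at hcon
        have h5 : 0 < coord x 2 ^ 4 := by positivity
        have h6 : 0 ≤ ε 1 * coord x 1 * coord x 2 := by
          have := mul_nonneg_of_nonpos_of_nonpos hx1 (show ε 1 * coord x 2 ≤ 0 by linarith)
          linarith
        linarith
      · rw [smul_apply, coordL_apply, smul_eq_mul, coord_upd_self _ (by omega) (by omega)]
        have := (hε 1).sq
        nlinarith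
  · rintro (⟨hev, j, hj, hj1⟩ | ⟨hodd, hcase⟩)
    · obtain rfl : k = 4 := by
        obtain rfl | rfl : k = 3 ∨ k = 4 := by omega
        · exact absurd hev (by decide)
        · rfl
      have hj3 := hj.1
      have hjn := hj.2
      refine main fun c hc => mem_tcone_eqSet hB (tendsto_upd_zero (j := j) (c := 1) (by omega)
        hjn (by rw [coord_upd_ne _ (by omega), coord_zero]))
        (Eventually.of_forall fun s => upd_mem_cone (upd_mem_cone (zero_mem_cone 0 1) (by omega)
          (by omega) (by omega)) (by omega) hjn (by omega)) (Eventually.of_forall fun s => ?_)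
      simp only [blow]
      rw [tail_upd _ (by omega) hj3 hjn]
      simp (disch := omega) only [coord_upd_ne, coord_upd_self, tail_upd_of_lt, coord_zero,
        tail_zero, hj1]
      linear_combination s ^ 2 * (c ^ 2 + 1) * hc
    · rcases hcase with h1 | hb
      · obtain rfl : k = 3 := by
          obtain rfl | rfl : k = 3 ∨ k = 4 := by omega
          · rfl
          · exact absurd hodd (by decide)
        refine main fun c hc => mem_tcone_eqSet hB (tendsto_upd_zero (j := 1) (c := -1) (by omega)
          (by omega) (by rw [coord_upd_ne _ (by omega), coord_zero])) ?_
          (Eventually.of_forall fun s => ?_)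
        · filter_upwards [self_mem_nhdsWithin] with s (hs : 0 < s)
          exact upd_mem_cone (upd_mem_cone (zero_mem_cone 0 1) (by omega) (by omega) (by omega))
            (by omega) (by omega) (fun _ => by linarith)
        · simp only [blow, h1]
          simp (disch := omega) only [coord_upd_ne, coord_upd_self, tail_upd_of_lt,
            tail_zero]
          linear_combination s * c * hc
      · exact polarLE_of_bothSigns hε hT hb

/-- If `ε_1 = ε_2 = -1` and the tail is nonnegative, `add_le_zero_of_cubic` bounds `x_3` from above
by `-(x_1 + x_2)`; for a nonpositive tail the reflection `x_3 ↦ -x_3` gives the mirrored bound. If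
one of these signs is `+`, that product can cancel the cubic term. -/
lemma polarLE_iff_t7 {n : ℕ} {ε : ℕ → ℝ} (hε : ∀ j, IsSign (ε j)) (hn : 4 ≤ n) :
    PolarLE (tcone (eqSet 2 fun x : Vec n => t7.form ε x)) (cone n 0 2) ↔ t7.GCQCond n ε := by
  have hT : t7.Admissible n := hn
  have hB := blowup ε hT
  constructor
  · intro hP
    by_contra hcon
    simp only [GCQCond, not_or] at hcon
    obtain ⟨hb, h1, h2⟩ := hcon
    have hε1 := (hε 1).eq_neg_one h1
    have hε2 := (hε 2).eq_neg_one h2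
    rcases allEq_of_not_bothSigns hε hb with hall | hall
    · refine not_polarLE (coordL n 3 + coordL n 1 + coordL n 2)
        (functional_le_of_mem_tcone _ fun x hx => ?_) (d := upd 0 3 1)
        (upd_mem_cone (zero_mem_cone 0 2) (by omega) (by omega) (by omega)) ?_ hP
      · obtain ⟨hx1, hx2⟩ := hx
        simp only [form, hε1, hε2] at hx2
        simp only [add_apply, coordL_apply]
        exact add_le_zero_of_cubic (hx1 1 (by omega) (by omega)) (hx1 2 (by omega) (by omega))
          (hε 3) (tail_nonneg hall x) (by linarith)
      · simp (disch := omega) only [add_apply, coordL_apply, coord_upd_ne, coord_upd_self,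
          coord_zero]
        norm_num
    · refine not_polarLE (-coordL n 3 + coordL n 1 + coordL n 2)
        (functional_le_of_mem_tcone _ fun x hx => ?_) (d := upd 0 3 (-1))
        (upd_mem_cone (zero_mem_cone 0 2) (by omega) (by omega) (by omega)) ?_ hP
      · obtain ⟨hx1, hx2⟩ := hx
        simp only [form, hε1, hε2] at hx2
        simp only [add_apply, neg_apply, coordL_apply]
        refine add_le_zero_of_cubic (c := -ε 3) (t := -tail ε 4 x) (hx1 1 (by omega) (by omega))
          (hx1 2 (by omega) (by omega)) ?_ (by linarith [tail_nonpos hall x]) (by linarith)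
        rcases hε 3 with h | h <;> simp [h, IsSign]
      · simp (disch := omega) only [add_apply, neg_apply, coordL_apply, coord_upd_ne,
          coord_upd_self, coord_zero]
        norm_num
  · rintro (hb | h1 | h2)
    · exact polarLE_of_bothSigns hε hT hb
    · refine polarLE_eqSet_cubic hB (a := 1) (u := 2) (c := ε 2) (c' := ε 3) (ε := ε) (by omega)
        (by omega) (by omega) (by omega) (by omega) (by omega) fun s d => ?_
      simp only [blow, h1]
      ring
    · refine polarLE_eqSet_cubic hB (a := 2) (u := 1) (c := ε 1) (c' := ε 3) (ε := ε) (by omega)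
        (by omega) (by omega) (by omega) (by omega) (by omega) fun s d => ?_
      simp only [blow, h2]
      ring

lemma polarLE_iff {n : ℕ} {ε : ℕ → ℝ} {T : MixedType} (hε : ∀ j, IsSign (ε j))
    (hT : T.Admissible n) :
    PolarLE (tcone (eqSet T.numIneq fun x : Vec n => T.form ε x)) (cone n 0 T.numIneq) ↔
      T.GCQCond n ε := by
  have hn := hT.tailStart_le
  -- In all types other than `t3` and `t7`, the part of `H 0` outside the tail involves constrained
  -- coordinates only, so a suitable `w` exists and the signs of the tail alone decide.
  have simple : ∀ w : Vec n →L[ℝ] ℝ, w (upd 0 T.tailStart 1) = 0 →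
      (∀ d ∈ cone n 0 T.numIneq, w d ≤ 0) →
      (∀ d ∈ cone n 0 T.numIneq, |T.blow ε 0 d - tail ε T.tailStart d| ≤ w d ^ 2) →
      (PolarLE (tcone (eqSet T.numIneq fun x : Vec n => T.form ε x)) (cone n 0 T.numIneq) ↔
        BothSigns ε T.tailStart n) := fun w hw hwC hH =>
    ⟨fun hP => by
      by_contra hb
      exact not_polarLE_of_not_bothSigns hε hT hb w hw hwC hH hP, polarLE_of_bothSigns hε hT⟩
  cases T with
  | t1 k =>
    refine simple (coordL n 1) ?_ (fun d hd => ?_) (fun d hd => ?_)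
    · simp (disch := omega) [tailStart, coord_upd_ne]
    · simpa using hd.2 1 le_rfl le_rfl
    · simp only [blow, tailStart, add_sub_cancel_right, coordL_apply]
      by_cases hk : k = 2
      · subst hk; simp
      · have := hT.1
        rw [zero_pow (by omega)]
        simpa using sq_nonneg _
  | t2 =>
    refine simple (coordL n 1) ?_ (fun d hd => ?_) (fun d hd => ?_)
    · simp (disch := omega) [tailStart, coord_upd_ne]
    · simpa using hd.2 1 le_rfl le_rfl
    · simp [blow, tailStart]
  | t3 k => exact polarLE_iff_t3 hε hT
  | t4 δ α =>
    refine simple ((1 + |α|) • (coordL n 1 + coordL n 2)) ?_ (fun d hd => ?_) (fun d hd => ?_)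
    · simp (disch := omega) [tailStart, coord_upd_ne]
    · have h1 := hd.2 1 (by simp) (by simp [numIneq])
      have h2 := hd.2 2 (by simp) (by simp [numIneq])
      simp only [smul_apply, add_apply, coordL_apply, smul_eq_mul]
      exact mul_nonpos_of_nonneg_of_nonpos (by positivity) (by linarith)
    · have h1 := hd.2 1 (by simp) (by simp [numIneq])
      have h2 := hd.2 2 (by simp) (by simp [numIneq])
      simpa [blow, tailStart, mul_add] using abs_binary_form_le (α := α) hT.1 hT.2.1 h1 h2
  | t5 =>
    refine simple (coordL n 1 + coordL n 2) ?_ (fun d hd => ?_) (fun d hd => ?_)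
    · simp (disch := omega) [tailStart, coord_upd_ne]
    · have h1 := hd.2 1 (by simp) (by simp [numIneq])
      have h2 := hd.2 2 (by simp) (by simp [numIneq])
      simp only [add_apply, coordL_apply]
      linarith
    · have h1 := hd.2 1 (by simp) (by simp [numIneq])
      have h2 := hd.2 2 (by simp) (by simp [numIneq])
      have h3 := mul_nonneg_of_nonpos_of_nonpos h1 h2
      simp only [blow, tailStart, add_apply, coordL_apply, zero_mul, zero_add,
        add_sub_cancel_right]
      rw [abs_le]
      rcases hε 1 with e1 | e1 <;> rcases hε 2 with e2 | e2 <;> rw [e1, e2] <;>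
        constructor <;> nlinarith [sq_nonneg (coord d 1), sq_nonneg (coord d 2)]
  | t6 =>
    refine simple (coordL n 1 + coordL n 2) ?_ (fun d hd => ?_) (fun d hd => ?_)
    · simp (disch := omega) [tailStart, coord_upd_ne]
    · have h1 := hd.2 1 (by simp) (by simp [numIneq])
      have h2 := hd.2 2 (by simp) (by simp [numIneq])
      simp only [add_apply, coordL_apply]
      linarith
    · have h1 := hd.2 1 (by simp) (by simp [numIneq])
      have h2 := hd.2 2 (by simp) (by simp [numIneq])
      have h3 := mul_nonneg_of_nonpos_of_nonpos h1 h2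
      simp only [blow, tailStart, add_apply, coordL_apply, zero_mul, add_zero,
        add_sub_cancel_right]
      rw [abs_of_nonneg (sq_nonneg _)]
      rcases hε 1 with e1 | e1 <;> rw [e1] <;> nlinarith
  | t7 => exact polarLE_iff_t7 hε hT
  | t8 δ α =>
    have hle : ∀ d ∈ cone n 0 3, coord d 1 ≤ 0 ∧ coord d 2 ≤ 0 ∧ coord d 3 ≤ 0 := fun d hd =>
      ⟨hd.2 1 (by simp) (by simp), hd.2 2 (by simp) (by simp), hd.2 3 (by simp) (by simp)⟩
    refine simple ((1 + |α 1 2| + |α 1 3| + |α 2 3|) • (coordL n 1 + coordL n 2 + coordL n 3)) ?_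
      (fun d hd => ?_) (fun d hd => ?_)
    · simp (disch := omega) [tailStart, coord_upd_ne]
    · obtain ⟨h1, h2, h3⟩ := hle d hd
      simp only [smul_apply, add_apply, coordL_apply, smul_eq_mul]
      exact mul_nonpos_of_nonneg_of_nonpos (by positivity) (by linarith)
    · obtain ⟨h1, h2, h3⟩ := hle d hd
      simpa [blow, tailStart, mul_add] using abs_ternary_form_le
        (α := α 1 2) (β := α 1 3) (γ := α 2 3) (hT.1 1 (by simp)) (hT.1 2 (by simp)) (hT.1 3 (by simp)) h1 h2 h3

theorem classification {n : ℕ} {ε : ℕ → ℝ} {T : MixedType} (hε : ∀ j, IsSign (ε j))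
    (hT : T.Admissible n) {g : Vec n → Fin T.numIneq → ℝ} {h : Vec n → Fin 1 → ℝ}
    (hK : KGEquiv g h (coords 0 T.numIneq) (single fun x => T.form ε x)) :
    ¬ LICQ g h ∧ ¬ MFCQ g h ∧ ¬ ACQ g h ∧ (GCQ g h ↔ T.GCQCond n ε) := by
  rw [← polarLE_iff hε hT]
  refine eqClass (blowup ε hT) hK T.numIneq_lt_tailStart hT.tailStart_le ?_
  have := T.numIneq_lt_tailStart
  rw [blow_upd ε T le_rfl hT.tailStart_le, (blowup ε hT).apply_zero_zero]
  simpa using (hε _).ne_zero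

end MixedType

/-! ### Copositivity of ternary forms -/

lemma ternary_nonpos_of_nonpos {a b c x y z : ℝ} (hxy : 0 ≤ x * y) (hxz : 0 ≤ x * z)
    (hyz : 0 ≤ y * z) (ha : a ≤ 0) (hb : b ≤ 0) (hc : c < 2) :
    -x ^ 2 - y ^ 2 - z ^ 2 + a * (x * y) + b * (x * z) + c * (y * z) ≤ 0 := by
  have h1 := mul_nonpos_of_nonpos_of_nonneg ha hxy
  have h2 := mul_nonpos_of_nonpos_of_nonneg hb hxz
  have h3 := mul_nonneg (sub_nonneg.2 hc.le) hyz
  nlinarith [sq_nonneg (y - z), sq_nonneg x]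

/-- Completing squares turns the form into `-(x - (a y + b z) / 2)² - (P y - Q z)² + (c + a b / 2 -
2 P Q) y z`. -/
lemma ternary_nonpos_of_pos {a b c x y z : ℝ} (hyz : 0 ≤ y * z) (ha : 0 < a) (ha' : a < 2)
    (hb : 0 < b) (hb' : b < 2) (hc : c + a * b / 2 < 2 * √((1 - a ^ 2 / 4) * (1 - b ^ 2 / 4))) :
    -x ^ 2 - y ^ 2 - z ^ 2 + a * (x * y) + b * (x * z) + c * (y * z) ≤ 0 := by
  have hP : 0 ≤ 1 - a ^ 2 / 4 := by nlinarith
  have hQ : 0 ≤ 1 - b ^ 2 / 4 := by nlinarith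
  rw [Real.sqrt_mul hP] at hc
  have h1 := Real.sq_sqrt hP
  have h2 := Real.sq_sqrt hQ
  set P := √(1 - a ^ 2 / 4)
  set Q := √(1 - b ^ 2 / 4)
  have h3 := mul_le_mul_of_nonneg_right hc.le hyz
  have key : -x ^ 2 - y ^ 2 - z ^ 2 + a * (x * y) + b * (x * z) + c * (y * z) =
      -(x - (a * y + b * z) / 2) ^ 2 - (P * y - Q * z) ^ 2
        + ((c + a * b / 2) * (y * z) - 2 * (P * Q) * (y * z)) := by
    linear_combination y ^ 2 * h1 + z ^ 2 * h2
  rw [key]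
  nlinarith [sq_nonneg (x - (a * y + b * z) / 2), sq_nonneg (P * y - Q * z)]

/-- Testing on the coordinate planes gives `a, b ≤ 2`; testing at the point where both completed
squares vanish gives the third bound. Nondegeneracy of the restrictions and of the form excludes
equality. -/
lemma lt_of_ternary_nonpos {a b c : ℝ} (hdet : 4 - a ^ 2 - b ^ 2 - c ^ 2 - a * b * c ≠ 0)
    (ha2 : 4 - a ^ 2 ≠ 0) (hb2 : 4 - b ^ 2 ≠ 0) (ha : 0 < a) (hb : 0 < b)
    (h : ∀ x y z : ℝ, 0 ≤ x → 0 ≤ y → 0 ≤ z →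
      -x ^ 2 - y ^ 2 - z ^ 2 + a * (x * y) + b * (x * z) + c * (y * z) ≤ 0) :
    a < 2 ∧ b < 2 ∧ c + a * b / 2 < 2 * √((1 - a ^ 2 / 4) * (1 - b ^ 2 / 4)) := by
  have ha' : a < 2 := by
    have := h 1 1 0 zero_le_one zero_le_one le_rfl
    refine lt_of_le_of_ne (by linarith) ?_
    rintro rfl
    norm_num at ha2
  have hb' : b < 2 := by
    have := h 1 0 1 zero_le_one le_rfl zero_le_one
    refine lt_of_le_of_ne (by linarith) ?_
    rintro rfl
    norm_num at hb2
  have hP : 0 < 1 - a ^ 2 / 4 := by nlinarith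
  have hQ : 0 < 1 - b ^ 2 / 4 := by nlinarith
  refine ⟨ha', hb', ?_⟩
  rw [Real.sqrt_mul hP.le]
  have h1 := Real.sq_sqrt hP.le
  have h2 := Real.sq_sqrt hQ.le
  have hP0 := Real.sqrt_pos.2 hP
  have hQ0 := Real.sqrt_pos.2 hQ
  set P := √(1 - a ^ 2 / 4)
  set Q := √(1 - b ^ 2 / 4)
  -- With `y = Q` and `z = P`, this point annihilates `x - (a y + b z) / 2` and `P y - Q z`; it lies
  -- in the positive orthant because `a, b > 0`.
  have h3 := h ((a * Q + b * P) / 2) Q P (by positivity) hQ0.le hP0.le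
  have h4 : (P * Q) * (c + a * b / 2) ≤ (P * Q) * (2 * (P * Q)) := by
    have : -((a * Q + b * P) / 2) ^ 2 - Q ^ 2 - P ^ 2 + a * ((a * Q + b * P) / 2 * Q)
        + b * ((a * Q + b * P) / 2 * P) + c * (Q * P)
        = (P * Q) * (c + a * b / 2) - (P * Q) * (2 * (P * Q)) := by
      linear_combination Q ^ 2 * h1 + P ^ 2 * h2
    linarith
  refine lt_of_le_of_ne (le_of_mul_le_mul_left h4 (by positivity)) fun heq => hdet ?_
  linear_combination -(c + a * b / 2 + 2 * (P * Q)) * heq - 4 * Q ^ 2 * h1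
    - 4 * (1 - a ^ 2 / 4) * h2

/-- Among the three mixed coefficients, two are nonpositive or two are positive, and any two share
an index, which becomes `i`. The two alternatives of the condition are the copositivity criteria for
these cases. -/
lemma IneqType.dagger_iff {δ : ℕ → ℝ} {α : ℕ → ℕ → ℝ} (hα : ∀ i j, α i j = α j i)
    (hδ1 : δ 1 = -1) (hδ2 : δ 2 = -1) (hδ3 : δ 3 = -1) (hS : StarStar δ α) :
    Dagger α ↔ ∀ x y z : ℝ, x ≤ 0 → y ≤ 0 → z ≤ 0 →
      -x ^ 2 - y ^ 2 - z ^ 2 + α 1 2 * (x * y) + α 1 3 * (x * z) + α 2 3 * (y * z) ≤ 0 := by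
  constructor
  · rintro ⟨i, hi, j, hj, k, hk, hij, hik, hjk, h⟩ x y z hx hy hz
    have hxy := mul_nonneg_of_nonpos_of_nonpos hx hy
    have hxz := mul_nonneg_of_nonpos_of_nonpos hx hz
    have hyz := mul_nonneg_of_nonpos_of_nonpos hy hz
    have hyx : 0 ≤ y * x := by linarith
    have hzx : 0 ≤ z * x := by linarith
    have hzy : 0 ≤ z * y := by linarith
    have key : ∀ x y z : ℝ, 0 ≤ x * y → 0 ≤ x * z → 0 ≤ y * z →
        -x ^ 2 - y ^ 2 - z ^ 2 + α i j * (x * y) + α i k * (x * z) + α j k * (y * z) ≤ 0 := by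
      intro x y z hxy hxz hyz
      rcases h with ⟨h1, h2, h3⟩ | ⟨h1, h2, h3, h4, h5⟩
      · exact ternary_nonpos_of_nonpos hxy hxz hyz h1 h2 h3
      · exact ternary_nonpos_of_pos hyz h1 h2 h3 h4 h5
    rw [Finset.mem_Icc] at hi hj hk
    obtain ⟨rfl, rfl, rfl⟩ | ⟨rfl, rfl, rfl⟩ | ⟨rfl, rfl, rfl⟩ | ⟨rfl, rfl, rfl⟩ |
        ⟨rfl, rfl, rfl⟩ | ⟨rfl, rfl, rfl⟩ :
        (i = 1 ∧ j = 2 ∧ k = 3) ∨ (i = 1 ∧ j = 3 ∧ k = 2) ∨ (i = 2 ∧ j = 1 ∧ k = 3) ∨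
        (i = 2 ∧ j = 3 ∧ k = 1) ∨ (i = 3 ∧ j = 1 ∧ k = 2) ∨ (i = 3 ∧ j = 2 ∧ k = 1) := by omega
    · linarith [key x y z hxy hxz hyz]
    · have := key x z y hxz hxy hzy
      rw [hα 3 2] at this; linarith
    · have := key y x z hyx hyz hxz
      rw [hα 2 1] at this; linarith
    · have := key y z x hyz hyx hzx
      rw [hα 2 1, hα 3 1] at this; linarith
    · have := key z x y hzx hzy hxy
      rw [hα 3 1, hα 3 2] at this; linarith
    · have := key z y x hzy hzx hyx
      rw [hα 3 1, hα 3 2, hα 2 1] at this; linarith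
  · intro h
    obtain ⟨hS1, hS2⟩ := hS
    have h12 : 4 - α 1 2 ^ 2 ≠ 0 := fun h0 => hS1 1 (by simp) 2 (by simp) (by simp)
      (by rw [hδ1, hδ2]; linarith)
    have h13 : 4 - α 1 3 ^ 2 ≠ 0 := fun h0 => hS1 1 (by simp) 3 (by simp) (by simp)
      (by rw [hδ1, hδ3]; linarith)
    have h23 : 4 - α 2 3 ^ 2 ≠ 0 := fun h0 => hS1 2 (by simp) 3 (by simp) (by simp)
      (by rw [hδ2, hδ3]; linarith)
    have hdet : 4 - α 1 2 ^ 2 - α 1 3 ^ 2 - α 2 3 ^ 2 - α 1 2 * α 1 3 * α 2 3 ≠ 0 := fun h0 =>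
      hS2 (by rw [hδ1, hδ2, hδ3]; linarith)
    have lt_two : ∀ c : ℝ, 4 - c ^ 2 ≠ 0 → c ≤ 2 → c < 2 := fun c hc hle =>
      lt_of_le_of_ne hle fun h0 => hc (by rw [h0]; norm_num)
    have h' : ∀ x y z : ℝ, 0 ≤ x → 0 ≤ y → 0 ≤ z →
        -x ^ 2 - y ^ 2 - z ^ 2 + α 1 2 * (x * y) + α 1 3 * (x * z) + α 2 3 * (y * z) ≤ 0 :=
      fun x y z hx hy hz => by
        have := h (-x) (-y) (-z) (by linarith) (by linarith) (by linarith)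
        linarith
    rcases le_or_gt (α 1 2) 0 with a1 | a1 <;> rcases le_or_gt (α 1 3) 0 with a2 | a2 <;>
      rcases le_or_gt (α 2 3) 0 with a3 | a3
    -- The first three alternatives are two nonpositive coefficients sharing the index `1`, `2` or
    -- `3`; the last three are two positive ones sharing it.
    all_goals first
      | exact ⟨1, by simp, 2, by simp, 3, by simp, by simp, by simp, by simp,
          Or.inl ⟨a1, a2, lt_two _ h23 (by linarith [h' 0 1 1 le_rfl zero_le_one zero_le_one])⟩⟩
      | exact ⟨2, by simp, 1, by simp, 3, by simp, by simp, by simp, by simp,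
          Or.inl ⟨by rw [hα 2 1]; exact a1, a3,
            lt_two _ h13 (by linarith [h' 1 0 1 zero_le_one le_rfl zero_le_one])⟩⟩
      | exact ⟨3, by simp, 1, by simp, 2, by simp, by simp, by simp, by simp,
          Or.inl ⟨by rw [hα 3 1]; exact a2, by rw [hα 3 2]; exact a3,
            lt_two _ h12 (by linarith [h' 1 1 0 zero_le_one zero_le_one le_rfl])⟩⟩
      | (obtain ⟨e1, e2, e3⟩ := lt_of_ternary_nonpos (a := α 1 2) (b := α 1 3) (c := α 2 3)
          hdet h12 h13 a1 a2 h'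
         exact ⟨1, by simp, 2, by simp, 3, by simp, by simp, by simp, by simp,
          Or.inr ⟨a1, e1, a2, e2, e3⟩⟩)
      | (obtain ⟨e1, e2, e3⟩ := lt_of_ternary_nonpos (a := α 1 2) (b := α 2 3) (c := α 1 3)
          (fun h0 => hdet (by linarith)) h12 h23 a1 a3
          (fun x y z hx hy hz => by linarith [h' y x z hy hx hz])
         refine ⟨2, by simp, 1, by simp, 3, by simp, by simp, by simp, by simp, ?_⟩
         rw [hα 2 1]
         exact Or.inr ⟨a1, e1, a3, e2, e3⟩)
      | (obtain ⟨e1, e2, e3⟩ := lt_of_ternary_nonpos (a := α 1 3) (b := α 2 3) (c := α 1 2)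
          (fun h0 => hdet (by linarith)) h13 h23 a2 a3
          (fun x y z hx hy hz => by linarith [h' y z x hy hz hx])
         refine ⟨3, by simp, 1, by simp, 2, by simp, by simp, by simp, by simp, ?_⟩
         rw [hα 3 1, hα 3 2]
         exact Or.inr ⟨a2, e1, a3, e2, e3⟩)

/-! ### Inequality constraints only -/

namespace IneqType

/-- The number of the first coordinate in the sum of the `ε_j x_j²`. -/
def tailStart (q : ℕ) : IneqType → ℕ
  | t1 _ => q + 1
  | t2 => q + 2
  | t3 _ => q
  | t4 _ => q + 1
  | t5 => q + 1
  | t6 _ _ => q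
  | t7 _ => q
  | t8 _ => q
  | t9 _ _ _ => q + 1
  | t10 _ _ => q

lemma le_tailStart (q : ℕ) (T : IneqType) : q ≤ T.tailStart q := by
  cases T <;> simp [tailStart]

lemma Admissible.tailStart_le {n q : ℕ} {T : IneqType} (hT : T.Admissible n q) :
    T.tailStart q ≤ n := by
  obtain ⟨-, h⟩ := hT
  cases T with
  | t1 k | t3 k => exact h.2.2
  | t4 k | t7 k | t8 k => exact h.2
  | t6 δ α | t10 δ α => exact h.2.2.2
  | t9 a b c => exact h.2.2.2
  | _ => exact h

lemma len_le (q : ℕ) (T : IneqType) : T.len q ≤ q - 1 := by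
  have := T.one_le_gap
  unfold len
  omega

variable {n q : ℕ} {ε : ℕ → ℝ} {T : IneqType}

lemma blow_upd (ε : ℕ → ℝ) (hq : T.gap ≤ q) {j : ℕ} (hj : T.tailStart q ≤ j) (hn : j ≤ n)
    (s : ℝ) (d : Vec n) (r : ℝ) :
    T.blow q ε s (upd d j r) = T.blow q ε s d + ε j * (r ^ 2 - coord d j ^ 2) := by
  cases T <;> simp only [tailStart] at hj <;> simp only [gap] at hq <;> simp only [blow] <;>
    simp (disch := omega) only [coord_upd_ne] <;> rw [tail_upd _ (by omega) hj hn] <;> ring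

lemma allEq_of_forall_nonpos (hε : ∀ j, IsSign (ε j)) (hT : T.Admissible n q)
    (h : ∀ d ∈ cone n (T.len q) (q - 1), T.blow q ε 0 d ≤ 0) :
    AllEq ε (T.tailStart q) n (-1) := by
  intro j hj
  have h1 := T.len_le q
  have h2 := T.le_tailStart q
  have h3 := T.one_le_gap
  have h4 := hT.1
  have hj1 := hj.1
  have := h (upd 0 j 1) (upd_mem_cone (zero_mem_cone _ _) (by omega) hj.2 (by omega))
  rw [blow_upd ε hT.1 hj.1 hj.2, (blowup q ε hT.powLE).apply_zero_zero] at this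
  exact (hε j).eq_neg_one_of_nonpos (by simpa using this)

/-- The quadratic part of `g̃` is nonpositive on the linearized cone exactly if the ACQ condition
holds. -/
lemma forall_nonpos_iff (hε : ∀ j, IsSign (ε j)) (hT : T.Admissible n q) :
    (∀ d ∈ cone n (T.len q) (q - 1), T.blow q ε 0 d ≤ 0) ↔ T.ACQCond n q ε := by
  have hall := allEq_of_forall_nonpos hε hT
  have hgap := hT.1
  have hts := hT.tailStart_le
  cases T with
  | t1 k =>
    obtain ⟨-, hk, -, -⟩ := hT
    simp only [gap] at hgap
    simp only [tailStart] at hts hall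
    constructor
    · intro h
      have ht := hall h
      by_cases hk2 : k = 2
      · subst hk2
        have := h (upd 0 q 1) (upd_mem_cone (zero_mem_cone _ _) (by simp only [len, gap]; omega)
          (by omega) (by omega))
        simp (disch := omega) only [blow, coord_upd_self, tail_upd_of_lt, tail_zero] at this
        refine Or.inl fun j hj => ?_
        rcases eq_or_lt_of_le hj.1 with rfl | hlt
        · exact (hε _).eq_neg_one_of_nonpos (by simpa using this)
        · exact ht j ⟨hlt, hj.2⟩
      · exact Or.inr ⟨by omega, ht⟩
    · intro h d hd
      have ht : AllEq ε (q + 1) n (-1) := by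
        rcases h with h | h
        · exact fun j hj => h j ⟨by have := hj.1; omega, hj.2⟩
        · exact h.2
      have h1 := tail_nonpos ht d
      simp only [blow]
      by_cases hk2 : k = 2
      · subst hk2
        have hq : ε q = -1 := by
          rcases h with h | h
          · exact h q ⟨le_rfl, by omega⟩
          · exact absurd h.1 (by omega)
        rw [hq]
        simp only [Nat.sub_self, pow_zero]
        linarith [sq_nonneg (coord d q)]
      · rw [zero_pow (by omega)]
        linarith
  | t2 =>
    refine ⟨hall, fun h d hd => ?_⟩
    have := tail_nonpos (show AllEq ε (q + 2) n (-1) from h) d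
    simp only [blow]
    linarith
  | t3 k =>
    obtain ⟨-, hk, -, -⟩ := hT
    simp only [gap] at hgap
    simp only [tailStart] at hts hall
    constructor
    · intro h
      have ht := hall h
      by_cases hk2 : k = 2
      · subst hk2
        have := h (upd 0 (q - 1) (-1)) (upd_mem_cone (zero_mem_cone _ _)
          (by simp only [len, gap]; omega) (by omega) (by norm_num))
        simp (disch := omega) only [blow, coord_upd_self, tail_upd_of_lt, tail_zero] at this
        refine Or.inl fun j hj => ?_
        rcases eq_or_lt_of_le hj.1 with rfl | hlt
        · exact (hε _).eq_neg_one_of_nonpos (by simpa using this)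
        · exact ht j ⟨by omega, hj.2⟩
      · exact Or.inr ⟨by omega, ht⟩
    · intro h d hd
      have ht : AllEq ε q n (-1) := by
        rcases h with h | h
        · exact fun j hj => h j ⟨by have := hj.1; omega, hj.2⟩
        · exact h.2
      have h1 := tail_nonpos ht d
      simp only [blow]
      by_cases hk2 : k = 2
      · subst hk2
        have hq : ε (q - 1) = -1 := by
          rcases h with h | h
          · exact h (q - 1) ⟨le_rfl, by omega⟩
          · exact absurd h.1 (by omega)
        rw [hq]
        simp only [Nat.sub_self, pow_zero]
        linarith [sq_nonneg (coord d (q - 1))]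
      · rw [zero_pow (by omega)]
        linarith
  | t4 k =>
    obtain ⟨-, hk, -⟩ := hT
    simp only [gap] at hgap
    simp only [tailStart] at hts
    refine ⟨fun h => ?_, fun h => h.elim⟩
    -- Only the product `x_{q-1} x_q` survives at `s = 0`, and it is positive here.
    have := h (upd (upd 0 (q - 1) (-1)) q (-1)) (upd_mem_cone (upd_mem_cone (zero_mem_cone _ _)
      (by simp only [len, gap]; omega) (by omega) (by norm_num)) (by simp only [len, gap]; omega)
      (by omega) (by norm_num))
    simp (disch := omega) only [blow, coord_upd_self, coord_upd_ne, tail_upd_of_lt, tail_zero,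
      zero_pow] at this
    norm_num at this
  | t5 =>
    simp only [gap] at hgap
    simp only [tailStart] at hts hall
    constructor
    · intro h
      have := h (upd 0 (q - 1) (-1)) (upd_mem_cone (zero_mem_cone _ _)
        (by simp only [len, gap]; omega) (by omega) (by norm_num))
      simp (disch := omega) only [blow, coord_upd_self, tail_upd_of_lt, tail_zero] at this
      exact ⟨(hε _).eq_neg_one_of_nonpos (by simpa using this), hall h⟩
    · rintro ⟨h1, h2⟩ d hd
      have := tail_nonpos h2 d
      simp only [blow, h1]
      linarith [sq_nonneg (coord d (q - 1))]
  | t6 δ α =>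
    obtain ⟨-, hδ1, hδ2, hS, -⟩ := hT
    simp only [gap] at hgap
    simp only [tailStart] at hts hall
    constructor
    · intro h
      have e1 := h (upd 0 (q - 1) (-1)) (upd_mem_cone (zero_mem_cone _ _)
        (by simp only [len, gap]; omega) (by omega) (by norm_num))
      have e2 := h (upd 0 (q - 2) (-1)) (upd_mem_cone (zero_mem_cone _ _)
        (by simp only [len, gap]; omega) (by omega) (by norm_num))
      have e3 := h (upd (upd 0 (q - 2) (-1)) (q - 1) (-1)) (upd_mem_cone (upd_mem_cone
        (zero_mem_cone _ _) (by simp only [len, gap]; omega) (by omega) (by norm_num))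
        (by simp only [len, gap]; omega) (by omega) (by norm_num))
      simp (disch := omega) only [blow, coord_upd_self, coord_upd_ne, coord_zero, tail_upd_of_lt,
        tail_zero] at e1 e2 e3
      have h1 : δ 1 = -1 := hδ1.eq_neg_one_of_nonpos (by linarith)
      have h2 : δ 2 = -1 := hδ2.eq_neg_one_of_nonpos (by linarith)
      -- The diagonal direction yields `α ≤ 2`, and `α = 2` would contradict nondegeneracy.
      refine ⟨h1, h2, lt_of_le_of_ne (by rw [h1, h2] at e3; linarith) fun h3 => hS ?_, hall h⟩
      rw [h1, h2, h3]; norm_num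
    · rintro ⟨h1, h2, h3, h4⟩ d hd
      have ht := tail_nonpos h4 d
      have u1 := hd.2 (q - 1) (by omega) (by omega)
      have u2 := hd.2 (q - 2) (by omega) (by omega)
      have := mul_nonneg (sub_nonneg.2 h3.le) (mul_nonneg_of_nonpos_of_nonpos u1 u2)
      simp only [blow, h1, h2]
      nlinarith [sq_nonneg (coord d (q - 1) - coord d (q - 2))]
  | t7 ε' =>
    simp only [gap] at hgap
    simp only [tailStart] at hts hall
    constructor
    · intro h
      have := h (upd 0 (q - 2) (-1)) (upd_mem_cone (zero_mem_cone _ _)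
        (by simp only [len, gap]; omega) (by omega) (by norm_num))
      simp (disch := omega) only [blow, coord_upd_self, coord_upd_ne, coord_zero, tail_upd_of_lt,
        tail_zero] at this
      exact ⟨(hε _).eq_neg_one_of_nonpos (by linarith), hall h⟩
    · rintro ⟨h1, h2⟩ d hd
      have := tail_nonpos h2 d
      simp only [blow, h1]
      linarith [sq_nonneg (coord d (q - 2) + ε' * coord d (q - 1))]
  | t8 ε' =>
    obtain ⟨-, hε', -⟩ := hT
    simp only [gap] at hgap
    simp only [tailStart] at hts hall
    constructor
    · intro h
      have e1 := h (upd 0 (q - 1) (-1)) (upd_mem_cone (zero_mem_cone _ _)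
        (by simp only [len, gap]; omega) (by omega) (by norm_num))
      -- Here `H 0` equals `ε_{q-1} + 2 ε'`. The entry `-2` matters: with `-1` the value for
      -- `ε_{q-1} = -1`, `ε' = 1` would be zero and exclude nothing.
      have e2 := h (upd (upd 0 (q - 2) (-2)) (q - 1) (-1)) (upd_mem_cone (upd_mem_cone
        (zero_mem_cone _ _) (by simp only [len, gap]; omega) (by omega) (by norm_num))
        (by simp only [len, gap]; omega) (by omega) (by norm_num))
      simp (disch := omega) only [blow, coord_upd_self, coord_upd_ne, coord_zero, tail_upd_of_lt,
        tail_zero] at e1 e2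
      have h1 : ε (q - 1) = -1 := (hε _).eq_neg_one_of_nonpos (by linarith)
      rw [h1] at e2
      refine ⟨h1, hε'.eq_neg_one fun h2 => ?_, hall h⟩
      rw [h2] at e2
      norm_num at e2
    · rintro ⟨h1, h2, h4⟩ d hd
      have ht := tail_nonpos h4 d
      have u1 := hd.2 (q - 1) (by omega) (by omega)
      have u2 := hd.2 (q - 2) (by omega) (by omega)
      have := mul_nonneg_of_nonpos_of_nonpos u2 u1
      simp only [blow, h1, h2]
      linarith [sq_nonneg (coord d (q - 1))]
  | t9 ε01 ε02 ε12 =>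
    obtain ⟨-, h01, -⟩ := hT
    simp only [gap] at hgap
    simp only [tailStart] at hts
    refine ⟨fun h => ?_, fun h => h.elim⟩
    -- The free coordinate `x_q` takes the sign that makes `ε01 * x_{q-1} * x_q` equal to `1`.
    have := h (upd (upd 0 (q - 1) (-1)) q (-ε01)) (upd_mem_cone (upd_mem_cone (zero_mem_cone _ _)
      (by simp only [len, gap]; omega) (by omega) (by norm_num)) (by simp only [len, gap]; omega)
      (by omega) (by omega))
    simp (disch := omega) only [blow, coord_upd_self, coord_upd_ne, coord_zero, tail_upd_of_lt,
      tail_zero] at this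
    have h2 := h01.sq
    linarith
  | t10 δ α =>
    obtain ⟨-, hδ, hα, hS, -⟩ := hT
    simp only [gap] at hgap
    simp only [tailStart] at hts hall
    constructor
    · intro h
      have key : ∀ x y z : ℝ, x ≤ 0 → y ≤ 0 → z ≤ 0 →
          δ 1 * x ^ 2 + δ 2 * y ^ 2 + δ 3 * z ^ 2 + α 1 2 * x * y + α 1 3 * x * z
            + α 2 3 * y * z ≤ 0 := by
        intro x y z hx hy hz
        have := h (upd (upd (upd 0 (q - 3) x) (q - 2) y) (q - 1) z)
          (upd_mem_cone (upd_mem_cone (upd_mem_cone (zero_mem_cone _ _)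
            (by simp only [len, gap]; omega) (by omega) (fun _ => hx))
            (by simp only [len, gap]; omega) (by omega) (fun _ => hy))
            (by simp only [len, gap]; omega) (by omega) (fun _ => hz))
        simp (disch := omega) only [blow, coord_upd_self, coord_upd_ne, tail_upd_of_lt,
          tail_zero] at this
        linarith
      have h1 : δ 1 = -1 := (hδ 1 (by simp)).eq_neg_one_of_nonpos
        (by linarith [key (-1) 0 0 (by norm_num) le_rfl le_rfl])
      have h2 : δ 2 = -1 := (hδ 2 (by simp)).eq_neg_one_of_nonpos
        (by linarith [key 0 (-1) 0 le_rfl (by norm_num) le_rfl])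
      have h3 : δ 3 = -1 := (hδ 3 (by simp)).eq_neg_one_of_nonpos
        (by linarith [key 0 0 (-1) le_rfl le_rfl (by norm_num)])
      refine ⟨h1, h2, h3, hall h, (dagger_iff hα h1 h2 h3 hS).2 fun x y z hx hy hz => ?_⟩
      have := key x y z hx hy hz
      rw [h1, h2, h3] at this
      linarith
    · rintro ⟨h1, h2, h3, h4, h5⟩ d hd
      have ht := tail_nonpos h4 d
      have := (dagger_iff hα h1 h2 h3 hS).1 h5 (coord d (q - 3)) (coord d (q - 2))
        (coord d (q - 1)) (hd.2 _ (by omega) (by omega)) (hd.2 _ (by omega) (by omega))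
        (hd.2 _ (by omega) (by omega))
      simp only [blow, h1, h2, h3]
      linarith

lemma polarLE_of_not_allEq (hε : ∀ j, IsSign (ε j)) (hT : T.Admissible n q)
    (h : ¬ AllEq ε (T.tailStart q) n 1) :
    PolarLE (tcone (ineqSet (T.len q) (q - 1) fun x : Vec n => T.form q ε x))
      (cone n (T.len q) (q - 1)) := by
  obtain ⟨j, hj, hjn, hj1⟩ := exists_of_not_allEq hε h
  have h1 := T.len_le q
  have h2 := T.le_tailStart q
  have h3 := T.one_le_gap
  have h4 := hT.1
  refine polarLE_ineqSet_of_neg (blowup q ε hT.powLE) h1 (j := j) (by omega) hjn fun d r => ?_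
  rw [blow_upd ε hT.1 hj hjn, hj1]

/-- With `H 0 ≤ 0` on the tangent cone, the positive definite tail is at most `w²`, and so is the
square of its first coordinate. -/
lemma not_polarLE_of_allEq (hT : T.Admissible n q) (hall : AllEq ε (T.tailStart q) n 1)
    (w : Vec n →L[ℝ] ℝ) (hw : w (upd 0 (T.tailStart q) 1) = 0)
    (hH : ∀ d : Vec n, (∀ j, 1 ≤ j → j ≤ q - 1 → coord d j ≤ 0) →
      w d ≤ 0 ∧ -(w d) ^ 2 ≤ T.blow q ε 0 d - tail ε (T.tailStart q) d) :
    ¬ PolarLE (tcone (ineqSet (T.len q) (q - 1) fun x : Vec n => T.form q ε x))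
      (cone n (T.len q) (q - 1)) := by
  have h1 := T.len_le q
  have h2 := T.le_tailStart q
  have h3 := T.one_le_gap
  have h4 := hT.1
  refine not_polarLE_of_sq_le (by omega) (by omega) hT.tailStart_le w hw fun d hd => ?_
  obtain ⟨e1, e2⟩ := hH d fun j hj hj' => coord_le_of_mem_tcone (fun x hx => hx.1 j hj hj') hd
  have e3 := (blowup q ε hT.powLE).le_of_mem_tcone (fun x hx => nonpos_of_mem_ineqSet h1 hx) hd
  have e4 := tail_of_allEq_one hall (x := d) le_rfl hT.tailStart_le
  exact ⟨e1, by linarith⟩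

/-- The ray through `-e_q` is feasible exactly when `ε_q x_q^k ≤ 0` for `x_q < 0`; the coupling with
`x_{q-1}` then gives GCQ. For the other sign and a nonnegative tail, `x_q < 0` makes `g̃` positive,
so the feasible set lies in `x_q ≥ 0`. -/
lemma polarLE_iff_t4 {k : ℕ} (hε : ∀ j, IsSign (ε j)) (hT : (t4 k).Admissible n q) :
    PolarLE (tcone (ineqSet (q - 2) (q - 1) fun x : Vec n => (t4 k).form q ε x))
      (cone n (q - 2) (q - 1)) ↔ (t4 k).GCQCond n q ε := by
  have hB := blowup (n := n) q ε hT.powLE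
  obtain ⟨hq, hk, hn⟩ := id hT
  simp only [gap] at hq
  constructor
  · intro hP
    by_contra hcon
    simp only [GCQCond, not_or, not_not] at hcon
    obtain ⟨hall, hne⟩ := hcon
    refine not_polarLE (-coordL n q) (functional_le_of_mem_tcone _ fun x hx => ?_)
      (d := upd 0 q (-1)) (upd_mem_cone (zero_mem_cone _ _) (by omega) (by omega) (by omega)) ?_ hP
    · have h1 := hx.1 (q - 1) (by omega) le_rfl
      have h2 := nonpos_of_mem_ineqSet (by omega) hx
      have h3 := tail_nonneg hall x
      simp only [form] at h2
      rw [neg_apply, coordL_apply]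
      by_contra! hc
      have hx0 : coord x q < 0 := by linarith
      have h4 := mul_nonneg_of_nonpos_of_nonpos h1 hx0.le
      have h5 : 0 < ε q * coord x q ^ k := by
        rcases hk with rfl | rfl
        · rw [(hε q).eq_neg_one (by intro h; exact hne (by rw [h]; norm_num))]
          nlinarith [pow_pos (neg_pos.2 hx0) 3]
        · rw [(hε q).resolve_right (by intro h; exact hne (by rw [h]; norm_num))]
          have := hx0.ne
          positivity
      linarith
    · rw [neg_apply, coordL_apply, coord_upd_self _ (by omega) (by omega)]
      norm_num
  · rintro (h | h)
    · exact polarLE_of_not_allEq hε hT h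
    · intro ℓ hℓ d hd
      refine le_zero_of_coupled_ineq hB (u := q - 1) (w := q) (by omega) le_rfl (by omega)
        (by omega) (D := cone n (q - 2) (q - 1)) subset_rfl
        (fun d hd r => upd_mem_cone hd (by omega) (by omega) (by omega))
        (fun d hd r hr => upd_mem_cone hd (by omega) (by omega) (fun _ => hr))
        (T := tail ε (q + 1)) (fun d r => tail_upd_of_lt _ (by omega) _ _) (fun d hd => ?_)
        (mem_tcone_ineqSet hB (upd_mem_cone (zero_mem_cone _ _) (by omega) (by omega) (by omega))
          ?_) hℓ hd
      · simp only [blow]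
        rw [zero_pow (by omega)]
        ring
      · filter_upwards [self_mem_nhdsWithin] with s (hs : 0 < s)
        simp (disch := omega) only [blow, coord_upd_self, coord_upd_ne, coord_zero,
          tail_upd_of_lt, tail_zero, h]
        rcases hk with rfl | rfl
        · norm_num; linarith
        · norm_num; positivity

/-- The germ `x_q³ + x_u x_q + c x_a x_q + c' x_a x_u + …` satisfies GCQ. -/
lemma polarLE_ineqSet_cubic {a u : ℕ} {f : Vec n → ℝ} {H : ℝ → Vec n → ℝ} (hB : Blowup f H)
    {c c' : ℝ} (hau : a ≠ u) (ha : q - 3 < a) (ha' : a ≤ q - 1) (hu : q - 3 < u) (hu' : u ≤ q - 1)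
    (hn : q + 1 ≤ n)
    (hH : ∀ s d, H s d = s * coord d q ^ 3 + coord d u * coord d q + c * coord d a * coord d q
      + c' * coord d a * coord d u + tail ε (q + 1) d) :
    PolarLE (tcone (ineqSet (q - 3) (q - 1) f)) (cone n (q - 3) (q - 1)) := by
  intro ℓ hℓ d hd
  -- On the ray through `-e_q` only the cubic term survives, and it is negative.
  have hneg : upd 0 q (-1) ∈ tcone (ineqSet (q - 3) (q - 1) f) := by
    refine mem_tcone_ineqSet hB (upd_mem_cone (zero_mem_cone _ _) (by omega) (by omega)
      (by omega)) ?_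
    filter_upwards [self_mem_nhdsWithin] with s (hs : 0 < s)
    rw [hH]
    simp (disch := omega) only [coord_upd_self, coord_upd_ne, coord_zero, tail_upd_of_lt,
      tail_zero]
    linarith
  have hea : 0 ≤ ℓ (upd 0 a 1) := by
    have := hℓ _ (mem_tcone_ineqSet hB (d := upd 0 a (-1)) (upd_mem_cone (zero_mem_cone _ _) ha
        (by omega) (by norm_num)) (Eventually.of_forall fun s => by
          rw [hH]
          simp (disch := omega) only [coord_upd_ne, coord_zero, tail_upd_of_lt, tail_zero]
          linarith))
    rw [map_upd ℓ _ (by omega) (by omega)] at this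
    simpa using this
  -- After setting `d_a = 0` only the coupling with `u` remains at `s = 0`; restoring `d_a ≤ 0` does
  -- not increase `ℓ`.
  have h0 := le_zero_of_coupled_ineq hB (u := u) (w := q) hu hu' (by omega) (by omega)
    (D := {d | d ∈ cone n (q - 3) (q - 1) ∧ coord d a = 0}) (fun d hd => hd.1)
    (fun d hd r => ⟨upd_mem_cone hd.1 (by omega) (by omega) (by omega), by
      rw [coord_upd_ne _ (by omega)]; exact hd.2⟩)
    (fun d hd r hr => ⟨upd_mem_cone hd.1 (by omega) (by omega) (fun _ => hr), by
      rw [coord_upd_ne _ hau]; exact hd.2⟩) (T := tail ε (q + 1))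
    (fun d r => tail_upd_of_lt _ (by omega) _ _) (fun d hd => by rw [hH, hd.2]; ring) hneg hℓ
    (d := upd d a 0) ⟨upd_mem_cone hd ha (by omega) (fun _ => le_rfl),
      coord_upd_self _ (by omega) (by omega) _⟩
  rw [map_upd ℓ _ (by omega) (by omega)] at h0
  have := mul_nonpos_of_nonpos_of_nonneg (hd.2 a (by omega) ha') hea
  linarith

/-- With two negative couplings and a nonnegative tail the cubic estimate bounds `x_q` from above by
`-(x_{q-2} + x_{q-1})`, which excludes the direction `e_q`; one positive coupling suffices for GCQ.
-/
lemma polarLE_iff_t9 {ε01 ε02 ε12 : ℝ} (hε : ∀ j, IsSign (ε j))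
    (hT : (t9 ε01 ε02 ε12).Admissible n q) :
    PolarLE (tcone (ineqSet (q - 3) (q - 1) fun x : Vec n => (t9 ε01 ε02 ε12).form q ε x))
      (cone n (q - 3) (q - 1)) ↔ (t9 ε01 ε02 ε12).GCQCond n q ε := by
  have hB := blowup (n := n) q ε hT.powLE
  obtain ⟨hq, h01, h02, h12, hn⟩ := id hT
  simp only [gap] at hq
  constructor
  · intro hP
    by_contra hcon
    simp only [GCQCond, not_or, not_not] at hcon
    obtain ⟨hall, hne1, hne2⟩ := hcon
    obtain rfl := h01.eq_neg_one hne1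
    obtain rfl := h02.eq_neg_one hne2
    refine not_polarLE (coordL n q + coordL n (q - 2) + coordL n (q - 1))
      (functional_le_of_mem_tcone _ fun x hx => ?_) (d := upd 0 q 1)
      (upd_mem_cone (zero_mem_cone _ _) (by omega) (by omega) (by omega)) ?_ hP
    · have h2 := nonpos_of_mem_ineqSet (by omega) hx
      simp only [form] at h2
      simp only [add_apply, coordL_apply]
      exact add_le_zero_of_cubic (hx.1 _ (by omega) (by omega)) (hx.1 _ (by omega) (by omega))
        h12 (tail_nonneg hall x) (by linarith)
    · simp (disch := omega) only [add_apply, coordL_apply, coord_upd_ne, coord_upd_self,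
        coord_zero]
      norm_num
  · rintro (h | h | h)
    · exact polarLE_of_not_allEq hε hT h
    · refine polarLE_ineqSet_cubic hB (a := q - 2) (u := q - 1) (c := ε02) (c' := ε12) (ε := ε)
        (by omega) (by omega) (by omega) (by omega) (by omega) hn fun s d => ?_
      simp only [blow, h]
      ring
    · refine polarLE_ineqSet_cubic hB (a := q - 1) (u := q - 2) (c := ε01) (c' := ε12) (ε := ε)
        (by omega) (by omega) (by omega) (by omega) (by omega) hn fun s d => ?_
      simp only [blow, h]
      ring

lemma polarLE_iff (hε : ∀ j, IsSign (ε j)) (hT : T.Admissible n q) :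
    PolarLE (tcone (ineqSet (T.len q) (q - 1) fun x : Vec n => T.form q ε x))
      (cone n (T.len q) (q - 1)) ↔ T.GCQCond n q ε := by
  have hgap := hT.1
  have hts := hT.tailStart_le
  -- A functional `w` controlling the part of `H 0` outside the tail from below reduces GCQ to the
  -- existence of a negative square in the tail.
  have simple : ∀ w : Vec n →L[ℝ] ℝ, w (upd 0 (T.tailStart q) 1) = 0 →
      (∀ d : Vec n, (∀ j, 1 ≤ j → j ≤ q - 1 → coord d j ≤ 0) →
        w d ≤ 0 ∧ -(w d) ^ 2 ≤ T.blow q ε 0 d - tail ε (T.tailStart q) d) →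
      (PolarLE (tcone (ineqSet (T.len q) (q - 1) fun x : Vec n => T.form q ε x))
        (cone n (T.len q) (q - 1)) ↔ ¬ AllEq ε (T.tailStart q) n 1) := fun w hw hH =>
    ⟨fun hP hall => not_polarLE_of_allEq hT hall w hw hH hP, polarLE_of_not_allEq hε hT⟩
  cases T with
  | t1 k =>
    simp only [gap] at hgap
    simp only [tailStart] at hts simple
    have hk := hT.2.1
    by_cases hk2 : k = 2
    · subst hk2
      constructor
      · intro hP
        by_contra hcon
        simp only [GCQCond, not_or, not_and, not_not] at hcon
        have hq := hcon.1 trivial q ⟨le_rfl, by omega⟩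
        refine not_polarLE_of_allEq hT hcon.2 0 (by simp) (fun d _ => ⟨by simp, ?_⟩) hP
        simp [blow, tailStart, hq, sq_nonneg]
      · intro h
        by_cases hall : AllEq ε (q + 1) n 1
        · have hq : ε q = -1 := by
            refine (hε q).eq_neg_one fun h1 => ?_
            rcases h with h | h
            · refine h.2 fun j hj => ?_
              rcases eq_or_lt_of_le hj.1 with rfl | hlt
              exacts [h1, hall j ⟨hlt, hj.2⟩]
            · exact h hall
          -- For `k = 2` the coordinate `x_q` is itself a free coordinate with a square, here with
          -- coefficient `-1`.
          refine polarLE_ineqSet_of_neg (blowup q ε hT.powLE) (len_le _ _) (j := q) (by omega)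
            (by omega) fun d r => ?_
          simp (disch := omega) only [blow, coord_upd_self, tail_upd_of_lt, hq]
          ring
        · exact polarLE_of_not_allEq hε hT hall
    · rw [simple 0 (by simp) fun d _ => ⟨by simp, by
        simp [blow, zero_pow (show k - 2 ≠ 0 by omega)]⟩]
      simp [GCQCond, hk2]
  | t2 => exact simple 0 (by simp) fun d _ => ⟨by simp, by simp [blow, tailStart]⟩
  | t3 k =>
    simp only [gap] at hgap
    have hk := hT.2.1
    refine simple (coordL n (q - 1)) ?_ fun d hd => ⟨?_, ?_⟩
    · simp (disch := omega) [tailStart, coord_upd_ne]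
    · simpa using hd (q - 1) (by omega) le_rfl
    · simp only [blow, tailStart, add_sub_cancel_right, coordL_apply]
      by_cases hk2 : k = 2
      · subst hk2
        rcases hε (q - 1) with e | e <;> rw [e] <;>
          (simp; try linarith [sq_nonneg (coord d (q - 1))])
      · rw [zero_pow (by omega)]
        simpa using sq_nonneg _
  | t4 k => exact polarLE_iff_t4 hε hT
  | t5 =>
    simp only [gap] at hgap
    refine simple (coordL n (q - 1)) ?_ fun d hd => ⟨?_, ?_⟩
    · simp (disch := omega) [tailStart, coord_upd_ne]
    · simpa using hd (q - 1) (by omega) le_rfl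
    · simp only [blow, tailStart, coordL_apply]
      rcases hε (q - 1) with e | e <;> rw [e] <;> linarith [sq_nonneg (coord d (q - 1))]
  | t6 δ α =>
    simp only [gap] at hgap
    refine simple ((1 + |α|) • (coordL n (q - 1) + coordL n (q - 2))) ?_ fun d hd => ⟨?_, ?_⟩
    · simp (disch := omega) [tailStart, coord_upd_ne]
    all_goals
      have h1 := hd (q - 1) (by omega) (by omega)
      have h2 := hd (q - 2) (by omega) (by omega)
      simp only [smul_apply, add_apply, coordL_apply, smul_eq_mul]
    · exact mul_nonpos_of_nonneg_of_nonpos (by positivity) (by linarith)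
    · have := neg_le_of_abs_le (abs_binary_form_le (α := α) hT.2.1 hT.2.2.1 h1 h2)
      simp only [blow, tailStart]
      linarith
  | t7 ε' =>
    simp only [gap] at hgap
    refine simple (coordL n (q - 1) + coordL n (q - 2)) ?_ fun d hd => ⟨?_, ?_⟩
    · simp (disch := omega) [tailStart, coord_upd_ne]
    all_goals
      have h1 := hd (q - 1) (by omega) (by omega)
      have h2 := hd (q - 2) (by omega) (by omega)
      simp only [add_apply, coordL_apply]
    · linarith
    · have h3 := mul_nonneg_of_nonpos_of_nonpos h1 h2
      simp only [blow, tailStart]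
      rcases hε (q - 2) with e | e <;> rcases hT.2.1 with e' | e' <;> rw [e, e'] <;> nlinarith
  | t8 ε' =>
    simp only [gap] at hgap
    refine simple (coordL n (q - 1) + coordL n (q - 2)) ?_ fun d hd => ⟨?_, ?_⟩
    · simp (disch := omega) [tailStart, coord_upd_ne]
    all_goals
      have h1 := hd (q - 1) (by omega) (by omega)
      have h2 := hd (q - 2) (by omega) (by omega)
      simp only [add_apply, coordL_apply]
    · linarith
    · have h3 := mul_nonneg_of_nonpos_of_nonpos h1 h2
      simp only [blow, tailStart]
      rcases hε (q - 1) with e | e <;> rcases hT.2.1 with e' | e' <;> rw [e, e'] <;>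
        nlinarith [sq_nonneg (coord d (q - 1)), sq_nonneg (coord d (q - 2))]
  | t9 ε01 ε02 ε12 => exact polarLE_iff_t9 hε hT
  | t10 δ α =>
    simp only [gap] at hgap
    refine simple ((1 + |α 1 2| + |α 1 3| + |α 2 3|) •
      (coordL n (q - 3) + coordL n (q - 2) + coordL n (q - 1))) ?_ fun d hd => ⟨?_, ?_⟩
    · simp (disch := omega) [tailStart, coord_upd_ne]
    all_goals
      have h1 := hd (q - 1) (by omega) (by omega)
      have h2 := hd (q - 2) (by omega) (by omega)
      have h3 := hd (q - 3) (by omega) (by omega)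
      simp only [smul_apply, add_apply, coordL_apply, smul_eq_mul]
    · exact mul_nonpos_of_nonneg_of_nonpos (by positivity) (by linarith)
    · have := neg_le_of_abs_le (abs_ternary_form_le (α := α 1 2) (β := α 1 3) (γ := α 2 3)
        (hT.2.1 1 (by simp)) (hT.2.1 2 (by simp)) (hT.2.1 3 (by simp)) h3 h2 h1)
      simp only [blow, tailStart]
      linarith

theorem classification {l₁ : ℕ} (hε : ∀ j, IsSign (ε j)) (hT : T.Admissible n q)
    (hl : l₁ ≤ (T.len q + 1) / 2) {g : Vec n → Fin q → ℝ} {h : Vec n → Fin 0 → ℝ}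
    (hK : KGEquiv g h (T.normalForm n q l₁ ε) noConstraint) :
    ¬ LICQ g h ∧ (MFCQ g h ↔ 0 < l₁) ∧ (0 < l₁ → ACQ g h ∧ GCQ g h) ∧
      (l₁ = 0 → (ACQ g h ↔ T.ACQCond n q ε) ∧ (GCQ g h ↔ T.GCQCond n q ε)) := by
  have h1 := T.len_le q
  have h2 := T.le_tailStart q
  have h3 := T.one_le_gap
  have h4 := hT.1
  have h5 := hT.tailStart_le
  obtain ⟨e1, e2, e3, e4⟩ := ineqClass hT.powLE hT.1 (by omega) hl hK
  refine ⟨e1, e2, e3, fun h0 => ?_⟩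
  obtain ⟨f1, f2⟩ := e4 h0
  -- The coordinate `x_n` always belongs to the tail and serves as the free coordinate in the ACQ
  -- criterion.
  rw [f1, f2, polarLE_iff hε hT, cone_subset_tcone_ineqSet_iff (blowup q ε hT.powLE) h1 (j := n)
    (by omega) le_rfl (hε n) fun d r => blow_upd ε hT.1 h5 le_rfl 0 d r, forall_nonpos_iff hε hT]
  exact ⟨Iff.rfl, Iff.rfl⟩

end IneqType

end CQ

end

theorem mainTheorem1 :
    -- LICQ holds exactly for the regular class (inactive inequality constraints being removed).
    (∀ (n q r : ℕ) (g : CQ.Vec n → Fin q → ℝ) (h : CQ.Vec n → Fin r → ℝ),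
      CQ.SmoothGerm g → CQ.SmoothGerm h → (∀ i, g 0 i ≤ 0) → h 0 = 0 →
      (CQ.LICQ g h ↔ ∃ (s : ℕ) (e : Fin s ≃ CQ.Active g), s + r ≤ n ∧
        CQ.KGEquiv (fun x a => g x (e a).1) h (CQ.coords 0 s) (CQ.coords s r))) ∧
    -- MFCQ fails whenever a singular equality constraint is present.
    (∀ (n q r : ℕ) (g : CQ.Vec n → Fin q → ℝ) (h : CQ.Vec n → Fin r → ℝ),
      ¬ LinearIndependent ℝ (CQ.diff h) → ¬ CQ.MFCQ g h) ∧
    -- Classes with one equality constraint and no inequality constraints.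
    (∀ (n : ℕ) (ε : ℕ → ℝ) (T : CQ.EqType), (∀ j, CQ.IsSign (ε j)) → T.Admissible n →
      ∀ (g : CQ.Vec n → Fin 0 → ℝ) (h : CQ.Vec n → Fin 1 → ℝ),
        CQ.KGEquiv g h CQ.noConstraint (CQ.single fun x => T.form ε x) →
        ¬ CQ.LICQ g h ∧ ¬ CQ.MFCQ g h ∧ ¬ CQ.ACQ g h ∧ (CQ.GCQ g h ↔ T.GCQCond n ε)) ∧
    -- Classes with inequality constraints only.
    (∀ (n q l₁ : ℕ) (ε : ℕ → ℝ) (T : CQ.IneqType), (∀ j, CQ.IsSign (ε j)) →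
      T.Admissible n q → l₁ ≤ (T.len q + 1) / 2 →
      ∀ (g : CQ.Vec n → Fin q → ℝ) (h : CQ.Vec n → Fin 0 → ℝ),
        CQ.KGEquiv g h (T.normalForm n q l₁ ε) CQ.noConstraint →
        ¬ CQ.LICQ g h ∧ (CQ.MFCQ g h ↔ 0 < l₁) ∧
        (0 < l₁ → CQ.ACQ g h ∧ CQ.GCQ g h) ∧
        (l₁ = 0 → (CQ.ACQ g h ↔ T.ACQCond n q ε) ∧ (CQ.GCQ g h ↔ T.GCQCond n q ε))) ∧
    -- Classes with one equality constraint and at least one inequality constraint.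
    (∀ (n : ℕ) (ε : ℕ → ℝ) (T : CQ.MixedType), (∀ j, CQ.IsSign (ε j)) → T.Admissible n →
      ∀ (g : CQ.Vec n → Fin T.numIneq → ℝ) (h : CQ.Vec n → Fin 1 → ℝ),
        CQ.KGEquiv g h (CQ.coords 0 T.numIneq) (CQ.single fun x => T.form ε x) →
        ¬ CQ.LICQ g h ∧ ¬ CQ.MFCQ g h ∧ ¬ CQ.ACQ g h ∧
        (CQ.GCQ g h ↔ T.GCQCond n ε)) := by
  refine ⟨fun n q r g h hg hh _ h0 => CQ.LICQ_iff_regular g h hg hh h0,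
    fun n q r g h hd hM => hd hM.1,
    fun n ε T hε hT g h hK => CQ.EqType.classification hε hT hK,
    fun n q l₁ ε T hε hT hl g h hK => CQ.IneqType.classification hε hT hl hK,
    fun n ε T hε hT g h hK => CQ.MixedType.classification hε hT hK⟩
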